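/- Let $(\overline M,J,\overline g)$ be an almost Hermitian manifold that is locally conformal K\"ahler: every point has an open neighbourhood $U$ with a smooth function $f$ on $U$ such that $e^{-f}\overline g|_U$ is K\"ahler (i.e. $J$ is parallel for its Levi-Civita connection). Let $\Omega(X,Y)=\overline g(X,JY)$, let $\omega$ be a Lee form, i.e. a closed smooth $1$-form with $d\Omega=\omega\wedge\Omega$, and let $B$ be the Lee vector field, $\overline g(X,B)=\omega(X)$. Let $M$ be a CR-submanifold of $\overline M$: an (immersed) submanifold with a smooth distribution $D\subset TM$ such that $JD=D$ and $JD^\perp\subset TM^\perp$, where $D^\perp$ is the orthogonal complement of $D$ in $TM$ and $TM^\perp$ is the normal bundle of $M$. Let $\mu$ be the orthogonal complement of $JD^\perp$ in $TM^\perp$, let $g$ be the induced metric on $M$, $h$ the second fundamental form of $M$ in $\overline M$, and, for a normal field $N$, let $a_N$ be the shape operator, $g(a_NX,Y)=\overline g(h(X,Y),N)$. The distribution $D^\perp$ is always integrable; let $\mathfrak F^\perp$ be the foliation of $M$ whose leaves are its maximal connected integral manifolds. A foliation is called totally geodesic if each of its leaves is a totally geodesic submanifold of $(M,g)$; a distribution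 $D'$ on $M$ is called $a_N$-invariant if $a_NX\in\Gamma(D')$ for every $X\in\Gamma(D')$. Suppose that $B$ is normal to $M$ at every point of $M$. Then the following assertions are equivalent: (i) the foliation $\mathfrak F^\perp$ is totally geodesic; (ii) $h(X,Y)\in\Gamma(\mu)$ for all $X\in\Gamma(D^\perp)$ and $Y\in\Gamma(D)$; (iii) $D^\perp$ is $a_N$-invariant for every $N\in\Gamma(JD^\perp)$; (iv) $D$ is $a_N$-invariant for every $N\in\Gamma(JD^\perp)$. -/

import Mathlib

open scoped Manifold ContDiff Topology

noncomputable section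

namespace LCK

/-! ### Riesz representation for a bilinear form -/

/-- The vector representing the functional `α` with respect to `b`, i.e. the vector `v` with
`b v w = α w` for all `w`; for positive definite `b` on a finite dimensional space and linear `α`
it exists (see `sharp_spec`) and is unique. -/
def sharp {V : Type*} [Zero V] (b : V → V → ℝ) (α : V → ℝ) : V :=
  open scoped Classical in if h : ∃ v, ∀ w, b v w = α w then h.choose else 0

theorem sharp_spec {V : Type*} [AddCommGroup V] [Module ℝ V] [FiniteDimensional ℝ V]
    (b : V →ₗ[ℝ] V →ₗ[ℝ] ℝ) (hb : ∀ v, v ≠ 0 → 0 < b v v) (α : V →ₗ[ℝ] ℝ) (w : V) :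
    b (sharp (fun x y => b x y) α) w = α w := by
  have hinj : Function.Injective b := by
    refine (injective_iff_map_eq_zero b).2 fun v hv => ?_
    by_contra hne
    have := hb v hne
    simp [hv] at this
  have hsurj : Function.Surjective b :=
    (LinearMap.injective_iff_surjective_of_finrank_eq_finrank
      (Subspace.dual_finrank_eq (K := ℝ) (V := V)).symm).1 hinj
  obtain ⟨v, hv⟩ := hsurj α
  have h : ∃ v, ∀ w, b v w = α w := ⟨v, fun w => by rw [hv]⟩
  unfold sharp
  rw [dif_pos h]
  exact h.choose_spec w

/-! ### Manifolds, tensor fields in charts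

All manifolds are smooth manifolds without boundary, modelled on a finite dimensional real vector
space `E`. Recall that Mathlib's tangent space at `p` is `E`, the identification being given by the
preferred chart at `p`. -/

section Charts

variable {E : Type*} [NormedAddCommGroup E] [NormedSpace ℝ E]
  {M : Type*} [TopologicalSpace M] [ChartedSpace E M]

/-- The tangent vector at the point with coordinate vector `z` in the preferred chart at `p`,
with components `u` in that chart. -/
def fromChart (p : M) (z u : E) :
    TangentSpace 𝓘(ℝ, E) ((extChartAt 𝓘(ℝ, E) p).symm z) :=
  mfderiv 𝓘(ℝ, E) 𝓘(ℝ, E) (extChartAt 𝓘(ℝ, E) p).symm z u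

/-- The components, in the preferred chart at `p`, of the tangent vector `v` at `q`. -/
def toChart (p q : M) (v : TangentSpace 𝓘(ℝ, E) q) : E :=
  mfderiv 𝓘(ℝ, E) 𝓘(ℝ, E) (extChartAt 𝓘(ℝ, E) p) q v

/-- At the centre `p` of the preferred chart, the components of a vector are the vector itself. -/
theorem toChart_self [IsManifold 𝓘(ℝ, E) ∞ M] (p : M) (v : TangentSpace 𝓘(ℝ, E) p) :
    toChart p p v = v := by
  have : IsManifold 𝓘(ℝ, E) 1 M := .of_le (n := ∞) (by norm_cast)
  have h := TangentBundle.continuousLinearMapAt_trivializationAt (𝕜 := ℝ) (I := 𝓘(ℝ, E))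
    (x₀ := p) (x := p) (mem_chart_source E p)
  unfold toChart
  rw [← h, TangentBundle.continuousLinearMapAt_trivializationAt_eq_core (mem_chart_source E p)]
  exact (tangentBundleCore 𝓘(ℝ, E) M).coordChange_self _ p
    (by simp) v

/-- The derivative at `p`, in the direction `u`, of the component functions `b(v, w)` of the
`2`-tensor field `b`, where `v`, `w` are constant in the preferred chart at `p`. -/
def partialDeriv (b : ∀ x : M, TangentSpace 𝓘(ℝ, E) x → TangentSpace 𝓘(ℝ, E) x → ℝ) (p : M)
    (u v w : E) : ℝ :=
  fderiv ℝ (fun z => b _ (fromChart p z v) (fromChart p z w)) (extChartAt 𝓘(ℝ, E) p p) u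

/-- The Christoffel symbol `Γ(u, v)` at `p` of the Levi-Civita connection of the Riemannian metric
`g`, computed in the preferred chart at `p`:
`2 g(Γ(u, v), w) = ∂_u g(v, w) + ∂_v g(u, w) - ∂_w g(u, v)`. -/
def christoffel (g : ∀ x : M, TangentSpace 𝓘(ℝ, E) x → TangentSpace 𝓘(ℝ, E) x → ℝ) (p : M)
    (u v : TangentSpace 𝓘(ℝ, E) p) : TangentSpace 𝓘(ℝ, E) p :=
  sharp (g p) fun w =>
    (partialDeriv g p u v w + partialDeriv g p v u w - partialDeriv g p w u v) / 2

/-- The exterior derivative `dα` at `p` of a `1`-form, computed in the preferred chart at `p`. -/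
def extDeriv₁ (α : ∀ x : M, TangentSpace 𝓘(ℝ, E) x →L[ℝ] ℝ) (p : M)
    (u v : TangentSpace 𝓘(ℝ, E) p) : ℝ :=
  fderiv ℝ (fun z => α _ (fromChart p z v)) (extChartAt 𝓘(ℝ, E) p p) u -
    fderiv ℝ (fun z => α _ (fromChart p z u)) (extChartAt 𝓘(ℝ, E) p p) v

/-- The exterior derivative `dΩ` at `p` of a `2`-form, computed in the preferred chart at `p`. -/
def extDeriv₂ (Ω : ∀ x : M, TangentSpace 𝓘(ℝ, E) x → TangentSpace 𝓘(ℝ, E) x → ℝ) (p : M)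
    (u v w : TangentSpace 𝓘(ℝ, E) p) : ℝ :=
  partialDeriv Ω p u v w + partialDeriv Ω p v w u + partialDeriv Ω p w u v

/-- Smoothness of a vector field on a set. -/
def SmoothFieldOn [IsManifold 𝓘(ℝ, E) ∞ M] (X : ∀ x : M, TangentSpace 𝓘(ℝ, E) x) (U : Set M) : Prop :=
  ContMDiffOn 𝓘(ℝ, E) 𝓘(ℝ, E).tangent ∞
    (fun x => (⟨x, X x⟩ : TangentBundle 𝓘(ℝ, E) M)) U

/-- `X ∈ Γ(TM)`: a smooth vector field on `M`. -/
def SmoothField [IsManifold 𝓘(ℝ, E) ∞ M] (X : ∀ x : M, TangentSpace 𝓘(ℝ, E) x) : Prop :=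
  SmoothFieldOn X Set.univ

/-- `D` is a smooth distribution on `M`: near every point it is spanned by smooth, pointwise
linearly independent vector fields. -/
def IsSmoothDistribution [IsManifold 𝓘(ℝ, E) ∞ M]
    (D : ∀ x : M, Submodule ℝ (TangentSpace 𝓘(ℝ, E) x)) : Prop :=
  ∀ p : M, ∃ U : Set M, IsOpen U ∧ p ∈ U ∧
    ∃ (r : ℕ) (X : Fin r → ∀ x : M, TangentSpace 𝓘(ℝ, E) x),
      (∀ a, SmoothFieldOn (X a) U) ∧
      ∀ q ∈ U, LinearIndependent ℝ (fun a => X a q) ∧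
        Submodule.span ℝ (Set.range fun a => X a q) = D q

end Charts

/-! ### Geometry of maps into a Riemannian manifold -/

section Maps

variable {E : Type*} [NormedAddCommGroup E] [NormedSpace ℝ E]
  {M : Type*} [TopologicalSpace M] [ChartedSpace E M]
  {F : Type*} [NormedAddCommGroup F] [NormedSpace ℝ F]
  {N : Type*} [TopologicalSpace N] [ChartedSpace F N]

/-- The differential of `φ : N → M` at `p`. -/
abbrev diff (φ : N → M) (p : N) :
    TangentSpace 𝓘(ℝ, F) p →L[ℝ] TangentSpace 𝓘(ℝ, E) (φ p) :=
  mfderiv 𝓘(ℝ, F) 𝓘(ℝ, E) φ p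

/-- `φ : N → M` is a smooth immersion. -/
structure IsSmoothImmersion (φ : N → M) : Prop where
  smooth : ContMDiff 𝓘(ℝ, F) 𝓘(ℝ, E) ∞ φ
  injective : ∀ p, Function.Injective (diff (E := E) (F := F) φ p)

/-- A smooth vector field along `φ`, i.e. a smooth section of the restriction of `TM` to `N`. -/
def SmoothAlong [IsManifold 𝓘(ℝ, E) ∞ M] (φ : N → M)
    (V : ∀ q : N, TangentSpace 𝓘(ℝ, E) (φ q)) : Prop :=
  ContMDiff 𝓘(ℝ, F) 𝓘(ℝ, E).tangent ∞
    (fun q => (⟨φ q, V q⟩ : TangentBundle 𝓘(ℝ, E) M))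

/-- The covariant derivative `∇_x V` at `p`, in the direction `x ∈ T_p N`, of a vector field `V`
along `φ : N → M`, with respect to the Levi-Civita connection of the metric `g` of `M`: the
derivative of the components of `V` in the preferred chart at `φ p`, plus `Γ(dφ x, V)`. For `φ` the
identity this is the covariant derivative of vector fields on `M`. -/
def covDeriv (g : ∀ x : M, TangentSpace 𝓘(ℝ, E) x → TangentSpace 𝓘(ℝ, E) x → ℝ)
    (φ : N → M) (V : ∀ q : N, TangentSpace 𝓘(ℝ, E) (φ q)) (p : N)
    (x : TangentSpace 𝓘(ℝ, F) p) : TangentSpace 𝓘(ℝ, E) (φ p) :=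
  (show TangentSpace 𝓘(ℝ, E) (φ p) from
    mvfderiv 𝓘(ℝ, F) (fun q => toChart (φ p) (φ q) (V q)) p x) +
    christoffel g (φ p) (diff φ p x) (V p)

/-- The metric on `N` induced by the metric `g` of `M` through `φ`. -/
def inducedMetric (g : ∀ x : M, TangentSpace 𝓘(ℝ, E) x → TangentSpace 𝓘(ℝ, E) x → ℝ)
    (φ : N → M) (p : N) (x y : TangentSpace 𝓘(ℝ, F) p) : ℝ :=
  g (φ p) (diff φ p x) (diff φ p y)

/-- The tangential component (as a vector of `T_p N`) of a vector of `T_{φ p} M`. -/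
def tangentialPart (g : ∀ x : M, TangentSpace 𝓘(ℝ, E) x → TangentSpace 𝓘(ℝ, E) x → ℝ)
    (φ : N → M) (p : N) (v : TangentSpace 𝓘(ℝ, E) (φ p)) : TangentSpace 𝓘(ℝ, F) p :=
  sharp (inducedMetric g φ p) fun y => g (φ p) v (diff φ p y)

/-- The second fundamental form `h(X, Y)` of the immersion `φ`: the normal component of
`∇_X (dφ Y)` (Gauss formula). -/
def secondFundamentalForm
    (g : ∀ x : M, TangentSpace 𝓘(ℝ, E) x → TangentSpace 𝓘(ℝ, E) x → ℝ)
    (φ : N → M) (X Y : ∀ q : N, TangentSpace 𝓘(ℝ, F) q) (p : N) :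
    TangentSpace 𝓘(ℝ, E) (φ p) :=
  covDeriv g φ (fun q => diff φ q (Y q)) p (X p) -
    diff φ p (tangentialPart (F := F) g φ p
      (covDeriv g φ (fun q => diff φ q (Y q)) p (X p)))

/-- The shape operator `a_ξ X` in the direction of a normal field `ξ`: minus the tangential
component of `∇_X ξ` (Weingarten formula). -/
def shapeOperator (g : ∀ x : M, TangentSpace 𝓘(ℝ, E) x → TangentSpace 𝓘(ℝ, E) x → ℝ)
    (φ : N → M) (ξ : ∀ q : N, TangentSpace 𝓘(ℝ, E) (φ q))
    (X : ∀ q : N, TangentSpace 𝓘(ℝ, F) q) (p : N) : TangentSpace 𝓘(ℝ, F) p :=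
  -tangentialPart g φ p (covDeriv g φ ξ p (X p))

/-- The immersed submanifold `φ : N → M` is totally geodesic in `(M, g)`: its second fundamental
form vanishes. -/
def IsTotallyGeodesic (F : Type*) [NormedAddCommGroup F] [NormedSpace ℝ F]
    {N : Type*} [TopologicalSpace N] [ChartedSpace F N] [IsManifold 𝓘(ℝ, F) ∞ N]
    (g : ∀ x : M, TangentSpace 𝓘(ℝ, E) x → TangentSpace 𝓘(ℝ, E) x → ℝ) (φ : N → M) : Prop :=
  ∀ X Y : ∀ q : N, TangentSpace 𝓘(ℝ, F) q, SmoothField X → SmoothField Y →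
    ∀ q, secondFundamentalForm g φ X Y q = 0

end Maps

/-! ### Foliations by integral manifolds of a distribution -/

section Foliation

universe u

/-- `j : L → M` is a connected integral manifold of the distribution `D`: an injectively immersed
connected submanifold with tangent space `D` at each of its points. -/
structure IsIntegralManifold {E : Type*} [NormedAddCommGroup E] [NormedSpace ℝ E]
    {M : Type*} [TopologicalSpace M] [ChartedSpace E M]
    (D : ∀ x : M, Submodule ℝ (TangentSpace 𝓘(ℝ, E) x))
    {k : ℕ} {L : Type*} [TopologicalSpace L] [ChartedSpace (EuclideanSpace ℝ (Fin k)) L]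
    (j : L → M) : Prop where
  connected : ConnectedSpace L
  injective : Function.Injective j
  immersion : IsSmoothImmersion (E := E) (F := EuclideanSpace ℝ (Fin k)) j
  tangent : ∀ q, LinearMap.range
    (diff (E := E) (F := EuclideanSpace ℝ (Fin k)) j q).toLinearMap = D (j q)

/-- The foliation of `(M, g)` given by the integrable distribution `D` is totally geodesic: the
leaves are totally geodesic submanifolds of `M`. Leaves are the maximal connected integral manifolds
of `D`; the condition is local and every connected integral manifold is an open piece of a leaf, so
it is required of all connected integral manifolds of `D`. -/
def IsTotallyGeodesicFoliation {E : Type*} [NormedAddCommGroup E] [NormedSpace ℝ E]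
    {M : Type u} [TopologicalSpace M] [ChartedSpace E M]
    (g : ∀ x : M, TangentSpace 𝓘(ℝ, E) x → TangentSpace 𝓘(ℝ, E) x → ℝ)
    (D : ∀ x : M, Submodule ℝ (TangentSpace 𝓘(ℝ, E) x)) : Prop :=
  ∀ (k : ℕ) (L : Type u) [TopologicalSpace L] [ChartedSpace (EuclideanSpace ℝ (Fin k)) L]
    [IsManifold 𝓘(ℝ, EuclideanSpace ℝ (Fin k)) ∞ L] (j : L → M),
    IsIntegralManifold (k := k) D j → IsTotallyGeodesic (EuclideanSpace ℝ (Fin k)) g j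

end Foliation

/-! ### Almost Hermitian and locally conformal Kähler manifolds -/

section Hermitian

/-- An almost Hermitian structure `(J, g)` on a smooth manifold. -/
structure AlmostHermitian (E : Type*) [NormedAddCommGroup E] [NormedSpace ℝ E]
    (M : Type*) [TopologicalSpace M] [ChartedSpace E M] [IsManifold 𝓘(ℝ, E) ∞ M] where
  /-- the Riemannian metric -/
  metric : Bundle.ContMDiffRiemannianMetric 𝓘(ℝ, E) ∞ E
    (fun x : M => TangentSpace 𝓘(ℝ, E) x)
  /-- the almost complex structure -/
  J : ∀ x : M, TangentSpace 𝓘(ℝ, E) x →L[ℝ] TangentSpace 𝓘(ℝ, E) x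
  smooth_J : ContMDiff 𝓘(ℝ, E) (𝓘(ℝ, E).prod 𝓘(ℝ, E →L[ℝ] E)) ∞
    (fun x => Bundle.TotalSpace.mk' (E →L[ℝ] E)
      (E := fun x : M => TangentSpace 𝓘(ℝ, E) x →L[ℝ] TangentSpace 𝓘(ℝ, E) x) x (J x))
  J_sq : ∀ (x : M) (v : TangentSpace 𝓘(ℝ, E) x), J x (J x v) = -v
  metric_J : ∀ (x : M) (v w : TangentSpace 𝓘(ℝ, E) x),
    metric.inner x (J x v) (J x w) = metric.inner x v w

variable {E : Type*} [NormedAddCommGroup E] [NormedSpace ℝ E]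
  {M : Type*} [TopologicalSpace M] [ChartedSpace E M] [IsManifold 𝓘(ℝ, E) ∞ M]

namespace AlmostHermitian

/-- The metric of an almost Hermitian manifold, as a field of bilinear functions. -/
def g (H : AlmostHermitian E M) (x : M) (v w : TangentSpace 𝓘(ℝ, E) x) : ℝ :=
  H.metric.inner x v w

/-- The Kähler form `Ω(X, Y) = g(X, JY)`. -/
def kahlerForm (H : AlmostHermitian E M) (x : M) (v w : TangentSpace 𝓘(ℝ, E) x) : ℝ :=
  H.g x v (H.J x w)

/-- The conformal metric `exp(-f) g` together with `J` is Kähler on the open set `U`: `J` is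
parallel, `∇J = 0` on `U`, for the Levi-Civita connection `∇` of `exp(-f) g`. -/
def IsConformalKahlerOn (H : AlmostHermitian E M) (f : M → ℝ) (U : Set M) : Prop :=
  ∀ p ∈ U, ∀ Y : ∀ x : M, TangentSpace 𝓘(ℝ, E) x,
    (∃ W : Set M, IsOpen W ∧ p ∈ W ∧ SmoothFieldOn Y W) → ∀ u : TangentSpace 𝓘(ℝ, E) p,
      covDeriv (F := E) (fun x v w => Real.exp (-f x) * H.g x v w) (fun x => x)
          (fun x => H.J x (Y x)) p u =
        H.J p (covDeriv (F := E) (fun x v w => Real.exp (-f x) * H.g x v w) (fun x => x) Y p u)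

/-- `(M, J, g)` is locally conformal Kähler. -/
def IsLCK (H : AlmostHermitian E M) : Prop :=
  ∀ p : M, ∃ U : Set M, IsOpen U ∧ p ∈ U ∧ ∃ f : M → ℝ,
    ContMDiffOn 𝓘(ℝ, E) 𝓘(ℝ, ℝ) ∞ f U ∧ H.IsConformalKahlerOn f U

/-- `lee` is a Lee form `ω`: a closed smooth `1`-form with `dΩ = ω ∧ Ω`. -/
structure IsLeeForm (H : AlmostHermitian E M)
    (lee : ∀ x : M, TangentSpace 𝓘(ℝ, E) x →L[ℝ] ℝ) : Prop where
  smooth : ContMDiff 𝓘(ℝ, E) (𝓘(ℝ, E).prod 𝓘(ℝ, E →L[ℝ] ℝ)) ∞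
    (fun x => Bundle.TotalSpace.mk' (E →L[ℝ] ℝ)
      (E := fun x : M => TangentSpace 𝓘(ℝ, E) x →L[ℝ] ℝ) x (lee x))
  closed : ∀ (p : M) (u v : TangentSpace 𝓘(ℝ, E) p), extDeriv₁ lee p u v = 0
  d_kahlerForm : ∀ (p : M) (u v w : TangentSpace 𝓘(ℝ, E) p),
    extDeriv₂ H.kahlerForm p u v w =
      lee p u * H.kahlerForm p v w + lee p v * H.kahlerForm p w u + lee p w * H.kahlerForm p u v

/-- The Lee vector field `B = ω^♯`, i.e. `g(B, X) = ω(X)`. -/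
def leeField (H : AlmostHermitian E M) (lee : ∀ x : M, TangentSpace 𝓘(ℝ, E) x →L[ℝ] ℝ) (x : M) :
    TangentSpace 𝓘(ℝ, E) x :=
  sharp (H.g x) (lee x)

end AlmostHermitian

end Hermitian

/-! ### CR-submanifolds -/

section CR

variable {E : Type*} [NormedAddCommGroup E] [NormedSpace ℝ E]
  {Mb : Type*} [TopologicalSpace Mb] [ChartedSpace E Mb] [IsManifold 𝓘(ℝ, E) ∞ Mb]
  {F : Type*} [NormedAddCommGroup F] [NormedSpace ℝ F]
  {M : Type*} [TopologicalSpace M] [ChartedSpace F M] [IsManifold 𝓘(ℝ, F) ∞ M]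

/-- The normal space of the submanifold `i : M → Mb` at `p`. -/
def normalSpace (F : Type*) [NormedAddCommGroup F] [NormedSpace ℝ F]
    {M : Type*} [TopologicalSpace M] [ChartedSpace F M]
    (H : AlmostHermitian E Mb) (i : M → Mb) (p : M) :
    Submodule ℝ (TangentSpace 𝓘(ℝ, E) (i p)) where
  carrier := {n | ∀ x : TangentSpace 𝓘(ℝ, F) p, H.g (i p) n (diff i p x) = 0}
  add_mem' := by
    intro a b ha hb x
    have h1 := ha x
    have h2 := hb x
    simp only [AlmostHermitian.g] at h1 h2 ⊢
    simp [h1, h2]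
  zero_mem' := by intro x; simp [AlmostHermitian.g]
  smul_mem' := by
    intro c a ha x
    have h1 := ha x
    simp only [AlmostHermitian.g] at h1 ⊢
    simp [h1]

/-- The orthogonal complement `D^⊥` of the distribution `D` in `TM`. -/
def orthDist (H : AlmostHermitian E Mb) (i : M → Mb)
    (D : ∀ p : M, Submodule ℝ (TangentSpace 𝓘(ℝ, F) p)) (p : M) :
    Submodule ℝ (TangentSpace 𝓘(ℝ, F) p) where
  carrier := {y | ∀ x ∈ D p, inducedMetric H.g i p x y = 0}
  add_mem' := by
    intro a b ha hb x hx
    have h1 := ha x hx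
    have h2 := hb x hx
    simp only [inducedMetric, AlmostHermitian.g] at h1 h2 ⊢
    simp [h1, h2]
  zero_mem' := by intro x _; simp [inducedMetric, AlmostHermitian.g]
  smul_mem' := by
    intro c a ha x hx
    have h1 := ha x hx
    simp only [inducedMetric, AlmostHermitian.g] at h1 ⊢
    simp [h1]

/-- The bundle `J D' ⊂ T Mb` along `M`, for a distribution `D'` on `M`. -/
def JDist (H : AlmostHermitian E Mb) (i : M → Mb)
    (D' : ∀ p : M, Submodule ℝ (TangentSpace 𝓘(ℝ, F) p)) (p : M) :
    Submodule ℝ (TangentSpace 𝓘(ℝ, E) (i p)) :=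
  (D' p).map ((H.J (i p)).comp (diff (E := E) (F := F) i p)).toLinearMap

/-- The bundle `μ`: the orthogonal complement of `J D^⊥` in the normal bundle of `M`. -/
def muBundle (H : AlmostHermitian E Mb) (i : M → Mb)
    (D : ∀ p : M, Submodule ℝ (TangentSpace 𝓘(ℝ, F) p)) (p : M) :
    Set (TangentSpace 𝓘(ℝ, E) (i p)) :=
  {n | n ∈ normalSpace F H i p ∧ ∀ m ∈ JDist H i (orthDist H i D) p, H.g (i p) n m = 0}

/-- `i : M → Mb`, with the distribution `D` on `M`, is a CR-submanifold of the almost Hermitian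
manifold `(Mb, J, g)`: `D` is smooth and holomorphic, `D^⊥` is totally real. -/
structure IsCRSubmanifold (H : AlmostHermitian E Mb) (i : M → Mb)
    (D : ∀ p : M, Submodule ℝ (TangentSpace 𝓘(ℝ, F) p)) : Prop where
  immersion : IsSmoothImmersion (E := E) (F := F) i
  smooth : IsSmoothDistribution D
  holomorphic : ∀ p,
    JDist H i D p = (D p).map (diff (E := E) (F := F) i p).toLinearMap
  totallyReal : ∀ p, JDist H i (orthDist H i D) p ≤ normalSpace F H i p

/-- `X ∈ Γ(D')` : a smooth vector field on `M` with values in the distribution `D'`. -/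
def IsSection (D' : ∀ p : M, Submodule ℝ (TangentSpace 𝓘(ℝ, F) p))
    (X : ∀ p : M, TangentSpace 𝓘(ℝ, F) p) : Prop :=
  SmoothField X ∧ ∀ p, X p ∈ D' p

/-- `ξ ∈ Γ(J D')` : a smooth vector field along `i : M → Mb` with values in `J D'`. -/
def IsSectionJ (H : AlmostHermitian E Mb) (i : M → Mb)
    (D' : ∀ p : M, Submodule ℝ (TangentSpace 𝓘(ℝ, F) p))
    (ξ : ∀ p : M, TangentSpace 𝓘(ℝ, E) (i p)) : Prop :=
  SmoothAlong (F := F) (E := E) i ξ ∧ ∀ p, ξ p ∈ JDist H i D' p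

/-- The distribution `D'` is `a_ξ`-invariant: `a_ξ X` takes values in `D'` for all
`X ∈ Γ(D')`. -/
def IsShapeInvariant (H : AlmostHermitian E Mb) (i : M → Mb)
    (ξ : ∀ p : M, TangentSpace 𝓘(ℝ, E) (i p))
    (D' : ∀ p : M, Submodule ℝ (TangentSpace 𝓘(ℝ, F) p)) : Prop :=
  ∀ X, IsSection D' X → ∀ p, shapeOperator H.g i ξ X p ∈ D' p

end CR

end LCK

end

/-!
All four conditions are equivalent to one pointwise condition, `LCK.MixedVanishing`: at every point,
`g(∇di(x, z), J di y) = 0` for `x, y ∈ D^⊥` and `z ∈ D`, where `∇di` is the Hessian of the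
immersion `i`, a symmetric form whose normal part is the second fundamental form `h`.

* The condition on `h(X, Y)` is the pointwise condition by definition of `μ`, since `J D^⊥` is
  normal. For the shape operators, differentiating `g(ξ, di Z) = 0` gives the Weingarten formula
  `g(a_ξ X, Z) = g(∇di(X, Z), ξ)` (`LCK.formE_covDerivE_of_normal`); invariance of `D^⊥` and of `D`
  are then the same condition read with the two arguments exchanged. To return from fields to
  vectors, every vector of `D` or `D^⊥` is extended to a global section.

* Let `X`, `Y` be tangent to a leaf of `D^⊥` and let `z ∈ D`, `di z = J di z'`. Then
  `g(∇_X Y, J z') = -g(J ∇_X Y, z') = -g(∇_X (J Y), z') + g((∇_X J) Y, z')`, and the first term is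
  `g(J Y, ∇di(X, z'))` because `J Y` is normal. So the leaf is totally geodesic exactly under the
  pointwise condition, provided that the last term vanishes.

* If `exp(-f) g` is Kähler, `(∇_X J) Y` is an explicit expression in `df`, and `dΩ = df ∧ Ω`
  (`LCK.AlmostHermitian.IsLCK.exists_nablaJ`). Comparing with `dΩ = ω ∧ Ω` on the vectors
  `z, y, J y` shows that `df = ω` on `D` wherever `D^⊥ ≠ 0`, and `ω` vanishes on `D` because the Lee
  vector field is normal. This kills the `D`-component of `(∇_X J) Y` for `X, Y ∈ D^⊥`
  (`LCK.IsCRSubmanifold.formE_nablaJ_eq_zero`).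

* That total geodesy of the foliation implies the pointwise condition needs a leaf through every
  point (`LCK.IsCRSubmanifold.exists_isIntegralManifold`). The distribution `D^⊥` is the kernel of
  `i^*Ω`, and `i^*(ω ∧ Ω)` vanishes when two of its arguments lie in this kernel, so `D^⊥` is
  involutive; a frame normalised by a fixed projection commutes
  (`LCK.IsCRSubmanifold.exists_commuting_frame`), and flowing along constant combinations of it
  parametrises a leaf (`LCK.exists_hasFDerivAt_of_commuting`).

All computations take place in the preferred charts, where a tangent space is the model space.
-/


noncomputable section

namespace LCK

set_option linter.unusedSectionVars false

/-! ### Maps with prescribed commuting derivative -/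

section Frobenius

open Metric Set Filter Asymptotics

variable {F : Type*} [NormedAddCommGroup F] [NormedSpace ℝ F]
  {K : Type*} [NormedAddCommGroup K] [NormedSpace ℝ K]

/-- Uniform bounds for `B`, its derivative and its first two Taylor remainders on a small ball, on
which a given local property `P` holds as well. -/
theorem exists_closedBall_taylor_bound {G : Type*} [NormedAddCommGroup G] [NormedSpace ℝ G]
    {B : F → G} {x₀ : F} (hB : ContDiffAt ℝ 2 B x₀) {P : F → Prop} (hP : ∀ᶠ x in 𝓝 x₀, P x) :
    ∃ ρ > 0, ∃ C > 0, ∀ x ∈ closedBall x₀ ρ, P x ∧ DifferentiableAt ℝ B x ∧ ‖B x‖ ≤ C ∧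
      ‖fderiv ℝ B x‖ ≤ C ∧ ∀ y ∈ closedBall x₀ ρ,
        ‖B y - B x‖ ≤ C * ‖y - x‖ ∧ ‖B y - B x - fderiv ℝ B x (y - x)‖ ≤ C * ‖y - x‖ ^ 2 := by
  have hB1 : ContDiffAt ℝ 1 (fderiv ℝ B) x₀ := hB.fderiv_right (by norm_num)
  obtain ⟨K₂, s, hs, hLip⟩ := hB1.exists_lipschitzOnWith
  have hd : ∀ᶠ x in 𝓝 x₀, DifferentiableAt ℝ B x :=
    (hB.eventually (by simp)).mono fun x hx => hx.differentiableAt (by norm_num)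
  have hb0 : ∀ᶠ x in 𝓝 x₀, ‖B x‖ < ‖B x₀‖ + 1 :=
    hB.continuousAt.norm.eventually (gt_mem_nhds (by linarith))
  have hb1 : ∀ᶠ x in 𝓝 x₀, ‖fderiv ℝ B x‖ < ‖fderiv ℝ B x₀‖ + 1 :=
    hB1.continuousAt.norm.eventually (gt_mem_nhds (by linarith))
  obtain ⟨ρ, hρ, hball⟩ := nhds_basis_closedBall.eventually_iff.1
    (hP.and (hd.and (hb0.and (hb1.and hs))))
  refine ⟨ρ, hρ, ‖B x₀‖ + ‖fderiv ℝ B x₀‖ + 1 + K₂, by positivity, fun x hx => ?_⟩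
  obtain ⟨h1, h2, h3, h4, h5⟩ := hball hx
  have n1 := norm_nonneg (B x₀)
  have n2 := norm_nonneg (fderiv ℝ B x₀)
  refine ⟨h1, h2, by linarith [K₂.coe_nonneg], by linarith [K₂.coe_nonneg], fun y hy => ⟨?_, ?_⟩⟩
  · refine (convex_closedBall x₀ ρ).norm_image_sub_le_of_norm_fderiv_le (𝕜 := ℝ)
      (fun z hz => (hball hz).2.1) (fun z hz => ?_) hx hy
    have := (hball hz).2.2.2.1
    linarith [K₂.coe_nonneg]
  · have hseg : segment ℝ x y ⊆ closedBall x₀ ρ := (convex_closedBall x₀ ρ).segment_subset hx hy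
    have := (convex_segment x y).norm_image_sub_le_of_norm_hasFDerivWithin_le' (𝕜 := ℝ) (f := B)
      (f' := fderiv ℝ B) (φ := fderiv ℝ B x) (C := K₂ * ‖y - x‖)
      (fun z hz => (hball (hseg hz)).2.1.hasFDerivAt.hasFDerivWithinAt)
      (fun z hz => ?_) (left_mem_segment ℝ x y) (right_mem_segment ℝ x y)
    · refine this.trans ?_
      have : 0 ≤ ‖y - x‖ ^ 2 := by positivity
      nlinarith
    · refine (hLip.norm_sub_le (hball (hseg hz)).2.2.2.2 h5).trans ?_
      gcongr
      have := norm_sub_le_of_mem_segment hz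
      simpa using this

/-- A Lipschitz vector field bounded by `a` on the ball of radius `a` has an integral curve that
stays in this ball during the time interval `[0, 1]`. -/
theorem exists_hasDerivWithinAt_mem_closedBall [CompleteSpace F] {v : F → F} {x₀ : F} {a C : ℝ}
    (ha : 0 ≤ a) (hC : 0 ≤ C) (hv : ∀ x ∈ closedBall x₀ a, ∀ y ∈ closedBall x₀ a,
      ‖v y - v x‖ ≤ C * ‖y - x‖) (hb : ∀ x ∈ closedBall x₀ a, ‖v x‖ ≤ a) :
    ∃ y : ℝ → F, y 0 = x₀ ∧ (∀ t, y t ∈ closedBall x₀ a) ∧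
      ∀ t ∈ Icc (0 : ℝ) 1, HasDerivWithinAt y (v (y t)) (Icc 0 1) t := by
  lift a to NNReal using ha
  lift C to NNReal using hC
  have hpl : IsPicardLindelof (fun _ => v) (tmin := 0) (tmax := 1) ⟨0, by simp⟩ x₀ a 0 a C := by
    refine ⟨fun t _ => ?_, fun x _ => continuousOn_const, fun t _ x hx => hb x hx, ?_⟩
    · exact LipschitzOnWith.of_dist_le_mul fun x hx y hy => by
        rw [dist_eq_norm, dist_eq_norm]; exact hv y hy x hx
    · simp
  have hx : x₀ ∈ closedBall x₀ (0 : NNReal) := by simp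
  obtain ⟨α, hα⟩ := ODE.FunSpace.exists_isFixedPt_next hpl hx
  have hα' := (ODE.FunSpace.isFixedPt_next_iff hpl hx).1 hα
  refine ⟨α.compProj, ?_, fun t => α.compProj_mem_closedBall hpl.mul_max_le, fun t ht => ?_⟩
  · have := hα' ⟨0, by simp⟩
    rw [ODE.FunSpace.compProj_of_mem (t := 0) (by simp), this]
    simp
  · have := ODE.hasDerivWithinAt_picard_Icc (f := fun _ => v) (u := closedBall x₀ a) (t₀ := 0)
      (tmin := 0) (tmax := 1) (by simp) hpl.continuousOn_uncurry
      (α.continuous_compProj.continuousOn)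
      (fun t _ => α.compProj_mem_closedBall hpl.mul_max_le) x₀ ht
    refine this.congr (fun t ht => ?_) ?_
    · rw [ODE.FunSpace.compProj_of_mem ht, hα']
    · rw [ODE.FunSpace.compProj_of_mem ht, hα']

/-- Frobenius theorem for commuting frames. If the vector fields `x ↦ B x a` commute, there is a map
`f` with `f 0 = x₀` and derivative `B (f s)` at each `s` near `0`. The map is `f s = y s 1`, where
`y s` is the integral curve of `x ↦ B x s` from `x₀`; that its derivative is as required follows by
comparing `y (s + v)` with `t ↦ y s t + t B(y s t) v` through Grönwall's inequality. -/
theorem exists_hasFDerivAt_of_commuting [CompleteSpace F] {B : F → K →L[ℝ] F} {x₀ : F}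
    (hB : ContDiffAt ℝ 2 B x₀)
    (hsymm : ∀ᶠ x in 𝓝 x₀, ∀ a b, fderiv ℝ B x (B x a) b = fderiv ℝ B x (B x b) a)
    {P : F → Prop} (hP : ∀ᶠ x in 𝓝 x₀, P x) :
    ∃ r > 0, ∃ f : K → F, f 0 = x₀ ∧
      ∀ s ∈ ball (0 : K) r, P (f s) ∧ HasFDerivAt f (B (f s)) s := by
  obtain ⟨ρ, hρ, C, hC, H⟩ := exists_closedBall_taylor_bound hB (hsymm.and hP)
  set r : ℝ := min (ρ / (2 * C)) 1 with hr
  have hr0 : 0 < r := lt_min (by positivity) one_pos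
  have hrC : C * r ≤ ρ / 2 := by
    calc C * r ≤ C * (ρ / (2 * C)) := by gcongr; exact min_le_left _ _
      _ = ρ / 2 := by field_simp
  have hr1 : r ≤ 1 := min_le_right _ _
  have hsub : closedBall x₀ (ρ / 2) ⊆ closedBall x₀ ρ := closedBall_subset_closedBall (by linarith)
  have hLip : ∀ s ∈ ball (0 : K) r, ∀ x ∈ closedBall x₀ ρ, ∀ y ∈ closedBall x₀ ρ,
      ‖B y s - B x s‖ ≤ C * ‖y - x‖ := fun s hs x hx y hy => by
    have h1 : ‖s‖ ≤ 1 := by have := mem_ball_zero_iff.1 hs; linarith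
    calc ‖B y s - B x s‖ = ‖(B y - B x) s‖ := by simp
      _ ≤ ‖B y - B x‖ * ‖s‖ := ContinuousLinearMap.le_opNorm _ _
      _ ≤ ‖B y - B x‖ * 1 := by gcongr
      _ ≤ C * ‖y - x‖ := by rw [mul_one]; exact ((H x hx).2.2.2.2 y hy).1
  have hex : ∀ s : K, ∃ y : ℝ → F, s ∈ ball (0 : K) r → y 0 = x₀ ∧
      (∀ t, y t ∈ closedBall x₀ (ρ / 2)) ∧
      ∀ t ∈ Icc (0 : ℝ) 1, HasDerivWithinAt y (B (y t) s) (Icc 0 1) t := by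
    intro s
    by_cases hs : s ∈ ball (0 : K) r
    · obtain ⟨y, hy⟩ := exists_hasDerivWithinAt_mem_closedBall (v := fun x => B x s) (x₀ := x₀)
        (a := ρ / 2) (C := C) (by positivity) hC.le
        (fun x hx y hy => hLip s hs x (hsub hx) y (hsub hy)) (fun x hx => by
          calc ‖B x s‖ ≤ ‖B x‖ * ‖s‖ := ContinuousLinearMap.le_opNorm _ _
            _ ≤ C * r := by
              gcongr
              · exact (H x (hsub hx)).2.2.1
              · exact (mem_ball_zero_iff.1 hs).le
            _ ≤ ρ / 2 := hrC)
      exact ⟨y, fun _ => hy⟩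
    · exact ⟨0, fun h => absurd h hs⟩
  choose y hy using hex
  refine ⟨r, hr0, fun s => y s 1, ?_, fun s hs => ⟨?_, ?_⟩⟩
  · obtain ⟨h0, -, h2⟩ := hy 0 (mem_ball_self hr0)
    have := constant_of_has_deriv_right_zero (a := 0) (b := 1)
      (fun t ht => (h2 t ht).continuousWithinAt)
      (fun t ht => by
        have := (h2 t ⟨ht.1, ht.2.le⟩)
        rw [map_zero] at this
        exact this.mono_of_mem_nhdsWithin (Icc_mem_nhdsGE_of_mem ht))
    exact (this 1 (by simp)).trans h0
  · exact (H _ (hsub ((hy s hs).2.1 1))).1.2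
  · obtain ⟨y0, ymem, yder⟩ := hy s hs
    -- Since the fields commute, `y s t + t B(y s t) v` solves the equation of the ray `s + v` up to
    -- an error of order `‖v‖ ^ 2`.
    have key : ∀ v ∈ ball (0 : K) (r - ‖s‖),
        ‖y (s + v) 1 - y s 1 - B (y s 1) v‖ ≤
          ((C ^ 3 + C ^ 2) / C * (Real.exp (C * 1) - 1)) * ‖v‖ ^ 2 := by
      intro v hv
      have hvr : ‖v‖ < r - ‖s‖ := mem_ball_zero_iff.1 hv
      have hsv : ‖s + v‖ < r := (norm_add_le _ _).trans_lt (by linarith)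
      have hsv' : s + v ∈ ball (0 : K) r := mem_ball_zero_iff.2 hsv
      obtain ⟨w0, wmem, wder⟩ := hy (s + v) hsv'
      have hvr' : ‖v‖ ≤ r := by linarith [norm_nonneg s]
      have hBv : ∀ t, ‖B (y s t) v‖ ≤ C * ‖v‖ := fun t =>
        ((B (y s t)).le_opNorm v).trans (by gcongr; exact (H _ (hsub (ymem t))).2.2.1)
      have hz : ∀ t ∈ Icc (0 : ℝ) 1, y s t + t • B (y s t) v ∈ closedBall x₀ ρ := by
        intro t ht
        have h1 := mem_closedBall_iff_norm.1 (ymem t)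
        refine mem_closedBall_iff_norm.2 ?_
        calc ‖y s t + t • B (y s t) v - x₀‖ = ‖(y s t - x₀) + t • B (y s t) v‖ := by congr 1; abel
          _ ≤ ‖y s t - x₀‖ + ‖t • B (y s t) v‖ := norm_add_le _ _
          _ ≤ ρ / 2 + 1 * (C * ‖v‖) := by
            rw [norm_smul, Real.norm_of_nonneg ht.1]
            gcongr
            · exact ht.2
            · exact hBv t
          _ ≤ ρ / 2 + C * r := by rw [one_mul]; gcongr
          _ ≤ ρ := by linarith
      have hzder : ∀ t ∈ Icc (0 : ℝ) 1, HasDerivWithinAt (fun t => y s t + t • B (y s t) v)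
          (B (y s t) s + (t • fderiv ℝ B (y s t) (B (y s t) s) v + (1 : ℝ) • B (y s t) v))
          (Icc 0 1) t := by
        intro t ht
        have h1 := ((H _ (hsub (ymem t))).2.1.hasFDerivAt.comp_hasDerivWithinAt t (yder t ht))
        have h2 := h1.clm_apply (hasDerivWithinAt_const t (Icc 0 1) v)
        have h3 := (hasDerivWithinAt_id t (Icc 0 1)).smul h2
        simpa using! (yder t ht).add h3
      have hIci : ∀ t ∈ Ico (0 : ℝ) 1, Icc (0 : ℝ) 1 ∈ 𝓝[≥] t := fun t ht =>
        Icc_mem_nhdsGE_of_mem ht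
      have hgr := dist_le_of_approx_trajectories_ODE_of_mem (K := C.toNNReal) (a := 0) (b := 1)
        (v := fun _ x => B x (s + v)) (s := fun _ => closedBall x₀ ρ) (δ := 0) (εg := 0)
        (εf := (C ^ 3 + C ^ 2) * ‖v‖ ^ 2)
        (f := fun t => y s t + t • B (y s t) v) (g := y (s + v))
        (f' := fun t => B (y s t) s + (t • fderiv ℝ B (y s t) (B (y s t) s) v +
          (1 : ℝ) • B (y s t) v))
        (g' := fun t => B (y (s + v) t) (s + v))
        (fun t _ => LipschitzOnWith.of_dist_le_mul fun x hx y hy => by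
          rw [dist_eq_norm, dist_eq_norm, Real.coe_toNNReal C hC.le]
          exact hLip _ hsv' y hy x hx)
        (fun t ht => (hzder t ht).continuousWithinAt)
        (fun t ht => (hzder t ⟨ht.1, ht.2.le⟩).mono_of_mem_nhdsWithin (hIci t ht))
        (fun t ht => ?_)
        (fun t ht => hz t ⟨ht.1, ht.2.le⟩)
        (fun t ht => (wder t ht).continuousWithinAt)
        (fun t ht => (wder t ⟨ht.1, ht.2.le⟩).mono_of_mem_nhdsWithin (hIci t ht))
        (fun t ht => by simp) (fun t _ => hsub (wmem t)) (by simp [y0, w0]) 1 (by simp)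
      · rw [Real.coe_toNNReal C hC.le, gronwallBound_of_K_ne_0 hC.ne', dist_eq_norm] at hgr
        rw [← norm_neg]
        refine le_trans (le_of_eq ?_) (hgr.trans (le_of_eq ?_))
        · congr 1; simp only [one_smul]; abel
        · simp; ring
      · have ht' : t ∈ Icc (0 : ℝ) 1 := ⟨ht.1, ht.2.le⟩
        obtain ⟨⟨hs1, -⟩, -, -, hD, hT⟩ := H _ (hsub (ymem t))
        have hR := (hT _ (hz t ht')).2
        rw [dist_eq_norm]
        set Y := y s t with hY
        have hs2 := hs1 s v
        have hn : ‖t • B Y v‖ ≤ C * ‖v‖ := by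
          rw [norm_smul, Real.norm_of_nonneg ht.1]
          calc t * ‖B Y v‖ ≤ 1 * (C * ‖v‖) := by gcongr; exacts [ht.2.le, hBv t]
            _ = _ := one_mul _
        have e : B Y s + (t • fderiv ℝ B Y (B Y s) v + (1 : ℝ) • B Y v) -
            B (Y + t • B Y v) (s + v) =
            -((B (Y + t • B Y v) - B Y - fderiv ℝ B Y (Y + t • B Y v - Y)) (s + v)) -
              fderiv ℝ B Y (t • B Y v) v := by
          rw [hs2]
          simp only [add_sub_cancel_left, map_add, map_smul, sub_apply,
            smul_apply, one_smul]
          abel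
        rw [e]
        have b1 : ‖(B (Y + t • B Y v) - B Y - fderiv ℝ B Y (Y + t • B Y v - Y)) (s + v)‖ ≤
            C * (C * ‖v‖) ^ 2 * 1 := by
          refine (ContinuousLinearMap.le_opNorm _ _).trans ?_
          gcongr
          · refine hR.trans ?_
            rw [add_sub_cancel_left]
            gcongr
          · linarith
        have b2 : ‖fderiv ℝ B Y (t • B Y v) v‖ ≤ C * (C * ‖v‖) * ‖v‖ := by
          refine (ContinuousLinearMap.le_opNorm _ _).trans ?_
          gcongr
          refine (ContinuousLinearMap.le_opNorm _ _).trans ?_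
          gcongr
        calc _ ≤ _ := norm_sub_le _ _
          _ ≤ C * (C * ‖v‖) ^ 2 * 1 + C * (C * ‖v‖) * ‖v‖ := by rw [norm_neg]; gcongr
          _ = _ := by ring
    rw [hasFDerivAt_iff_isLittleO_nhds_zero]
    have hO : (fun v => y (s + v) 1 - y s 1 - B (y s 1) v) =O[𝓝 0] fun v : K => ‖v‖ ^ 2 :=
      IsBigO.of_bound _ (by
        filter_upwards [ball_mem_nhds (0 : K) (sub_pos.2 (mem_ball_zero_iff.1 hs))]
          with v hv
        simpa using key v hv)
    refine hO.trans_isLittleO ?_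
    simpa using isLittleO_norm_pow_id (E' := K) (n := 2) (by norm_num)

/-- A solution of `f' = B ∘ f` is as smooth as `B`. -/
theorem contDiffOn_of_hasFDerivAt_comp {B : F → K →L[ℝ] F} {f : K → F} {s : Set K}
    (hs : IsOpen s) {n : ℕ∞} (hB : ∀ a ∈ s, ContDiffAt ℝ n B (f a))
    (hf : ∀ a ∈ s, HasFDerivAt f (B (f a)) a) : ContDiffOn ℝ n f s := by
  have hnat : ∀ m : ℕ, (m : ℕ∞) ≤ n → ContDiffOn ℝ m f s := by
    intro m
    induction m with
    | zero =>
      intro _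
      exact contDiffOn_zero.2 fun a ha => (hf a ha).continuousAt.continuousWithinAt
    | succ m ih =>
      intro hm
      have hm' : (m : ℕ∞) ≤ n := le_trans (by exact_mod_cast Nat.le_succ m) hm
      have h := ih hm'
      rw [show ((m + 1 : ℕ) : WithTop ℕ∞) = (m : WithTop ℕ∞) + 1 by push_cast; rfl,
        contDiffOn_succ_iff_fderiv_of_isOpen hs]
      refine ⟨fun a ha => (hf a ha).differentiableAt.differentiableWithinAt, by simp, ?_⟩
      refine ContDiffOn.congr (f := fun a => B (f a)) (fun a ha => ?_) fun a ha => (hf a ha).fderiv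
      exact ((hB a ha).of_le (by exact_mod_cast hm')).comp_contDiffWithinAt a (h a ha)
  exact contDiffOn_iff_forall_nat_le.2 hnat

end Frobenius

/-! ### Smooth frames of kernels of constant rank -/

section KernelFrame

open Module Filter

/-- The kernels of a smooth family of linear maps of constant rank have a smooth frame `B`,
normalised by `π (B x a) = a` for a fixed projection `π`. With `F = ker (A x₀) ⊕ C` and `P` a left
inverse of `A x₀` on `C`, the frame is `v - (P ∘ A x |_C)⁻¹ (P (A x v))` for `v ∈ ker (A x₀)`, which
spans a space containing `ker (A x)` and of the same dimension. -/
theorem exists_contDiffAt_frame_ker {X F G : Type*} [NormedAddCommGroup X] [NormedSpace ℝ X]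
    [NormedAddCommGroup F] [NormedSpace ℝ F] [FiniteDimensional ℝ F]
    [NormedAddCommGroup G] [NormedSpace ℝ G] [FiniteDimensional ℝ G] {n : WithTop ℕ∞}
    {A : X → F →L[ℝ] G} {x₀ : X} (hA : ∀ᶠ x in 𝓝 x₀, ContDiffAt ℝ n A x)
    (hrank : ∀ᶠ x in 𝓝 x₀,
      finrank ℝ (LinearMap.ker (A x).toLinearMap) = finrank ℝ (LinearMap.ker (A x₀).toLinearMap)) :
    ∃ (k : ℕ) (B : X → EuclideanSpace ℝ (Fin k) →L[ℝ] F) (π : F →L[ℝ] EuclideanSpace ℝ (Fin k)),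
      ∀ᶠ x in 𝓝 x₀, ContDiffAt ℝ n B x ∧ (∀ a, π (B x a) = a) ∧
        LinearMap.range (B x).toLinearMap = LinearMap.ker (A x).toLinearMap := by
  set K := LinearMap.ker (A x₀).toLinearMap with hK
  obtain ⟨C, hC⟩ := K.exists_isCompl
  have hinj : LinearMap.ker ((A x₀).toLinearMap ∘ₗ C.subtype) = ⊥ := by
    refine LinearMap.ker_eq_bot'.2 fun c hc => ?_
    have : (c : F) ∈ K ⊓ C := ⟨hc, c.2⟩
    rw [hC.inf_eq_bot] at this
    exact Subtype.ext this
  obtain ⟨P, hP⟩ := LinearMap.exists_leftInverse_of_injective _ hinj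
  let θ : X → F →L[ℝ] C := fun x => P.toContinuousLinearMap ∘L A x
  let T : X → C →L[ℝ] C := fun x => θ x ∘L C.subtypeL
  have hθ : ∀ x, ContDiffAt ℝ n A x → ContDiffAt ℝ n θ x := fun x hx =>
    contDiffAt_const.clm_comp hx
  have hT : ∀ x, ContDiffAt ℝ n A x → ContDiffAt ℝ n T x := fun x hx =>
    (hθ x hx).clm_comp contDiffAt_const
  have hT0 : T x₀ = (ContinuousLinearEquiv.refl ℝ C : C →L[ℝ] C) := by
    ext c
    exact congrArg Subtype.val (LinearMap.congr_fun hP c)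
  have hev : ∀ᶠ x in 𝓝 x₀, ∃ e : C ≃L[ℝ] C, (e : C →L[ℝ] C) = T x := by
    have h := (ContinuousLinearEquiv.refl ℝ C).nhds
    rw [← hT0] at h
    exact (hT x₀ hA.self_of_nhds).continuousAt.eventually h
  let e : EuclideanSpace ℝ (Fin (finrank ℝ K)) ≃L[ℝ] K :=
    ContinuousLinearEquiv.ofFinrankEq (by simp)
  let ι : EuclideanSpace ℝ (Fin (finrank ℝ K)) →L[ℝ] F := K.subtypeL ∘L e
  let B : X → EuclideanSpace ℝ (Fin (finrank ℝ K)) →L[ℝ] F := fun x =>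
    ι - C.subtypeL ∘L (T x).inverse ∘L θ x ∘L ι
  let π : F →L[ℝ] EuclideanSpace ℝ (Fin (finrank ℝ K)) :=
    e.symm.toContinuousLinearMap ∘L (K.projectionOnto C hC).toContinuousLinearMap
  refine ⟨finrank ℝ K, B, π, ?_⟩
  filter_upwards [hev, hrank, hA] with x ⟨E, hE⟩ hr hx
  have hTinv : ContDiffAt ℝ n (fun x => (T x).inverse) x := by
    refine ContDiffAt.comp x (g := ContinuousLinearMap.inverse) ?_ (hT x hx)
    rw [← hE]
    exact contDiffAt_map_inverse _
  refine ⟨contDiffAt_const.sub (contDiffAt_const.clm_comp (hTinv.clm_comp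
    ((hθ x hx).clm_comp contDiffAt_const))), ?_⟩
  have hπ : ∀ a, π (B x a) = a := by
    intro a
    have h1 : K.projectionOnto C hC (e a : F) = e a := Submodule.projectionOnto_apply_left hC _
    have h2 : ∀ c : C, K.projectionOnto C hC (c : F) = 0 := fun c =>
      Submodule.projectionOnto_apply_right hC c
    simp [π, B, ι, h1, h2]
  refine ⟨hπ, ?_⟩
  have hle : LinearMap.ker (A x).toLinearMap ≤ LinearMap.range (B x).toLinearMap := by
    intro v hv
    have hv' : A x v = 0 := hv
    obtain ⟨a, c, rfl⟩ : ∃ (a : K) (c : C), (a : F) + c = v := by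
      have : v ∈ K ⊔ C := by rw [hC.sup_eq_top]; trivial
      obtain ⟨a, ha, c, hc, h⟩ := Submodule.mem_sup.1 this
      exact ⟨⟨a, ha⟩, ⟨c, hc⟩, h⟩
    have h1 : θ x a + E c = 0 := by
      have : θ x (a + c) = 0 := by
        change P (A x (a + c)) = 0
        rw [hv', map_zero]
      rw [map_add] at this
      have h2 : E c = T x c := congrArg (fun S : C →L[ℝ] C => S c) hE
      rw [h2]
      exact this
    have h3 : (T x).inverse (θ x a) = -c := by
      rw [← hE, ContinuousLinearMap.inverse_equiv, eq_neg_of_add_eq_zero_left h1]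
      simp
    refine ⟨e.symm a, ?_⟩
    change ι (e.symm a) - C.subtypeL ((T x).inverse (θ x (ι (e.symm a)))) = _
    have h4 : ι (e.symm a) = a := by simp [ι]
    rw [h4, h3]
    simp
  refine (Submodule.eq_of_le_of_finrank_eq hle ?_).symm
  rw [hr, LinearMap.finrank_range_of_inj]
  · simp
  · intro a b hab
    rw [← hπ a, ← hπ b]
    exact congrArg π hab

end KernelFrame

/-! ### Calculus in charts -/

section ChartCalculus

open Filter

variable {E : Type*} [NormedAddCommGroup E] [NormedSpace ℝ E]
  {M : Type*} [TopologicalSpace M] [ChartedSpace E M] [IsManifold 𝓘(ℝ, E) ∞ M]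
  {F : Type*} [NormedAddCommGroup F] [NormedSpace ℝ F]
  {N : Type*} [TopologicalSpace N] [ChartedSpace F N]

theorem isManifold_one (E M : Type*) [NormedAddCommGroup E] [NormedSpace ℝ E]
    [TopologicalSpace M] [ChartedSpace E M] [IsManifold 𝓘(ℝ, E) ∞ M] :
    IsManifold 𝓘(ℝ, E) 1 M := .of_le (n := ∞) (by norm_cast)

theorem toChart_fromChart {p : M} {z : E} (hz : z ∈ (extChartAt 𝓘(ℝ, E) p).target) (u : E) :
    toChart p _ (fromChart p z u) = u := by
  have := isManifold_one E M
  have h := mfderiv_extChartAt_comp_mfderivWithin_extChartAt_symm hz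
  rw [ModelWithCorners.range_eq_univ, mfderivWithin_univ] at h
  exact DFunLike.congr_fun h u

theorem fromChart_toChart {p : M} {z : E} (hz : z ∈ (extChartAt 𝓘(ℝ, E) p).target)
    (v : TangentSpace 𝓘(ℝ, E) ((extChartAt 𝓘(ℝ, E) p).symm z)) :
    fromChart p z (toChart p _ v) = v := by
  have := isManifold_one E M
  have h := mfderivWithin_extChartAt_symm_comp_mfderiv_extChartAt hz
  rw [ModelWithCorners.range_eq_univ, mfderivWithin_univ] at h
  exact DFunLike.congr_fun h v

theorem fromChart_center (p : M) (u : E) :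
    (fromChart p (extChartAt 𝓘(ℝ, E) p p) u : E) = u := by
  have := isManifold_one E M
  have h := mfderivWithin_range_extChartAt_symm (I := 𝓘(ℝ, E)) (x := p)
  rw [ModelWithCorners.range_eq_univ, mfderivWithin_univ] at h
  exact DFunLike.congr_fun h u

theorem toChart_eq_trivializationAt {c q : M} (hq : q ∈ (chartAt E c).source)
    (v : TangentSpace 𝓘(ℝ, E) q) :
    toChart c q v = (trivializationAt E (TangentSpace 𝓘(ℝ, E)) c ⟨q, v⟩).2 := by
  have := isManifold_one E M
  have h := TangentBundle.continuousLinearMapAt_trivializationAt (𝕜 := ℝ) (I := 𝓘(ℝ, E)) hq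
  unfold toChart
  rw [← h]
  have h0 := Bundle.Trivialization.coe_linearMapAt_of_mem (R := ℝ)
    (trivializationAt E (TangentSpace 𝓘(ℝ, E)) c) (b := q) hq
  exact congrFun h0 v

/-- Smoothness of a vector field along a map, by its components in any preferred chart. -/
theorem contMDiffAt_along_iff {φ : N → M} {V : ∀ q : N, TangentSpace 𝓘(ℝ, E) (φ q)} {p : N} {c : M}
    (hc : φ p ∈ (chartAt E c).source) :
    ContMDiffAt 𝓘(ℝ, F) 𝓘(ℝ, E).tangent ∞
        (fun q => (⟨φ q, V q⟩ : TangentBundle 𝓘(ℝ, E) M)) p ↔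
      ContMDiffAt 𝓘(ℝ, F) 𝓘(ℝ, E) ∞ φ p ∧
        ContMDiffAt 𝓘(ℝ, F) 𝓘(ℝ, E) ∞ (fun q => toChart c (φ q) (V q)) p := by
  have := isManifold_one E M
  rw [(trivializationAt E (TangentSpace 𝓘(ℝ, E)) c).contMDiffAt_iff
    (by rw [Bundle.Trivialization.mem_source]; exact hc)]
  refine and_congr_right fun hφ => ?_
  refine EventuallyEq.contMDiffAt_iff ?_
  filter_upwards [hφ.continuousAt.eventually ((chartAt E c).open_source.mem_nhds hc)] with q hq
  exact (toChart_eq_trivializationAt hq _).symm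

/-- The expression of a map in the preferred charts centred at `p` and `φ p`. -/
def coordMap (φ : N → M) (p : N) (y : F) : E :=
  extChartAt 𝓘(ℝ, E) (φ p) (φ ((extChartAt 𝓘(ℝ, F) p).symm y))

/-- The components of a vector field along `φ` in the preferred chart at `φ p`, as a function of
the coordinates in the preferred chart at `p`. -/
def coordField (φ : N → M) (V : ∀ q : N, TangentSpace 𝓘(ℝ, E) (φ q)) (p : N) (y : F) : E :=
  toChart (φ p) _ (V ((extChartAt 𝓘(ℝ, F) p).symm y))

theorem coordMap_center (φ : N → M) (p : N) :
    coordMap (E := E) (F := F) φ p (extChartAt 𝓘(ℝ, F) p p) = extChartAt 𝓘(ℝ, E) (φ p) (φ p) := by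
  simp [coordMap]

theorem coordField_center (φ : N → M) (V : ∀ q : N, TangentSpace 𝓘(ℝ, E) (φ q)) (p : N) :
    coordField (F := F) φ V p (extChartAt 𝓘(ℝ, F) p p) = V p := by
  unfold coordField
  rw [extChartAt_to_inv]
  exact toChart_self _ _

theorem contMDiffAt_extChartAt_symm_center [IsManifold 𝓘(ℝ, F) ∞ N] {p : N} {z : F}
    (hz : z ∈ (extChartAt 𝓘(ℝ, F) p).target) :
    ContMDiffAt 𝓘(ℝ, F) 𝓘(ℝ, F) ∞ (extChartAt 𝓘(ℝ, F) p).symm z :=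
  (contMDiffOn_extChartAt_symm p).contMDiffAt
    ((isOpen_extChartAt_target p).mem_nhds hz)

theorem ContMDiffAt.contDiffAt_comp_symm [IsManifold 𝓘(ℝ, F) ∞ N] {G : Type*}
    [NormedAddCommGroup G] [NormedSpace ℝ G] {h : N → G} {p : N}
    (hh : ContMDiffAt 𝓘(ℝ, F) 𝓘(ℝ, G) ∞ h p) :
    ContDiffAt ℝ ∞ (fun y => h ((extChartAt 𝓘(ℝ, F) p).symm y)) (extChartAt 𝓘(ℝ, F) p p) := by
  refine contMDiffAt_iff_contDiffAt.1 (ContMDiffAt.comp (I' := 𝓘(ℝ, F)) _ ?_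
    (contMDiffAt_extChartAt_symm_center (mem_extChartAt_target p)))
  rwa [extChartAt_to_inv]

theorem contDiffAt_coordMap [IsManifold 𝓘(ℝ, F) ∞ N] {φ : N → M} {p : N}
    (hφ : ContMDiffAt 𝓘(ℝ, F) 𝓘(ℝ, E) ∞ φ p) :
    ContDiffAt ℝ ∞ (coordMap (E := E) (F := F) φ p) (extChartAt 𝓘(ℝ, F) p p) :=
  ContMDiffAt.contDiffAt_comp_symm (h := fun q => extChartAt 𝓘(ℝ, E) (φ p) (φ q))
    (ContMDiffAt.comp (I' := 𝓘(ℝ, E)) p contMDiffAt_extChartAt hφ)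

theorem contDiffAt_coordField [IsManifold 𝓘(ℝ, F) ∞ N] {φ : N → M}
    {V : ∀ q : N, TangentSpace 𝓘(ℝ, E) (φ q)} {p : N}
    (hV : ContMDiffAt 𝓘(ℝ, F) 𝓘(ℝ, E).tangent ∞
        (fun q => (⟨φ q, V q⟩ : TangentBundle 𝓘(ℝ, E) M)) p) :
    ContDiffAt ℝ ∞ (coordField (F := F) φ V p) (extChartAt 𝓘(ℝ, F) p p) :=
  ContMDiffAt.contDiffAt_comp_symm (h := fun q => toChart (φ p) (φ q) (V q))
    ((contMDiffAt_along_iff (mem_chart_source E _)).1 hV).2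

theorem mfderiv_eq_fderiv_comp_symm {G : Type*} [NormedAddCommGroup G] [NormedSpace ℝ G]
    {h : N → G} {p : N} (hh : MDifferentiableAt 𝓘(ℝ, F) 𝓘(ℝ, G) h p) (x : F) :
    mvfderiv 𝓘(ℝ, F) h p x =
      fderiv ℝ (fun y => h ((extChartAt 𝓘(ℝ, F) p).symm y)) (extChartAt 𝓘(ℝ, F) p p) x := by
  have h1 : mfderiv 𝓘(ℝ, F) 𝓘(ℝ, G) h p =
      fderiv ℝ (fun y => h ((extChartAt 𝓘(ℝ, F) p).symm y)) (extChartAt 𝓘(ℝ, F) p p) := by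
    have h2 : HasFDerivWithinAt (fun y => h ((extChartAt 𝓘(ℝ, F) p).symm y))
        (show F →L[ℝ] G from mfderiv 𝓘(ℝ, F) 𝓘(ℝ, G) h p) (Set.range 𝓘(ℝ, F))
        (extChartAt 𝓘(ℝ, F) p p) := hh.hasMFDerivAt.2
    rw [ModelWithCorners.range_eq_univ, hasFDerivWithinAt_univ] at h2
    exact h2.fderiv.symm
  exact DFunLike.congr_fun h1 x

theorem diff_eq_fderiv_coordMap {φ : N → M} {p : N}
    (hφ : MDifferentiableAt 𝓘(ℝ, F) 𝓘(ℝ, E) φ p) (x : TangentSpace 𝓘(ℝ, F) p) :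
    diff (E := E) φ p x = fderiv ℝ (coordMap (E := E) (F := F) φ p) (extChartAt 𝓘(ℝ, F) p p) x := by
  have h1 : mfderiv 𝓘(ℝ, F) 𝓘(ℝ, E) φ p =
      fderiv ℝ (coordMap (E := E) (F := F) φ p) (extChartAt 𝓘(ℝ, F) p p) := by
    have h2 : HasFDerivWithinAt (coordMap (E := E) (F := F) φ p)
        (show F →L[ℝ] E from mfderiv 𝓘(ℝ, F) 𝓘(ℝ, E) φ p) (Set.range 𝓘(ℝ, F))
        (extChartAt 𝓘(ℝ, F) p p) := hφ.hasMFDerivAt.2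
    rw [ModelWithCorners.range_eq_univ, hasFDerivWithinAt_univ] at h2
    exact h2.fderiv.symm
  exact DFunLike.congr_fun h1 x

theorem covDeriv_eq {g : ∀ x : M, TangentSpace 𝓘(ℝ, E) x → TangentSpace 𝓘(ℝ, E) x → ℝ}
    {φ : N → M} {V : ∀ q : N, TangentSpace 𝓘(ℝ, E) (φ q)} {p : N}
    (hV : ContMDiffAt 𝓘(ℝ, F) 𝓘(ℝ, E).tangent ∞
        (fun q => (⟨φ q, V q⟩ : TangentBundle 𝓘(ℝ, E) M)) p) (x : TangentSpace 𝓘(ℝ, F) p) :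
    covDeriv g φ V p x =
      (show TangentSpace 𝓘(ℝ, E) (φ p) from
        fderiv ℝ (coordField (F := F) φ V p) (extChartAt 𝓘(ℝ, F) p p) x) +
      christoffel g (φ p) (diff φ p x) (V p) := by
  have h := ((contMDiffAt_along_iff (mem_chart_source E _)).1 hV).2
  have h2 := mfderiv_eq_fderiv_comp_symm (h.mdifferentiableAt (by simp)) x
  unfold covDeriv
  congr 1

/-- Near the centre, the components of `dφ(Y)` are obtained by applying the derivative of the
coordinate expression of `φ` to those of `Y`. -/
theorem toChart_diff_eventually [IsManifold 𝓘(ℝ, F) ∞ N] {φ : N → M}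
    (hφ : ContMDiff 𝓘(ℝ, F) 𝓘(ℝ, E) ∞ φ) (p : N) :
    ∀ᶠ m in 𝓝 p, ∀ Y : TangentSpace 𝓘(ℝ, F) m, toChart (φ p) (φ m) (diff (E := E) φ m Y) =
      fderiv ℝ (coordMap (E := E) (F := F) φ p) (extChartAt 𝓘(ℝ, F) p m) (toChart p m Y) := by
  have := isManifold_one E M
  have := isManifold_one F N
  filter_upwards [extChartAt_source_mem_nhds (I := 𝓘(ℝ, F)) p,
    hφ.continuous.continuousAt.preimage_mem_nhds (extChartAt_source_mem_nhds (I := 𝓘(ℝ, E)) (φ p))]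
    with m hm hm' Y
  obtain ⟨z, hz, rfl⟩ : ∃ z ∈ (extChartAt 𝓘(ℝ, F) p).target, (extChartAt 𝓘(ℝ, F) p).symm z = m :=
    ⟨_, (extChartAt 𝓘(ℝ, F) p).map_source hm, (extChartAt 𝓘(ℝ, F) p).left_inv hm⟩
  rw [(extChartAt 𝓘(ℝ, F) p).right_inv hz]
  have h1 : HasMFDerivAt 𝓘(ℝ, F) 𝓘(ℝ, F) (extChartAt 𝓘(ℝ, F) p).symm z _ :=
    ((contMDiffAt_extChartAt_symm_center hz).mdifferentiableAt (by simp)).hasMFDerivAt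
  have h2 := ((hφ ((extChartAt 𝓘(ℝ, F) p).symm z)).mdifferentiableAt (by simp)).hasMFDerivAt
  have h3 := (mdifferentiableAt_extChartAt (I := 𝓘(ℝ, E)) (x := φ p)
    (y := φ ((extChartAt 𝓘(ℝ, F) p).symm z)) (by rwa [← extChartAt_source 𝓘(ℝ, E)])).hasMFDerivAt
  have h4 := (HasMFDerivAt.comp z h3 (HasMFDerivAt.comp z h2 h1)).mfderiv
  rw [mfderiv_eq_fderiv] at h4
  have h5 := DFunLike.congr_fun h4 (toChart p _ Y)
  refine Eq.trans ?_ h5.symm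
  have h6 : fromChart p z (toChart p _ Y) = Y := fromChart_toChart hz Y
  exact congrArg (fun Y => toChart (φ p) (φ ((extChartAt 𝓘(ℝ, F) p).symm z))
    (diff (E := E) φ _ Y)) h6.symm

/-- The variant of `toChart_diff_eventually` for a map `Φ` defined on a vector space. -/
theorem toChart_mfderiv_eventually {Φ : F → M} {z : F}
    (hΦ : ContMDiffAt 𝓘(ℝ, F) 𝓘(ℝ, E) ∞ Φ z) :
    ∀ᶠ y in 𝓝 z, ∀ u : F, toChart (Φ z) (Φ y) (mfderiv 𝓘(ℝ, F) 𝓘(ℝ, E) Φ y u) =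
      fderiv ℝ (fun y => extChartAt 𝓘(ℝ, E) (Φ z) (Φ y)) y u := by
  have := isManifold_one E M
  filter_upwards [hΦ.continuousAt.preimage_mem_nhds (extChartAt_source_mem_nhds (I := 𝓘(ℝ, E)) (Φ
      z)),
    (contMDiffAt_iff_contMDiffAt_nhds (by simp)).1 (ContMDiffAt.of_le (m := 1) hΦ (by norm_cast))]
    with y hy hy' u
  have h3 := (mdifferentiableAt_extChartAt (I := 𝓘(ℝ, E)) (x := Φ z)
    (y := Φ y) (by rwa [← extChartAt_source 𝓘(ℝ, E)])).hasMFDerivAt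
  have h4 := (HasMFDerivAt.comp y h3 (ContMDiffAt.mdifferentiableAt hy' (by
      simp)).hasMFDerivAt).mfderiv
  rw [mfderiv_eq_fderiv] at h4
  exact (DFunLike.congr_fun h4 u).symm

end ChartCalculus

/-! ### Tensor fields of order two in charts -/

section CoordForms

open Filter

variable {E : Type*} [NormedAddCommGroup E] [NormedSpace ℝ E]
  {M : Type*} [TopologicalSpace M] [ChartedSpace E M] [IsManifold 𝓘(ℝ, E) ∞ M]
  {F : Type*} [NormedAddCommGroup F] [NormedSpace ℝ F]
  {N : Type*} [TopologicalSpace N] [ChartedSpace F N]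

/-- The smooth family `G` of bilinear forms is the expression of the `2`-tensor field `b` in the
preferred chart at `q`, near the centre of that chart. -/
structure IsCoordForm (b : ∀ x : M, TangentSpace 𝓘(ℝ, E) x → TangentSpace 𝓘(ℝ, E) x → ℝ) (q : M)
    (G : E → E →L[ℝ] E →L[ℝ] ℝ) : Prop where
  contDiffAt : ContDiffAt ℝ ∞ G (extChartAt 𝓘(ℝ, E) q q)
  eq : ∀ᶠ z in 𝓝 (extChartAt 𝓘(ℝ, E) q q), ∀ u v : E,
    b _ (fromChart q z u) (fromChart q z v) = G z u v

/-- Congruence for a `2`-tensor field whose base point and arguments are replaced by equal ones; the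
arguments are compared in the model space, as their types depend on the base point. -/
theorem form_congr (b : ∀ x : M, TangentSpace 𝓘(ℝ, E) x → TangentSpace 𝓘(ℝ, E) x → ℝ)
    {q q' : M} (h : q = q') {u u' v v' : E} (hu : u = u') (hv : v = v') :
    b q u v = b q' u' v' := by
  subst h hu hv; rfl

theorem fderiv_apply₂ {X E₁ E₂ G : Type*} [NormedAddCommGroup X] [NormedSpace ℝ X]
    [NormedAddCommGroup E₁] [NormedSpace ℝ E₁] [NormedAddCommGroup E₂] [NormedSpace ℝ E₂]
    [NormedAddCommGroup G] [NormedSpace ℝ G]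
    {A : X → E₁ →L[ℝ] E₂ →L[ℝ] G} {z : X} (hA : DifferentiableAt ℝ A z) (u : X) (v : E₁) (w : E₂) :
    fderiv ℝ (fun z => A z v w) z u = fderiv ℝ A z u v w := by
  have h := (hA.hasFDerivAt.clm_apply (hasFDerivAt_const v z)).clm_apply (hasFDerivAt_const w z)
  rw [h.fderiv]
  simp

theorem fderiv_comp_apply₂ {X E₀ E₁ E₂ G : Type*} [NormedAddCommGroup X] [NormedSpace ℝ X]
    [NormedAddCommGroup E₀] [NormedSpace ℝ E₀]
    [NormedAddCommGroup E₁] [NormedSpace ℝ E₁] [NormedAddCommGroup E₂] [NormedSpace ℝ E₂]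
    [NormedAddCommGroup G] [NormedSpace ℝ G]
    {A : E₀ → E₁ →L[ℝ] E₂ →L[ℝ] G} {ψ : X → E₀} {a : X → E₁} {b : X → E₂} {z : X}
    (hA : DifferentiableAt ℝ A (ψ z)) (hψ : DifferentiableAt ℝ ψ z) (ha : DifferentiableAt ℝ a z)
    (hb : DifferentiableAt ℝ b z) (u : X) :
    fderiv ℝ (fun z => A (ψ z) (a z) (b z)) z u =
      fderiv ℝ A (ψ z) (fderiv ℝ ψ z u) (a z) (b z) + A (ψ z) (fderiv ℝ a z u) (b z) +
        A (ψ z) (a z) (fderiv ℝ b z u) := by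
  have h0 : HasFDerivAt (fun z => A (ψ z)) (fderiv ℝ A (ψ z) ∘L fderiv ℝ ψ z) z :=
    HasFDerivAt.comp (G := E₁ →L[ℝ] E₂ →L[ℝ] G) z hA.hasFDerivAt hψ.hasFDerivAt
  rw [((h0.clm_apply ha.hasFDerivAt).clm_apply hb.hasFDerivAt).fderiv]
  simp
  abel

namespace IsCoordForm

variable {b : ∀ x : M, TangentSpace 𝓘(ℝ, E) x → TangentSpace 𝓘(ℝ, E) x → ℝ} {q : M}
  {G : E → E →L[ℝ] E →L[ℝ] ℝ}

theorem differentiableAt (h : IsCoordForm b q G) :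
    DifferentiableAt ℝ G (extChartAt 𝓘(ℝ, E) q q) := h.contDiffAt.differentiableAt (by simp)

theorem center (h : IsCoordForm b q G) (u v : E) :
    b q u v = G (extChartAt 𝓘(ℝ, E) q q) u v := by
  rw [← h.eq.self_of_nhds u v]
  exact form_congr b (extChartAt_to_inv (I := 𝓘(ℝ, E)) q).symm (fromChart_center q u).symm
    (fromChart_center q v).symm

theorem partialDeriv (h : IsCoordForm b q G) (u v w : E) :
    partialDeriv b q u v w = fderiv ℝ G (extChartAt 𝓘(ℝ, E) q q) u v w := by
  rw [← fderiv_apply₂ h.differentiableAt]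
  unfold LCK.partialDeriv
  rw [EventuallyEq.fderiv_eq (h.eq.mono fun z hz => hz v w)]

theorem eventually_apply (h : IsCoordForm b q G) :
    ∀ᶠ m in 𝓝 q, ∀ v w : TangentSpace 𝓘(ℝ, E) m,
      b m v w = G (extChartAt 𝓘(ℝ, E) q m) (toChart q m v) (toChart q m w) := by
  filter_upwards [extChartAt_source_mem_nhds (I := 𝓘(ℝ, E)) q,
    (continuousAt_extChartAt (I := 𝓘(ℝ, E)) q).eventually h.eq] with m hm hm' v w
  obtain ⟨z, hz, rfl⟩ : ∃ z ∈ (extChartAt 𝓘(ℝ, E) q).target, (extChartAt 𝓘(ℝ, E) q).symm z = m :=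
    ⟨_, (extChartAt 𝓘(ℝ, E) q).map_source hm, (extChartAt 𝓘(ℝ, E) q).left_inv hm⟩
  rw [(extChartAt 𝓘(ℝ, E) q).right_inv hz] at hm' ⊢
  rw [← hm', fromChart_toChart hz, fromChart_toChart hz]

theorem eventually_along {φ : N → M} {p : N}
    (hφ : ContinuousAt φ p) (hG : IsCoordForm b (φ p) G) :
    ∀ᶠ y in 𝓝 (extChartAt 𝓘(ℝ, F) p p),
      ∀ v w : TangentSpace 𝓘(ℝ, E) (φ ((extChartAt 𝓘(ℝ, F) p).symm y)),
      b _ v w = G (coordMap φ p y) (toChart (φ p) _ v) (toChart (φ p) _ w) := by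
  have h1 : Tendsto (fun y => φ ((extChartAt 𝓘(ℝ, F) p).symm y)) (𝓝 (extChartAt 𝓘(ℝ, F) p p))
      (𝓝 (φ p)) := hφ.tendsto.comp (by
    have := continuousAt_extChartAt_symm (I := 𝓘(ℝ, F)) p
    rwa [ContinuousAt, extChartAt_to_inv] at this)
  exact h1.eventually hG.eventually_apply

end IsCoordForm

/-- The pullback of a family of bilinear forms on `E` by a map `ψ : F → E`. -/
def pullbackForm (G : E → E →L[ℝ] E →L[ℝ] ℝ) (ψ : F → E) (y : F) : F →L[ℝ] F →L[ℝ] ℝ :=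
  ((ContinuousLinearMap.compL ℝ F E ℝ).flip (fderiv ℝ ψ y)) ∘L (G (ψ y)) ∘L fderiv ℝ ψ y

theorem pullbackForm_apply (G : E → E →L[ℝ] E →L[ℝ] ℝ) (ψ : F → E) (y u v : F) :
    pullbackForm G ψ y u v = G (ψ y) (fderiv ℝ ψ y u) (fderiv ℝ ψ y v) := rfl

theorem contDiffAt_pullbackForm {G : E → E →L[ℝ] E →L[ℝ] ℝ} {ψ : F → E} {y : F}
    (hG : ContDiffAt ℝ ∞ G (ψ y)) (hψ : ContDiffAt ℝ ∞ ψ y) :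
    ContDiffAt ℝ ∞ (pullbackForm G ψ) y := by
  have h1 : ContDiffAt ℝ ∞ (fderiv ℝ ψ) y := hψ.fderiv_right (by simp)
  exact (contDiffAt_const.clm_apply h1).clm_comp ((hG.comp y hψ).clm_comp h1)

theorem fderiv_pullbackForm {G : E → E →L[ℝ] E →L[ℝ] ℝ} {ψ : F → E} {y : F}
    (hG : ContDiffAt ℝ ∞ G (ψ y)) (hψ : ContDiffAt ℝ ∞ ψ y) (u v w : F) :
    fderiv ℝ (pullbackForm G ψ) y u v w =
      fderiv ℝ G (ψ y) (fderiv ℝ ψ y u) (fderiv ℝ ψ y v) (fderiv ℝ ψ y w) +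
      G (ψ y) (fderiv ℝ (fderiv ℝ ψ) y u v) (fderiv ℝ ψ y w) +
      G (ψ y) (fderiv ℝ ψ y v) (fderiv ℝ (fderiv ℝ ψ) y u w) := by
  have h1 : DifferentiableAt ℝ (fderiv ℝ ψ) y :=
    (hψ.fderiv_right (m := ∞) (by simp)).differentiableAt (by simp)
  rw [← fderiv_apply₂ ((contDiffAt_pullbackForm hG hψ).differentiableAt (by simp))]
  simp only [pullbackForm_apply]
  have h2 : ∀ v, fderiv ℝ (fun y => fderiv ℝ ψ y v) y u = fderiv ℝ (fderiv ℝ ψ) y u v := fun v => by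
    rw [(h1.hasFDerivAt.clm_apply (hasFDerivAt_const v y)).fderiv]
    simp
  have h3 : ∀ v, DifferentiableAt ℝ (fun y => fderiv ℝ ψ y v) y := fun v =>
    (h1.hasFDerivAt.clm_apply (hasFDerivAt_const v y)).differentiableAt
  rw [fderiv_comp_apply₂ (hG.differentiableAt (by simp)) (hψ.differentiableAt (by simp)) (h3 v)
    (h3 w), h2, h2]

theorem fderiv_fderiv_symm {ψ : F → E} {y : F} (hψ : ContDiffAt ℝ ∞ ψ y) (u v : F) :
    fderiv ℝ (fderiv ℝ ψ) y u v = fderiv ℝ (fderiv ℝ ψ) y v u :=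
  (hψ.isSymmSndFDerivAt (by
    simpa using WithTop.coe_le_coe.2 (le_top : (2 : ℕ∞) ≤ ⊤))) u v

/-- The pullback of a `2`-tensor field by a smooth map `Φ` of a vector space, at points near `z`. -/
theorem eventually_mfderiv_eq_pullbackForm
    {b : ∀ x : M, TangentSpace 𝓘(ℝ, E) x → TangentSpace 𝓘(ℝ, E) x → ℝ}
    {G : E → E →L[ℝ] E →L[ℝ] ℝ} {Φ : F → M} {z : F} (hG : IsCoordForm b (Φ z) G)
    (hΦ : ContMDiffAt 𝓘(ℝ, F) 𝓘(ℝ, E) ∞ Φ z) :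
    ∀ᶠ y in 𝓝 z, ∀ u v : F,
      b (Φ y) (mfderiv 𝓘(ℝ, F) 𝓘(ℝ, E) Φ y u) (mfderiv 𝓘(ℝ, F) 𝓘(ℝ, E) Φ y v) =
        pullbackForm G (fun y => extChartAt 𝓘(ℝ, E) (Φ z) (Φ y)) y u v := by
  filter_upwards [toChart_mfderiv_eventually hΦ, hΦ.continuousAt.eventually hG.eventually_apply]
    with y h1 h2 u v
  rw [h2, h1, h1, pullbackForm_apply]

theorem contDiffAt_extChartAt_comp {Φ : F → M} {z : F}
    (hΦ : ContMDiffAt 𝓘(ℝ, F) 𝓘(ℝ, E) ∞ Φ z) :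
    ContDiffAt ℝ ∞ (fun y => extChartAt 𝓘(ℝ, E) (Φ z) (Φ y)) z :=
  contMDiffAt_iff_contDiffAt.1 (ContMDiffAt.comp (I' := 𝓘(ℝ, E)) z contMDiffAt_extChartAt hΦ)

theorem mfderiv_comp_symm_eq [IsManifold 𝓘(ℝ, F) ∞ N] {φ : N → M}
    (hφ : ContMDiff 𝓘(ℝ, F) 𝓘(ℝ, E) ∞ φ) {p : N} {z : F} (hz : z ∈ (extChartAt 𝓘(ℝ, F) p).target)
    (u : F) :
    mfderiv 𝓘(ℝ, F) 𝓘(ℝ, E) (fun y => φ ((extChartAt 𝓘(ℝ, F) p).symm y)) z u =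
      diff φ _ (fromChart p z u) := by
  have h1 : HasMFDerivAt 𝓘(ℝ, F) 𝓘(ℝ, F) (extChartAt 𝓘(ℝ, F) p).symm z _ :=
    ((contMDiffAt_extChartAt_symm_center hz).mdifferentiableAt (by simp)).hasMFDerivAt
  have h2 := ((hφ ((extChartAt 𝓘(ℝ, F) p).symm z)).mdifferentiableAt (by simp)).hasMFDerivAt
  exact DFunLike.congr_fun (HasMFDerivAt.comp z h2 h1).mfderiv u

theorem contMDiffAt_comp_symm [IsManifold 𝓘(ℝ, F) ∞ N] {φ : N → M}
    (hφ : ContMDiff 𝓘(ℝ, F) 𝓘(ℝ, E) ∞ φ) {p : N} {z : F} (hz : z ∈ (extChartAt 𝓘(ℝ, F) p).target) :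
    ContMDiffAt 𝓘(ℝ, F) 𝓘(ℝ, E) ∞ (fun y => φ ((extChartAt 𝓘(ℝ, F) p).symm y)) z :=
  ContMDiffAt.comp (I' := 𝓘(ℝ, F)) z (hφ _) (contMDiffAt_extChartAt_symm_center hz)

/-- The induced `2`-tensor is expressed in charts by the pullback under the coordinate expression
of the map. -/
theorem isCoordForm_inducedMetric [IsManifold 𝓘(ℝ, F) ∞ N]
    {b : ∀ x : M, TangentSpace 𝓘(ℝ, E) x → TangentSpace 𝓘(ℝ, E) x → ℝ}
    {φ : N → M} (hφ : ContMDiff 𝓘(ℝ, F) 𝓘(ℝ, E) ∞ φ) {p : N} {G : E → E →L[ℝ] E →L[ℝ] ℝ}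
    (hG : IsCoordForm b (φ p) G) :
    IsCoordForm (inducedMetric b φ) p (pullbackForm G (coordMap (E := E) (F := F) φ p)) := by
  refine ⟨contDiffAt_pullbackForm ?_ (contDiffAt_coordMap (hφ p)), ?_⟩
  · rw [coordMap_center]; exact hG.contDiffAt
  · set Φ : F → M := fun y => φ ((extChartAt 𝓘(ℝ, F) p).symm y) with hΦdef
    have hΦ := contMDiffAt_comp_symm hφ (mem_extChartAt_target (I := 𝓘(ℝ, F)) p)
    have hc : Φ (extChartAt 𝓘(ℝ, F) p p) = φ p := by simp [hΦdef]
    have h := eventually_mfderiv_eq_pullbackForm (Φ := Φ) (z := extChartAt 𝓘(ℝ, F) p p) (b := b)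
      (G := G) (by rw [hc]; exact hG) hΦ
    filter_upwards [h, extChartAt_target_mem_nhds (I := 𝓘(ℝ, F)) p] with y hy hy' u v
    have := hy u v
    rw [hc] at this
    rw [mfderiv_comp_symm_eq hφ hy', mfderiv_comp_symm_eq hφ hy'] at this
    exact this

theorem sharp_apply_of_pos {V : Type*} [NormedAddCommGroup V] [NormedSpace ℝ V]
    [FiniteDimensional ℝ V] (b : V →L[ℝ] V →L[ℝ] ℝ) (hb : ∀ v, v ≠ 0 → 0 < b v v)
    {β : V → V → ℝ} (hβ : ∀ v w, β v w = b v w) (α : V →L[ℝ] ℝ) {a : V → ℝ} (ha : ∀ w, a w = α w)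
    (w : V) : β (sharp β a) w = a w := by
  obtain rfl : β = fun v w => b v w := by funext v w; exact hβ v w
  obtain rfl : a = fun w => α w := funext ha
  let b' : V →ₗ[ℝ] V →ₗ[ℝ] ℝ := LinearMap.mk₂ ℝ (fun v w => b v w) (by simp) (by simp) (by simp)
    (by simp)
  exact sharp_spec b' hb α.toLinearMap w

theorem eq_zero_of_forall_eq_zero_of_pos {V : Type*} [Zero V] {β : V → V → ℝ}
    (hb : ∀ v, v ≠ 0 → 0 < β v v) {v : V} (hv : ∀ w, β v w = 0) : v = 0 := by
  by_contra h
  exact (hb v h).ne' (hv v)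

/-- The defining equation of the Christoffel symbols: the representing vector exists, as the metric
is positive definite. -/
theorem christoffel_spec [FiniteDimensional ℝ E]
    {g : ∀ x : M, TangentSpace 𝓘(ℝ, E) x → TangentSpace 𝓘(ℝ, E) x → ℝ} {q : M}
    {G : E → E →L[ℝ] E →L[ℝ] ℝ} (hG : IsCoordForm g q G)
    (hpos : ∀ v : TangentSpace 𝓘(ℝ, E) q, v ≠ 0 → 0 < g q v v) (u v w : E) :
    G (extChartAt 𝓘(ℝ, E) q q) (christoffel g q u v) w =
      (fderiv ℝ G (extChartAt 𝓘(ℝ, E) q q) u v w + fderiv ℝ G (extChartAt 𝓘(ℝ, E) q q) v u w -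
        fderiv ℝ G (extChartAt 𝓘(ℝ, E) q q) w u v) / 2 := by
  set z := extChartAt 𝓘(ℝ, E) q q with hz
  let α : E →L[ℝ] ℝ := (2⁻¹ : ℝ) • (fderiv ℝ G z u v + fderiv ℝ G z v u -
    (ContinuousLinearMap.apply ℝ ℝ v) ∘L (ContinuousLinearMap.apply ℝ (E →L[ℝ] ℝ) u) ∘L
      fderiv ℝ G z)
  have h := sharp_apply_of_pos (V := E) (G z) (fun v hv => by
    rw [← hG.center]; exact hpos v hv) (β := g q) (fun v w => hG.center v w) α
    (a := fun w => (LCK.partialDeriv g q u v w + LCK.partialDeriv g q v u w -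
      LCK.partialDeriv g q w u v) / 2) (fun w => by
      simp only [hG.partialDeriv, ← hz]
      simp [α]
      ring) w
  refine ((hG.center (christoffel g q u v) w).symm.trans h).trans ?_
  simp only [hG.partialDeriv, ← hz]

end CoordForms

/-! ### Almost Hermitian structures in charts -/

section AlmostHermitianCharts

open Filter Bundle

variable {E : Type*} [NormedAddCommGroup E] [NormedSpace ℝ E]
  {M : Type*} [TopologicalSpace M] [ChartedSpace E M] [IsManifold 𝓘(ℝ, E) ∞ M]
  {F : Type*} [NormedAddCommGroup F] [NormedSpace ℝ F]
  {N : Type*} [TopologicalSpace N] [ChartedSpace F N]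

theorem contMDiffAt_fromChart {q : M} {z : E} (hz : z ∈ (extChartAt 𝓘(ℝ, E) q).target) (u : E) :
    ContMDiffAt 𝓘(ℝ, E) 𝓘(ℝ, E).tangent ∞
      (fun z => (⟨(extChartAt 𝓘(ℝ, E) q).symm z, fromChart q z u⟩ : TangentBundle 𝓘(ℝ, E) M)) z :=
          by
  refine (contMDiffAt_along_iff (c := q) ?_).2 ⟨contMDiffAt_extChartAt_symm_center hz, ?_⟩
  · rw [← extChartAt_source 𝓘(ℝ, E)]
    exact (extChartAt 𝓘(ℝ, E) q).map_target hz
  · refine (contMDiffAt_const (c := u)).congr_of_eventuallyEq ?_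
    filter_upwards [(isOpen_extChartAt_target (I := 𝓘(ℝ, E)) q).mem_nhds hz] with y hy
    exact toChart_fromChart hy u

/-- The differential of the inverse of the preferred chart at `q`, as a map on the model space. -/
def fromChartL (q : M) (z : E) : E →L[ℝ] TangentSpace 𝓘(ℝ, E) ((extChartAt 𝓘(ℝ, E) q).symm z) :=
  mfderiv 𝓘(ℝ, E) 𝓘(ℝ, E) (extChartAt 𝓘(ℝ, E) q).symm z

/-- The differential of the preferred chart at `q`, as a map to the model space. -/
def toChartL (q m : M) : TangentSpace 𝓘(ℝ, E) m →L[ℝ] E :=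
  mfderiv 𝓘(ℝ, E) 𝓘(ℝ, E) (extChartAt 𝓘(ℝ, E) q) m

variable [FiniteDimensional ℝ E]

/-- A field of continuous bilinear forms has a smooth coordinate expression if its components on
constant fields are smooth; in finite dimension this suffices. -/
theorem exists_isCoordForm_of_contMDiffAt
    {β : ∀ x : M, TangentSpace 𝓘(ℝ, E) x →L[ℝ] TangentSpace 𝓘(ℝ, E) x →L[ℝ] ℝ} (q : M)
    (hβ : ∀ u v : E, ∀ z ∈ (extChartAt 𝓘(ℝ, E) q).target, ContDiffAt ℝ ∞
      (fun z => β _ (fromChart q z u) (fromChart q z v)) z) :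
    ∃ G, IsCoordForm (fun x v w => β x v w) q G := by
  let G : E → E →L[ℝ] E →L[ℝ] ℝ := fun z =>
    (show E →L[ℝ] E →L[ℝ] ℝ from β ((extChartAt 𝓘(ℝ, E) q).symm z)).bilinearComp
      (show E →L[ℝ] E from fromChartL q z) (show E →L[ℝ] E from fromChartL q z)
  refine ⟨G, ?_, Eventually.of_forall fun _ _ _ => rfl⟩
  have hG : ContDiffOn ℝ ∞ G (extChartAt 𝓘(ℝ, E) q).target :=
    contDiffOn_clm_apply.2 fun u => contDiffOn_clm_apply.2 fun v z hz =>
      (hβ u v z hz).contDiffWithinAt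
  exact hG.contDiffAt (extChartAt_target_mem_nhds q)

namespace AlmostHermitian

variable (H : AlmostHermitian E M)

theorem contMDiffAt_g {φ : N → M} {V W : ∀ q : N, TangentSpace 𝓘(ℝ, E) (φ q)} {p : N}
    (hV : ContMDiffAt 𝓘(ℝ, F) 𝓘(ℝ, E).tangent ∞
        (fun q => (⟨φ q, V q⟩ : TangentBundle 𝓘(ℝ, E) M)) p)
    (hW : ContMDiffAt 𝓘(ℝ, F) 𝓘(ℝ, E).tangent ∞
        (fun q => (⟨φ q, W q⟩ : TangentBundle 𝓘(ℝ, E) M)) p) :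
    ContMDiffAt 𝓘(ℝ, F) 𝓘(ℝ, ℝ) ∞ (fun q => H.g (φ q) (V q) (W q)) p := by
  have := isManifold_one E M
  have hφ : ContMDiffAt 𝓘(ℝ, F) 𝓘(ℝ, E) ∞ φ p :=
    ((contMDiffAt_along_iff (mem_chart_source E _)).1 hV).1
  have h : ContMDiffAt 𝓘(ℝ, F) (𝓘(ℝ, E).prod 𝓘(ℝ)) ∞
      (fun m => TotalSpace.mk' ℝ (E := Bundle.Trivial M ℝ) (φ m)
        (H.metric.inner (φ m) (V m) (W m))) p := by
    apply ContMDiffAt.clm_bundle_apply₂ (F₁ := E) (F₂ := E)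
    · exact ContMDiffAt.comp (I' := 𝓘(ℝ, E)) p (H.metric.contMDiff.contMDiffAt) hφ
    · exact hV
    · exact hW
  rw [contMDiffAt_totalSpace] at h
  exact h.2

theorem contMDiffAt_J {φ : N → M} {V : ∀ q : N, TangentSpace 𝓘(ℝ, E) (φ q)} {p : N}
    (hV : ContMDiffAt 𝓘(ℝ, F) 𝓘(ℝ, E).tangent ∞
        (fun q => (⟨φ q, V q⟩ : TangentBundle 𝓘(ℝ, E) M)) p) :
    ContMDiffAt 𝓘(ℝ, F) 𝓘(ℝ, E).tangent ∞
      (fun q => (⟨φ q, H.J (φ q) (V q)⟩ : TangentBundle 𝓘(ℝ, E) M)) p := by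
  have := isManifold_one E M
  have hφ : ContMDiffAt 𝓘(ℝ, F) 𝓘(ℝ, E) ∞ φ p :=
    ((contMDiffAt_along_iff (mem_chart_source E _)).1 hV).1
  exact ContMDiffAt.clm_bundle_apply (F₁ := E) (F₂ := E)
    (ContMDiffAt.comp (I' := 𝓘(ℝ, E)) p (H.smooth_J.contMDiffAt) hφ) hV

theorem exists_isCoordForm_g (q : M) : ∃ G, IsCoordForm H.g q G :=
  exists_isCoordForm_of_contMDiffAt (β := H.metric.inner) q fun u v _ hz =>
    contMDiffAt_iff_contDiffAt.1
      (H.contMDiffAt_g (contMDiffAt_fromChart hz u) (contMDiffAt_fromChart hz v))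

theorem exists_isCoordForm_kahlerForm (q : M) : ∃ G, IsCoordForm H.kahlerForm q G :=
  exists_isCoordForm_of_contMDiffAt
    (β := fun x => show E →L[ℝ] E →L[ℝ] ℝ from
      (show E →L[ℝ] E →L[ℝ] ℝ from H.metric.inner x).bilinearComp (.id ℝ E)
        (show E →L[ℝ] E from H.J x)) q fun u v _ hz =>
    contMDiffAt_iff_contDiffAt.1 (H.contMDiffAt_g (contMDiffAt_fromChart hz u)
      (H.contMDiffAt_J (contMDiffAt_fromChart hz v)))

/-- The expression of the almost complex structure in the preferred chart at `q`. -/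
def coordJ (q : M) (z : E) : E →L[ℝ] E :=
  toChartL q ((extChartAt 𝓘(ℝ, E) q).symm z) ∘L H.J ((extChartAt 𝓘(ℝ, E) q).symm z) ∘L
    fromChartL q z

theorem contDiffAt_coordJ (q : M) : ContDiffAt ℝ ∞ (H.coordJ q) (extChartAt 𝓘(ℝ, E) q q) := by
  have h : ContDiffOn ℝ ∞ (H.coordJ q) (extChartAt 𝓘(ℝ, E) q).target := by
    refine contDiffOn_clm_apply.2 fun u z hz => ContDiffAt.contDiffWithinAt ?_
    have h1 := (contMDiffAt_along_iff (c := q) ?_).1 (H.contMDiffAt_J (contMDiffAt_fromChart hz u))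
    · exact contMDiffAt_iff_contDiffAt.1 h1.2
    · rw [← extChartAt_source 𝓘(ℝ, E)]
      exact (extChartAt 𝓘(ℝ, E) q).map_target hz
  exact h.contDiffAt (extChartAt_target_mem_nhds q)

theorem toChart_J {q m : M} (hm : m ∈ (extChartAt 𝓘(ℝ, E) q).source)
    (v : TangentSpace 𝓘(ℝ, E) m) :
    toChart q m (H.J m v) = H.coordJ q (extChartAt 𝓘(ℝ, E) q m) (toChart q m v) := by
  obtain ⟨z, hz, rfl⟩ : ∃ z ∈ (extChartAt 𝓘(ℝ, E) q).target, (extChartAt 𝓘(ℝ, E) q).symm z = m :=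
    ⟨_, (extChartAt 𝓘(ℝ, E) q).map_source hm, (extChartAt 𝓘(ℝ, E) q).left_inv hm⟩
  rw [(extChartAt 𝓘(ℝ, E) q).right_inv hz]
  have h := fromChart_toChart hz v
  exact congrArg (fun w => toChart q _ (H.J ((extChartAt 𝓘(ℝ, E) q).symm z) w)) h.symm

theorem coordJ_center (q : M) (v : E) : H.coordJ q (extChartAt 𝓘(ℝ, E) q q) v = H.J q v := by
  have h := H.toChart_J (mem_extChartAt_source (I := 𝓘(ℝ, E)) q) v
  exact (((toChart_self q _).symm.trans h).trans
    (congrArg (H.coordJ q _) (toChart_self q v))).symm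

end AlmostHermitian

end AlmostHermitianCharts

/-! ### The Levi-Civita connection and immersions -/

section LeviCivita

open Filter

variable {E : Type*} [NormedAddCommGroup E] [NormedSpace ℝ E] [FiniteDimensional ℝ E]
  {M : Type*} [TopologicalSpace M] [ChartedSpace E M] [IsManifold 𝓘(ℝ, E) ∞ M]
  {F : Type*} [NormedAddCommGroup F] [NormedSpace ℝ F]
  {N : Type*} [TopologicalSpace N] [ChartedSpace F N] [IsManifold 𝓘(ℝ, F) ∞ N]

/-! Tangent spaces are definitionally equal to the model space. The following definitions are the
basic notions with values and arguments taken in the model space: in this form they can be added and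
rewritten without regard to the base point. -/

/-- The value at `q` of a `2`-tensor field, on vectors of the model space. -/
def formE (b : ∀ x : M, TangentSpace 𝓘(ℝ, E) x → TangentSpace 𝓘(ℝ, E) x → ℝ) (q : M)
    (u v : E) : ℝ := b q u v

/-- The Christoffel symbol at `q`, on vectors of the model space. -/
def christoffelE (g : ∀ x : M, TangentSpace 𝓘(ℝ, E) x → TangentSpace 𝓘(ℝ, E) x → ℝ) (q : M)
    (u v : E) : E := christoffel g q u v

/-- The differential at `p`, as a map of model spaces. -/
def diffE (φ : N → M) (p : N) : F →L[ℝ] E := mfderiv 𝓘(ℝ, F) 𝓘(ℝ, E) φ p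

/-- The value at `p` of a vector field along `φ`, in the model space. -/
def valE {φ : N → M} (V : ∀ q : N, TangentSpace 𝓘(ℝ, E) (φ q)) (p : N) : E := V p

/-- The covariant derivative at `p`, with values in the model space. -/
def covDerivE (g : ∀ x : M, TangentSpace 𝓘(ℝ, E) x → TangentSpace 𝓘(ℝ, E) x → ℝ)
    (φ : N → M) (V : ∀ q : N, TangentSpace 𝓘(ℝ, E) (φ q)) (p : N) (x : F) : E :=
  covDeriv g φ V p x

/-- The tangential part at `p`, on vectors of the model space. -/
def tangentialPartE (g : ∀ x : M, TangentSpace 𝓘(ℝ, E) x → TangentSpace 𝓘(ℝ, E) x → ℝ)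
    (φ : N → M) (p : N) (v : E) : F := tangentialPart (F := F) g φ p v

/-- The second fundamental form at `p`, with values in the model space. -/
def secondFundamentalFormE
    (g : ∀ x : M, TangentSpace 𝓘(ℝ, E) x → TangentSpace 𝓘(ℝ, E) x → ℝ)
    (φ : N → M) (X Y : ∀ q : N, TangentSpace 𝓘(ℝ, F) q) (p : N) : E :=
  secondFundamentalForm g φ X Y p

/-- The shape operator at `p`, with values in the model space. -/
def shapeOperatorE (g : ∀ x : M, TangentSpace 𝓘(ℝ, E) x → TangentSpace 𝓘(ℝ, E) x → ℝ)
    (φ : N → M) (ξ : ∀ q : N, TangentSpace 𝓘(ℝ, E) (φ q))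
    (X : ∀ q : N, TangentSpace 𝓘(ℝ, F) q) (p : N) : F := shapeOperator g φ ξ X p

/-- The value at `p` of a vector field, in the model space. -/
def fieldE (X : ∀ q : N, TangentSpace 𝓘(ℝ, F) q) (p : N) : F := X p

theorem secondFundamentalFormE_eq
    (g : ∀ x : M, TangentSpace 𝓘(ℝ, E) x → TangentSpace 𝓘(ℝ, E) x → ℝ)
    (φ : N → M) (X Y : ∀ q : N, TangentSpace 𝓘(ℝ, F) q) (p : N) :
    secondFundamentalFormE g φ X Y p =
      covDerivE g φ (fun q => diff (E := E) φ q (Y q)) p (fieldE X p) -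
        diffE φ p (tangentialPartE (F := F) g φ p
          (covDerivE g φ (fun q => diff (E := E) φ q (Y q)) p (fieldE X p))) := rfl

theorem shapeOperatorE_eq
    (g : ∀ x : M, TangentSpace 𝓘(ℝ, E) x → TangentSpace 𝓘(ℝ, E) x → ℝ)
    (φ : N → M) (ξ : ∀ q : N, TangentSpace 𝓘(ℝ, E) (φ q))
    (X : ∀ q : N, TangentSpace 𝓘(ℝ, F) q) (p : N) :
    shapeOperatorE g φ ξ X p = -tangentialPartE (F := F) g φ p (covDerivE g φ ξ p (fieldE X p)) :=
  rfl

/-- A vector field along `φ` is smooth at `p`. -/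
def SmoothAlongAt (F : Type*) [NormedAddCommGroup F] [NormedSpace ℝ F]
    {N : Type*} [TopologicalSpace N] [ChartedSpace F N] (φ : N → M)
    (V : ∀ q : N, TangentSpace 𝓘(ℝ, E) (φ q)) (p : N) : Prop :=
  ContMDiffAt 𝓘(ℝ, F) 𝓘(ℝ, E).tangent ∞
    (fun q => (⟨φ q, V q⟩ : TangentBundle 𝓘(ℝ, E) M)) p

theorem diffE_eq {φ : N → M} {p : N} (hφ : ContMDiffAt 𝓘(ℝ, F) 𝓘(ℝ, E) ∞ φ p) :
    diffE φ p = fderiv ℝ (coordMap (E := E) (F := F) φ p) (extChartAt 𝓘(ℝ, F) p p) :=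
  ContinuousLinearMap.ext fun x => diff_eq_fderiv_coordMap (hφ.mdifferentiableAt (by simp)) x

theorem valE_eq {φ : N → M} (V : ∀ q : N, TangentSpace 𝓘(ℝ, E) (φ q)) (p : N) :
    valE V p = coordField (F := F) φ V p (extChartAt 𝓘(ℝ, F) p p) :=
  (coordField_center φ V p).symm

theorem SmoothAlongAt.contMDiffAt {φ : N → M} {V : ∀ q : N, TangentSpace 𝓘(ℝ, E) (φ q)} {p : N}
    (hV : SmoothAlongAt F φ V p) : ContMDiffAt 𝓘(ℝ, F) 𝓘(ℝ, E) ∞ φ p :=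
  ((contMDiffAt_along_iff (mem_chart_source E _)).1 hV).1

theorem covDerivE_eq {g : ∀ x : M, TangentSpace 𝓘(ℝ, E) x → TangentSpace 𝓘(ℝ, E) x → ℝ}
    {φ : N → M} {V : ∀ q : N, TangentSpace 𝓘(ℝ, E) (φ q)} {p : N}
    (hV : SmoothAlongAt F φ V p) (x : F) :
    covDerivE g φ V p x =
      fderiv ℝ (coordField (F := F) φ V p) (extChartAt 𝓘(ℝ, F) p p) x +
      christoffelE g (φ p) (diffE φ p x) (valE V p) :=
  covDeriv_eq hV x

/-- A Riemannian metric, as a field of functions of two tangent vectors: symmetric, positive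
definite, bilinear and smooth in charts. -/
structure IsSmoothMetric
    (g : ∀ x : M, TangentSpace 𝓘(ℝ, E) x → TangentSpace 𝓘(ℝ, E) x → ℝ) : Prop where
  symm : ∀ x v w, g x v w = g x w v
  pos : ∀ x v, v ≠ 0 → 0 < g x v v
  exists_isCoordForm : ∀ q, ∃ G, IsCoordForm g q G

theorem AlmostHermitian.isSmoothMetric_g (H : AlmostHermitian E M) : IsSmoothMetric H.g :=
  ⟨fun x => H.metric.symm x, fun x => H.metric.pos x, H.exists_isCoordForm_g⟩

theorem IsCoordForm.formE_eq
    {b : ∀ x : M, TangentSpace 𝓘(ℝ, E) x → TangentSpace 𝓘(ℝ, E) x → ℝ} {q : M}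
    {G : E → E →L[ℝ] E →L[ℝ] ℝ} (hG : IsCoordForm b q G) (u v : E) :
    formE b q u v = G (extChartAt 𝓘(ℝ, E) q q) u v := hG.center u v

variable {g : ∀ x : M, TangentSpace 𝓘(ℝ, E) x → TangentSpace 𝓘(ℝ, E) x → ℝ}

theorem christoffelE_spec {q : M}
    {G : E → E →L[ℝ] E →L[ℝ] ℝ} (hG : IsCoordForm g q G)
    (hpos : ∀ v : TangentSpace 𝓘(ℝ, E) q, v ≠ 0 → 0 < g q v v) (u v w : E) :
    G (extChartAt 𝓘(ℝ, E) q q) (christoffelE g q u v) w =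
      (fderiv ℝ G (extChartAt 𝓘(ℝ, E) q q) u v w + fderiv ℝ G (extChartAt 𝓘(ℝ, E) q q) v u w -
        fderiv ℝ G (extChartAt 𝓘(ℝ, E) q q) w u v) / 2 :=
  christoffel_spec hG hpos u v w

namespace IsSmoothMetric

theorem inducedMetric (hg : IsSmoothMetric g) {φ : N → M}
    (hφ : IsSmoothImmersion (E := E) (F := F) φ) : IsSmoothMetric (inducedMetric (F := F) g φ) where
  symm _ _ _ := hg.symm _ _ _
  pos p v hv := hg.pos _ _ fun h => hv (hφ.injective p (h.trans (map_zero (diff φ p)).symm))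
  exists_isCoordForm p := by
    obtain ⟨G, hG⟩ := hg.exists_isCoordForm (φ p)
    exact ⟨_, isCoordForm_inducedMetric hφ.smooth hG⟩

theorem add_left (hg : IsSmoothMetric g) (q : M) (u v w : E) :
    formE g q (u + v) w = formE g q u w + formE g q v w := by
  obtain ⟨G, hG⟩ := hg.exists_isCoordForm q
  simp [hG.formE_eq]

theorem formE_symm (hg : IsSmoothMetric g) (q : M) (u v : E) : formE g q u v = formE g q v u :=
  hg.symm q u v

theorem add_right (hg : IsSmoothMetric g) (q : M) (u v w : E) :
    formE g q u (v + w) = formE g q u v + formE g q u w := by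
  rw [hg.formE_symm, hg.add_left, hg.formE_symm q v, hg.formE_symm q w]

theorem neg_left (hg : IsSmoothMetric g) (q : M) (u w : E) :
    formE g q (-u) w = -formE g q u w := by
  obtain ⟨G, hG⟩ := hg.exists_isCoordForm q
  simp [hG.formE_eq]

theorem neg_right (hg : IsSmoothMetric g) (q : M) (u w : E) :
    formE g q u (-w) = -formE g q u w := by
  rw [hg.formE_symm, hg.neg_left, hg.formE_symm]

theorem sub_left (hg : IsSmoothMetric g) (q : M) (u v w : E) :
    formE g q (u - v) w = formE g q u w - formE g q v w := by
  rw [sub_eq_add_neg, hg.add_left, hg.neg_left, ← sub_eq_add_neg]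

theorem eq_zero_of_forall (hg : IsSmoothMetric g) {q : M} {v : E}
    (h : ∀ w, formE g q v w = 0) : v = 0 :=
  eq_zero_of_forall_eq_zero_of_pos (V := E) (β := formE g q) (hg.pos q) h

theorem eq_of_forall_eq (hg : IsSmoothMetric g) {q : M} {u v : E}
    (h : ∀ w, formE g q u w = formE g q v w) : u = v := by
  refine sub_eq_zero.1 (hg.eq_zero_of_forall (q := q) fun w => ?_)
  rw [hg.sub_left, h, sub_self]

theorem coord_symm (hg : IsSmoothMetric g) {q : M} {G : E → E →L[ℝ] E →L[ℝ] ℝ}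
    (hG : IsCoordForm g q G) (u v : E) :
    G (extChartAt 𝓘(ℝ, E) q q) u v = G (extChartAt 𝓘(ℝ, E) q q) v u := by
  rw [← hG.formE_eq, ← hG.formE_eq, hg.formE_symm]

theorem fderiv_coord_symm (hg : IsSmoothMetric g) {q : M} {G : E → E →L[ℝ] E →L[ℝ] ℝ}
    (hG : IsCoordForm g q G) (u v w : E) :
    fderiv ℝ G (extChartAt 𝓘(ℝ, E) q q) u v w = fderiv ℝ G (extChartAt 𝓘(ℝ, E) q q) u w v := by
  rw [← fderiv_apply₂ hG.differentiableAt, ← fderiv_apply₂ hG.differentiableAt]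
  refine congrArg (fun L : E →L[ℝ] ℝ => L u) (EventuallyEq.fderiv_eq ?_)
  filter_upwards [hG.eq] with z hz
  rw [← hz, ← hz]
  exact hg.symm _ _ _

theorem christoffelE_symm (hg : IsSmoothMetric g) (q : M) (u v : E) :
    christoffelE g q u v = christoffelE g q v u := by
  obtain ⟨G, hG⟩ := hg.exists_isCoordForm q
  refine hg.eq_of_forall_eq (q := q) fun w => ?_
  rw [hG.formE_eq, hG.formE_eq, christoffelE_spec hG (hg.pos q), christoffelE_spec hG (hg.pos q)]
  have h := hg.fderiv_coord_symm hG w u v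
  linarith

/-- The derivative of the metric in terms of the Christoffel symbols. -/
theorem fderiv_coord_eq (hg : IsSmoothMetric g) {q : M} {G : E → E →L[ℝ] E →L[ℝ] ℝ}
    (hG : IsCoordForm g q G) (u v w : E) :
    fderiv ℝ G (extChartAt 𝓘(ℝ, E) q q) u v w =
      formE g q (christoffelE g q u v) w + formE g q v (christoffelE g q u w) := by
  rw [hg.formE_symm q v, hG.formE_eq, hG.formE_eq, christoffelE_spec hG (hg.pos q),
    christoffelE_spec hG (hg.pos q)]
  have h1 := hg.fderiv_coord_symm hG u v w
  have h2 := hg.fderiv_coord_symm hG w u v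
  have h3 := hg.fderiv_coord_symm hG v u w
  linarith

/-- The Levi-Civita connection is compatible with the metric. -/
theorem fderiv_apply_eq_covDerivE (hg : IsSmoothMetric g) {φ : N → M}
    {V W : ∀ q : N, TangentSpace 𝓘(ℝ, E) (φ q)} {p : N}
    (hV : SmoothAlongAt F φ V p) (hW : SmoothAlongAt F φ W p) (x : F) :
    fderiv ℝ (fun y => g (φ ((extChartAt 𝓘(ℝ, F) p).symm y)) (V _) (W _))
        (extChartAt 𝓘(ℝ, F) p p) x =
      formE g (φ p) (covDerivE g φ V p x) (valE W p) +
        formE g (φ p) (valE V p) (covDerivE g φ W p x) := by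
  have hφ := hV.contMDiffAt
  obtain ⟨G, hG⟩ := hg.exists_isCoordForm (φ p)
  have h1 : (fun y => g (φ ((extChartAt 𝓘(ℝ, F) p).symm y)) (V _) (W _)) =ᶠ[
      𝓝 (extChartAt 𝓘(ℝ, F) p p)] fun y => G (coordMap (E := E) (F := F) φ p y)
        (coordField (F := F) φ V p y) (coordField (F := F) φ W p y) :=
    (IsCoordForm.eventually_along hφ.continuousAt hG).mono fun y hy => hy _ _
  have hG' := hG.differentiableAt
  rw [← coordMap_center (E := E) (F := F) φ p] at hG'
  rw [h1.fderiv_eq, fderiv_comp_apply₂ hG' ((contDiffAt_coordMap hφ).differentiableAt (by simp))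
    ((contDiffAt_coordField hV).differentiableAt (by simp))
    ((contDiffAt_coordField hW).differentiableAt (by simp)) x, coordMap_center, ← diffE_eq hφ,
    ← valE_eq, ← valE_eq, hg.fderiv_coord_eq hG, covDerivE_eq hV, covDerivE_eq hW,
    hg.add_left, hg.add_right, ← hG.formE_eq, ← hG.formE_eq]
  ring

/-- Differentiate `g(V, W) = 0`. -/
theorem formE_covDerivE_of_orthogonal (hg : IsSmoothMetric g) {φ : N → M}
    {V W : ∀ q : N, TangentSpace 𝓘(ℝ, E) (φ q)} {p : N}
    (hV : SmoothAlongAt F φ V p) (hW : SmoothAlongAt F φ W p)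
    (h0 : ∀ᶠ q in 𝓝 p, g (φ q) (V q) (W q) = 0) (x : F) :
    formE g (φ p) (covDerivE g φ V p x) (valE W p) =
      -formE g (φ p) (valE V p) (covDerivE g φ W p x) := by
  have h := hg.fderiv_apply_eq_covDerivE hV hW x
  have h1 : (fun y => g (φ ((extChartAt 𝓘(ℝ, F) p).symm y)) (V _) (W _)) =ᶠ[
      𝓝 (extChartAt 𝓘(ℝ, F) p p)] fun _ => 0 := by
    have hc := continuousAt_extChartAt_symm (I := 𝓘(ℝ, F)) p
    rw [ContinuousAt, extChartAt_to_inv] at hc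
    exact hc.eventually h0
  rw [h1.fderiv_eq, (hasFDerivAt_const (0 : ℝ) (extChartAt 𝓘(ℝ, F) p p)).fderiv] at h
  have h2 : (0 : F →L[ℝ] ℝ) x = 0 := rfl
  linarith

theorem formE_tangentialPart [FiniteDimensional ℝ F] (hg : IsSmoothMetric g) {φ : N → M}
    (hφ : IsSmoothImmersion (E := E) (F := F) φ) (p : N) (v : E) (y : F) :
    formE g (φ p) (diffE (E := E) (F := F) φ p (tangentialPartE g φ p v))
        (diffE (E := E) (F := F) φ p y) =
      formE g (φ p) v (diffE (E := E) (F := F) φ p y) := by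
  have hgM := hg.inducedMetric hφ
  obtain ⟨G, hG⟩ := hg.exists_isCoordForm (φ p)
  obtain ⟨G', hG'⟩ := hgM.exists_isCoordForm p
  exact sharp_apply_of_pos (V := F) (G' (extChartAt 𝓘(ℝ, F) p p))
    (fun v hv => by rw [← hG'.center]; exact hgM.pos p v hv) (β := LCK.inducedMetric g φ p)
    (fun v w => hG'.center v w)
    (G (extChartAt 𝓘(ℝ, E) (φ p) (φ p)) v ∘L diffE φ p) (a := fun y => g (φ p) v (diff φ p y))
    (fun w => hG.center _ _) y

end IsSmoothMetric

/-- The Hessian (second covariant derivative) of a map `φ : N → M` in the preferred chart of `N` at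
`p`: the covariant derivative at `p`, in the direction `u`, of the image under `dφ` of the vector
field with constant components `v`. -/
def hess (g : ∀ x : M, TangentSpace 𝓘(ℝ, E) x → TangentSpace 𝓘(ℝ, E) x → ℝ) (φ : N → M) (p : N)
    (u v : F) : E :=
  fderiv ℝ (fderiv ℝ (coordMap (E := E) (F := F) φ p)) (extChartAt 𝓘(ℝ, F) p p) u v +
  christoffelE g (φ p) (diffE φ p u) (diffE φ p v)

theorem IsSmoothMetric.hess_symm (hg : IsSmoothMetric g) {φ : N → M}
    (hφ : ContMDiff 𝓘(ℝ, F) 𝓘(ℝ, E) ∞ φ) (p : N) (u v : F) :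
    hess g φ p u v = hess g φ p v u := by
  unfold hess
  rw [hg.christoffelE_symm, fderiv_fderiv_symm (contDiffAt_coordMap (hφ p))]

/-- Gauss: the Levi-Civita connection of the induced metric is the tangential part of the
connection of the ambient manifold. -/
theorem IsSmoothMetric.formE_diffE_christoffelE_inducedMetric [FiniteDimensional ℝ F]
    (hg : IsSmoothMetric g) {φ : N → M}
    (hφ : IsSmoothImmersion (E := E) (F := F) φ) (p : N) (u v w : F) :
    formE g (φ p) (diffE φ p (christoffelE (LCK.inducedMetric (F := F) g φ) p u v)) (diffE φ p w) =
      formE g (φ p) (hess g φ p u v) (diffE φ p w) := by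
  obtain ⟨G, hG⟩ := hg.exists_isCoordForm (φ p)
  have hG' := isCoordForm_inducedMetric hφ.smooth hG
  have hψ := contDiffAt_coordMap (hφ.smooth p)
  have hGc := hG.contDiffAt
  rw [← coordMap_center (E := E) (F := F) φ p] at hGc
  have h := christoffelE_spec hG' ((hg.inducedMetric hφ).pos p) u v w
  rw [← hG'.formE_eq] at h
  refine Eq.trans h ?_
  simp only [fderiv_pullbackForm hGc hψ, ← diffE_eq (hφ.smooth p), coordMap_center]
  unfold hess
  rw [hg.add_left, hG.formE_eq, hG.formE_eq, christoffelE_spec hG (hg.pos _),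
    fderiv_fderiv_symm hψ v u, fderiv_fderiv_symm hψ w u, fderiv_fderiv_symm hψ w v]
  have s1 := hg.coord_symm hG (diffE φ p v)
    (fderiv ℝ (fderiv ℝ (coordMap (E := E) (F := F) φ p)) (extChartAt 𝓘(ℝ, F) p p) u w)
  have s2 := hg.coord_symm hG (diffE φ p u)
    (fderiv ℝ (fderiv ℝ (coordMap (E := E) (F := F) φ p)) (extChartAt 𝓘(ℝ, F) p p) v w)
  linarith

theorem smoothAlongAt_diff [FiniteDimensional ℝ F] {P K : Type*} [NormedAddCommGroup K]
    [NormedSpace ℝ K]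
    [TopologicalSpace P] [ChartedSpace K P] {i : N → M}
    (hi : ContMDiff 𝓘(ℝ, F) 𝓘(ℝ, E) ∞ i) {j : P → N} {V : ∀ q : P, TangentSpace 𝓘(ℝ, F) (j q)}
    {p : P} (hV : SmoothAlongAt K j V p) :
    SmoothAlongAt K (fun q => i (j q)) (fun q => diff (E := E) i (j q) (V q)) p := by
  have h := hi.contMDiff_tangentMap (m := ∞) (by simp)
  exact ContMDiffAt.comp p (h _) hV

/-- The covariant derivative of the image under `di` of a vector field along `j`: the Hessian of
`i`, and a term tangent to `i`. -/
theorem covDerivE_diff [FiniteDimensional ℝ F] {P K : Type*} [NormedAddCommGroup K] [NormedSpace ℝ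
    K]
    [TopologicalSpace P] [ChartedSpace K P] [IsManifold 𝓘(ℝ, K) ∞ P] {i : N → M}
    (hi : ContMDiff 𝓘(ℝ, F) 𝓘(ℝ, E) ∞ i) {j : P → N} {V : ∀ q : P, TangentSpace 𝓘(ℝ, F) (j q)}
    {p : P} (hV : SmoothAlongAt K j V p) (x : K) :
    covDerivE g (fun q => i (j q)) (fun q => diff (E := E) i (j q) (V q)) p x =
      hess g i (j p) (diffE j p x) (valE V p) +
        diffE i (j p) (fderiv ℝ (coordField (F := K) j V p) (extChartAt 𝓘(ℝ, K) p p) x) := by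
  have hj := hV.contMDiffAt
  have hψ := contDiffAt_coordMap (hi (j p))
  have hψ' : DifferentiableAt ℝ (fderiv ℝ (coordMap (E := E) (F := F) i (j p)))
      (coordMap (F := K) j p (extChartAt 𝓘(ℝ, K) p p)) := by
    rw [coordMap_center]
    exact (hψ.fderiv_right (m := ∞) (by simp)).differentiableAt (by simp)
  have hev : coordField (F := K) (fun q => i (j q)) (fun q => diff (E := E) i (j q) (V q)) p
      =ᶠ[𝓝 (extChartAt 𝓘(ℝ, K) p p)] fun y =>
        fderiv ℝ (coordMap (E := E) (F := F) i (j p)) (coordMap (F := K) j p y)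
          (coordField (F := K) j V p y) := by
    have hc := continuousAt_extChartAt_symm (I := 𝓘(ℝ, K)) p
    rw [ContinuousAt, extChartAt_to_inv] at hc
    exact ((hj.continuousAt.tendsto.comp hc).eventually
      (toChart_diff_eventually hi (j p))).mono fun y hy => hy _
  rw [covDerivE_eq (smoothAlongAt_diff hi hV), hev.fderiv_eq]
  have h1 : HasFDerivAt (fun y => fderiv ℝ (coordMap (E := E) (F := F) i (j p))
      (coordMap (F := K) j p y)) _ (extChartAt 𝓘(ℝ, K) p p) :=
    HasFDerivAt.comp (G := F →L[ℝ] E) _ hψ'.hasFDerivAt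
      ((contDiffAt_coordMap hj).differentiableAt (by simp)).hasFDerivAt
  rw [(h1.clm_apply ((contDiffAt_coordField hV).differentiableAt (by simp)).hasFDerivAt).fderiv]
  have h2 : diffE (E := E) (F := K) (fun q => i (j q)) p x =
      diffE (E := E) (F := F) i (j p) (diffE (E := F) (F := K) j p x) :=
    DFunLike.congr_fun (mfderiv_comp p ((hi (j p)).mdifferentiableAt (by simp))
      (hj.mdifferentiableAt (by simp))) x
  rw [h2]
  unfold hess
  rw [diffE_eq (hi (j p)), diffE_eq hj, valE_eq (F := K) V p, coordMap_center]
  simp only [add_apply, ContinuousLinearMap.comp_apply,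
    ContinuousLinearMap.flip_apply]
  have h3 : valE (fun q => diff (E := E) i (j q) (V q)) p = fderiv ℝ (coordMap (E := E) (F := F) i
      (j p))
      (extChartAt 𝓘(ℝ, F) (j p) (j p)) (coordField (F := K) j V p (extChartAt 𝓘(ℝ, K) p p)) := by
    rw [← diffE_eq (hi (j p)), ← valE_eq]
    rfl
  rw [h3]
  abel

/-- Gauss formula along a map `j` into a submanifold: the tangential part of the ambient covariant
derivative is the covariant derivative of the induced metric. -/
theorem IsSmoothMetric.formE_covDerivE_inducedMetric [FiniteDimensional ℝ F]
    (hg : IsSmoothMetric g)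
    {P K : Type*} [NormedAddCommGroup K] [NormedSpace ℝ K]
    [TopologicalSpace P] [ChartedSpace K P] [IsManifold 𝓘(ℝ, K) ∞ P] {i : N → M}
    (hi : IsSmoothImmersion (E := E) (F := F) i) {j : P → N}
    {V : ∀ q : P, TangentSpace 𝓘(ℝ, F) (j q)} {p : P} (hV : SmoothAlongAt K j V p) (x : K) (w : F) :
    formE g (i (j p)) (diffE i (j p) (covDerivE (LCK.inducedMetric (F := F) g i) j V p x))
        (diffE i (j p) w) =
      formE g (i (j p)) (covDerivE g (fun q => i (j q)) (fun q => diff (E := E) i (j q) (V q)) p x)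
        (diffE i (j p) w) := by
  rw [covDerivE_eq hV, covDerivE_diff hi.smooth hV, map_add, hg.add_left, hg.add_left,
    hg.formE_diffE_christoffelE_inducedMetric hi]
  ring

end LeviCivita

/-! ### Conformal changes and the covariant derivative of `J` -/

section ConformallyKahler

open Filter

variable {E : Type*} [NormedAddCommGroup E] [NormedSpace ℝ E] [FiniteDimensional ℝ E]
  {M : Type*} [TopologicalSpace M] [ChartedSpace E M] [IsManifold 𝓘(ℝ, E) ∞ M]
  {F : Type*} [NormedAddCommGroup F] [NormedSpace ℝ F]
  {N : Type*} [TopologicalSpace N] [ChartedSpace F N] [IsManifold 𝓘(ℝ, F) ∞ N]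

theorem contDiffAt_fun_smul {X V : Type*} [NormedAddCommGroup X] [NormedSpace ℝ X]
    [NormedAddCommGroup V] [NormedSpace ℝ V] {c : X → ℝ} {G : X → V} {z : X}
    (hc : ContDiffAt ℝ ∞ c z) (hG : ContDiffAt ℝ ∞ G z) :
    ContDiffAt ℝ ∞ (fun z => c z • G z) z := hc.smul hG

theorem fderiv_fun_smul_apply {X V : Type*} [NormedAddCommGroup X] [NormedSpace ℝ X]
    [NormedAddCommGroup V] [NormedSpace ℝ V] {c : X → ℝ} {c' : X →L[ℝ] ℝ} {G : X → V} {z : X}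
    (hc : HasFDerivAt c c' z) (hG : DifferentiableAt ℝ G z) (u : X) :
    fderiv ℝ (fun z => c z • G z) z u = c z • fderiv ℝ G z u + c' u • G z := by
  rw [(hc.fun_smul hG.hasFDerivAt).fderiv]
  simp

/-- The Christoffel symbols of a conformal change `exp(-f) g` of the metric. -/
theorem formE_christoffelE_conformal
    {g : ∀ x : M, TangentSpace 𝓘(ℝ, E) x → TangentSpace 𝓘(ℝ, E) x → ℝ} (hg : IsSmoothMetric g)
    {f : M → ℝ} {q : M} (hf : ContMDiffAt 𝓘(ℝ, E) 𝓘(ℝ, ℝ) ∞ f q) (u v w : E) :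
    formE g q (christoffelE (fun x v w => Real.exp (-f x) * g x v w) q u v) w =
      formE g q (christoffelE g q u v) w -
        (fderiv ℝ (fun z => f ((extChartAt 𝓘(ℝ, E) q).symm z)) (extChartAt 𝓘(ℝ, E) q q) u *
            formE g q v w +
          fderiv ℝ (fun z => f ((extChartAt 𝓘(ℝ, E) q).symm z)) (extChartAt 𝓘(ℝ, E) q q) v *
            formE g q u w -
          fderiv ℝ (fun z => f ((extChartAt 𝓘(ℝ, E) q).symm z)) (extChartAt 𝓘(ℝ, E) q q) w *
            formE g q u v) / 2 := by
  obtain ⟨G, hG⟩ := hg.exists_isCoordForm q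
  have hfc := ContMDiffAt.contDiffAt_comp_symm hf
  set fc : E → ℝ := fun z => f ((extChartAt 𝓘(ℝ, E) q).symm z) with hfc_def
  have hGf : IsCoordForm (fun x v w => Real.exp (-f x) * g x v w) q
      (fun z => Real.exp (-fc z) • G z) :=
    ⟨contDiffAt_fun_smul hfc.neg.exp hG.contDiffAt, hG.eq.mono fun z hz u v => by
      rw [hz]; rfl⟩
  have hd : ∀ u v w, fderiv ℝ (fun z => Real.exp (-fc z) • G z) (extChartAt 𝓘(ℝ, E) q q) u v w =
      Real.exp (-fc (extChartAt 𝓘(ℝ, E) q q)) * (fderiv ℝ G (extChartAt 𝓘(ℝ, E) q q) u v w -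
        fderiv ℝ fc (extChartAt 𝓘(ℝ, E) q q) u * G (extChartAt 𝓘(ℝ, E) q q) v w) := by
    intro u v w
    have h1 : HasFDerivAt (fun z => Real.exp (-fc z)) _ (extChartAt 𝓘(ℝ, E) q q) :=
      (hfc.differentiableAt (by simp)).hasFDerivAt.neg.exp
    refine (congrArg (fun L : E →L[ℝ] E →L[ℝ] ℝ => L v w) (fderiv_fun_smul_apply
      (V := E →L[ℝ] E →L[ℝ] ℝ) (G := G) h1 hG.differentiableAt u)).trans ?_
    simp
    ring
  have hpos : ∀ v : TangentSpace 𝓘(ℝ, E) q, v ≠ 0 → 0 < Real.exp (-f q) * g q v v :=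
    fun v hv => mul_pos (Real.exp_pos _) (hg.pos q v hv)
  have h := christoffelE_spec hGf hpos u v w
  rw [hd, hd, hd] at h
  simp only [smul_apply, smul_eq_mul] at h
  have hne := Real.exp_pos (-fc (extChartAt 𝓘(ℝ, E) q q))
  simp only [hG.formE_eq, christoffelE_spec hG (hg.pos q)]
  refine mul_left_cancel₀ hne.ne' (h.trans ?_)
  ring

/-- The vector field on the domain of the preferred chart at `q` with constant components `v`. -/
def chartField (q : M) (v : E) (x : M) : TangentSpace 𝓘(ℝ, E) x :=
  show E from fromChart q (extChartAt 𝓘(ℝ, E) q x) v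

theorem toChart_chartField {q x : M} (hx : x ∈ (extChartAt 𝓘(ℝ, E) q).source) (v : E) :
    toChart q x (chartField q v x) = v := by
  obtain ⟨z, hz, rfl⟩ : ∃ z ∈ (extChartAt 𝓘(ℝ, E) q).target, (extChartAt 𝓘(ℝ, E) q).symm z = x :=
    ⟨_, (extChartAt 𝓘(ℝ, E) q).map_source hx, (extChartAt 𝓘(ℝ, E) q).left_inv hx⟩
  have h : (chartField q v ((extChartAt 𝓘(ℝ, E) q).symm z) : E) = fromChart q z v := by
    unfold chartField
    rw [(extChartAt 𝓘(ℝ, E) q).right_inv hz]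
  exact (congrArg (fun y : E => toChart q ((extChartAt 𝓘(ℝ, E) q).symm z) y) h).trans
    (toChart_fromChart hz v)

theorem chartField_center (q : M) (v : E) : chartField q v q = v :=
  fromChart_center q v

theorem smoothFieldOn_chartField (q : M) (v : E) :
    SmoothFieldOn (chartField q v) (extChartAt 𝓘(ℝ, E) q).source := by
  intro x hx
  refine ContMDiffAt.contMDiffWithinAt ?_
  have hx' := hx
  rw [extChartAt_source] at hx'
  refine (contMDiffAt_along_iff (φ := fun x => x) (c := q) hx').2 ⟨contMDiffAt_id, ?_⟩
  refine (contMDiffAt_const (c := v)).congr_of_eventuallyEq ?_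
  filter_upwards [(isOpen_extChartAt_source (I := 𝓘(ℝ, E)) q).mem_nhds hx] with y hy
  exact toChart_chartField hy v

theorem smoothAlongAt_chartField {q x : M} (v : E) (hx : x ∈ (extChartAt 𝓘(ℝ, E) q).source) :
    SmoothAlongAt E (fun x => x) (chartField q v) x :=
  (smoothFieldOn_chartField q v).contMDiffAt ((isOpen_extChartAt_source q).mem_nhds hx)

theorem diffE_id (q : M) : diffE (E := E) (F := E) (fun x : M => x) q = ContinuousLinearMap.id ℝ E
    :=
  mfderiv_id

namespace AlmostHermitian

variable (H : AlmostHermitian E M)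

/-- The almost complex structure at `q`, as a map of the model space. -/
def JE (q : M) : E →L[ℝ] E := H.J q

theorem JE_sq (q : M) (v : E) : H.JE q (H.JE q v) = -v := H.J_sq q v

theorem formE_JE_left (q : M) (u v : E) :
    formE H.g q (H.JE q u) v = -formE H.g q u (H.JE q v) := by
  have h : formE H.g q (H.JE q u) (H.JE q (H.JE q v)) = formE H.g q u (H.JE q v) :=
    H.metric_J q u (H.JE q v)
  rw [H.JE_sq, H.isSmoothMetric_g.neg_right] at h
  linarith

theorem coordJ_center_eq (q : M) : H.coordJ q (extChartAt 𝓘(ℝ, E) q q) = H.JE q :=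
  ContinuousLinearMap.ext fun v => H.coordJ_center q v

/-- The covariant derivative of `J` at `q`: the vector `(∇_u J) v`. -/
def nablaJ (q : M) (u v : E) : E :=
  fderiv ℝ (H.coordJ q) (extChartAt 𝓘(ℝ, E) q q) u v + christoffelE H.g q u (H.JE q v) -
    H.JE q (christoffelE H.g q u v)

theorem coordField_J {φ : N → M} {V : ∀ q : N, TangentSpace 𝓘(ℝ, E) (φ q)} {p : N}
    (hφ : ContinuousAt φ p) :
    coordField (F := F) φ (fun q => H.J (φ q) (V q)) p =ᶠ[𝓝 (extChartAt 𝓘(ℝ, F) p p)]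
      fun y => H.coordJ (φ p) (coordMap (E := E) (F := F) φ p y) (coordField (F := F) φ V p y) := by
  have h1 : Tendsto (fun y => φ ((extChartAt 𝓘(ℝ, F) p).symm y)) (𝓝 (extChartAt 𝓘(ℝ, F) p p))
      (𝓝 (φ p)) := hφ.tendsto.comp (by
    have := continuousAt_extChartAt_symm (I := 𝓘(ℝ, F)) p
    rwa [ContinuousAt, extChartAt_to_inv] at this)
  filter_upwards [h1.eventually (extChartAt_source_mem_nhds (I := 𝓘(ℝ, E)) (φ p))] with y hy
  exact H.toChart_J hy _

theorem smoothAlongAt_J {φ : N → M} {V : ∀ q : N, TangentSpace 𝓘(ℝ, E) (φ q)} {p : N}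
    (hV : SmoothAlongAt F φ V p) : SmoothAlongAt F φ (fun q => H.J (φ q) (V q)) p :=
  H.contMDiffAt_J hV

theorem fderiv_coordField_J {φ : N → M} {V : ∀ q : N, TangentSpace 𝓘(ℝ, E) (φ q)} {p : N}
    (hV : SmoothAlongAt F φ V p) (x : F) :
    fderiv ℝ (coordField (F := F) φ (fun q => H.J (φ q) (V q)) p) (extChartAt 𝓘(ℝ, F) p p) x =
      fderiv ℝ (H.coordJ (φ p)) (extChartAt 𝓘(ℝ, E) (φ p) (φ p)) (diffE φ p x) (valE V p) +
        H.JE (φ p) (fderiv ℝ (coordField (F := F) φ V p) (extChartAt 𝓘(ℝ, F) p p) x) := by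
  have hφ := hV.contMDiffAt
  rw [(H.coordField_J hφ.continuousAt).fderiv_eq]
  have hA : DifferentiableAt ℝ (H.coordJ (φ p))
      (coordMap (E := E) (F := F) φ p (extChartAt 𝓘(ℝ, F) p p)) := by
    rw [coordMap_center]
    exact (H.contDiffAt_coordJ _).differentiableAt (by simp)
  have h1 : HasFDerivAt (fun y => H.coordJ (φ p) (coordMap (E := E) (F := F) φ p y)) _
      (extChartAt 𝓘(ℝ, F) p p) :=
    HasFDerivAt.comp (G := E →L[ℝ] E) _ hA.hasFDerivAt
      ((contDiffAt_coordMap hφ).differentiableAt (by simp)).hasFDerivAt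
  rw [(h1.clm_apply ((contDiffAt_coordField hV).differentiableAt (by simp)).hasFDerivAt).fderiv]
  simp only [add_apply, ContinuousLinearMap.comp_apply,
    ContinuousLinearMap.flip_apply]
  rw [coordMap_center, ← diffE_eq hφ, ← valE_eq, coordJ_center_eq, add_comm]

/-- `∇_x (J V) = J ∇_x V + (∇_x J) V`. -/
theorem covDerivE_J {φ : N → M} {V : ∀ q : N, TangentSpace 𝓘(ℝ, E) (φ q)} {p : N}
    (hV : SmoothAlongAt F φ V p) (x : F) :
    covDerivE H.g φ (fun q => H.J (φ q) (V q)) p x =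
      H.JE (φ p) (covDerivE H.g φ V p x) + H.nablaJ (φ p) (diffE φ p x) (valE V p) := by
  rw [covDerivE_eq (H.smoothAlongAt_J hV), H.fderiv_coordField_J hV, covDerivE_eq hV, map_add]
  have h : valE (fun q => H.J (φ q) (V q)) p = H.JE (φ p) (valE V p) := rfl
  rw [h]
  unfold nablaJ
  abel

/-- `J` is parallel for the conformal metric `exp(-f) g`, expressed in the chart at `q`. -/
theorem IsConformalKahlerOn.fderiv_coordJ {H : AlmostHermitian E M} {f : M → ℝ} {U : Set M}
    (h : H.IsConformalKahlerOn f U) {q : M} (hq : q ∈ U) (u v : E) :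
    fderiv ℝ (H.coordJ q) (extChartAt 𝓘(ℝ, E) q q) u v =
      H.JE q (christoffelE (fun x v w => Real.exp (-f x) * H.g x v w) q u v) -
        christoffelE (fun x v w => Real.exp (-f x) * H.g x v w) q u (H.JE q v) := by
  have h1 := h q hq (chartField q v) ⟨_, isOpen_extChartAt_source q, mem_extChartAt_source q,
    smoothFieldOn_chartField q v⟩ u
  have hs := smoothAlongAt_chartField v (mem_extChartAt_source (I := 𝓘(ℝ, E)) q)
  have h2 := covDerivE_eq (g := fun x v w => Real.exp (-f x) * H.g x v w) hs u
  have h3 := covDerivE_eq (g := fun x v w => Real.exp (-f x) * H.g x v w) (H.smoothAlongAt_J hs) u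
  rw [H.fderiv_coordField_J hs] at h3
  have h4 : fderiv ℝ (coordField (F := E) (fun x => x) (chartField q v) q)
      (extChartAt 𝓘(ℝ, E) q q) u = 0 := by
    have h5 : coordField (F := E) (fun x => x) (chartField q v) q =ᶠ[𝓝 (extChartAt 𝓘(ℝ, E) q q)]
        fun _ => v := by
      filter_upwards [extChartAt_target_mem_nhds (I := 𝓘(ℝ, E)) q] with y hy
      exact toChart_chartField ((extChartAt 𝓘(ℝ, E) q).map_target hy) v
    rw [h5.fderiv_eq, (hasFDerivAt_const v (extChartAt 𝓘(ℝ, E) q q)).fderiv]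
    rfl
  have h6 : valE (chartField q v) q = v := chartField_center q v
  have h7 : valE (fun x => H.J x (chartField q v x)) q = H.JE q v := congrArg (H.JE q) h6
  rw [h4, h6, diffE_id, map_zero, h7] at h3
  rw [h4, h6, diffE_id] at h2
  have h8 : covDerivE (fun x v w => Real.exp (-f x) * H.g x v w) (fun x => x)
      (fun x => H.J x (chartField q v x)) q u = H.JE q
      (covDerivE (fun x v w => Real.exp (-f x) * H.g x v w) (fun x => x) (chartField q v) q u) := h1
  rw [h2, h3] at h8
  simp only [ContinuousLinearMap.id_apply, add_zero, zero_add] at h8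
  exact eq_sub_of_add_eq h8

/-- The derivative of `Ω = g(·, J ·)` by the product rule. -/
theorem partialDeriv_kahlerForm (q : M) {G : E → E →L[ℝ] E →L[ℝ] ℝ} (hG : IsCoordForm H.g q G)
    (u v w : E) :
    partialDeriv H.kahlerForm q u v w =
      fderiv ℝ G (extChartAt 𝓘(ℝ, E) q q) u v (H.JE q w) +
        formE H.g q v (fderiv ℝ (H.coordJ q) (extChartAt 𝓘(ℝ, E) q q) u w) := by
  have h1 : (fun z => H.kahlerForm _ (fromChart q z v) (fromChart q z w))
      =ᶠ[𝓝 (extChartAt 𝓘(ℝ, E) q q)] fun z => G z v (H.coordJ q z w) := by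
    filter_upwards [hG.eq, extChartAt_target_mem_nhds (I := 𝓘(ℝ, E)) q] with z hz hz'
    rw [← hz]
    have h2 : fromChart q z (H.coordJ q z w) = H.J _ (fromChart q z w) :=
      fromChart_toChart hz' (H.J _ (fromChart q z w))
    rw [h2]
    rfl
  have hA := (H.contDiffAt_coordJ q).differentiableAt (by simp)
  unfold partialDeriv
  rw [h1.fderiv_eq]
  have h3 := (hA.hasFDerivAt.clm_apply (hasFDerivAt_const w (extChartAt 𝓘(ℝ, E) q q)))
  have h4 := (hG.differentiableAt.hasFDerivAt.clm_apply
    (hasFDerivAt_const v (extChartAt 𝓘(ℝ, E) q q))).clm_apply h3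
  rw [h4.fderiv, hG.formE_eq, ← H.coordJ_center_eq]
  simp
  abel

/-- At each point of a locally conformal Kähler manifold, `dΩ = θ ∧ Ω`, and the covariant
derivative of `J` is expressed in terms of `θ`; here `θ` is the differential of the function `f`
for which `exp(-f) g` is Kähler. -/
theorem IsLCK.exists_nablaJ {H : AlmostHermitian E M} (hH : H.IsLCK) (q : M) :
    ∃ θ : E →L[ℝ] ℝ,
      (∀ u v w : E, extDeriv₂ H.kahlerForm q u v w =
        θ u * formE H.g q v (H.JE q w) + θ v * formE H.g q w (H.JE q u) +
          θ w * formE H.g q u (H.JE q v)) ∧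
      ∀ u v w : E, formE H.g q (H.nablaJ q u v) w =
        (θ v * formE H.g q u (H.JE q w) - θ (H.JE q w) * formE H.g q u v +
          θ (H.JE q v) * formE H.g q u w - θ w * formE H.g q u (H.JE q v)) / 2 := by
  obtain ⟨U, hU, hq, f, hf, hK⟩ := hH q
  have hg := H.isSmoothMetric_g
  have hT := formE_christoffelE_conformal hg (hf.contMDiffAt (hU.mem_nhds hq))
  set θ := fderiv ℝ (fun z => f ((extChartAt 𝓘(ℝ, E) q).symm z)) (extChartAt 𝓘(ℝ, E) q q)
  have hsub : ∀ u v w, formE H.g q u (v - w) = formE H.g q u v - formE H.g q u w :=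
    fun u v w => by rw [hg.formE_symm, hg.sub_left, hg.formE_symm q v, hg.formE_symm q w]
  refine ⟨θ, fun u v w => ?_, fun u v w => ?_⟩
  · -- in the cyclic sum of the `partialDeriv` the Christoffel symbols of `g` cancel by symmetry
    obtain ⟨G, hG⟩ := hg.exists_isCoordForm q
    have hP : ∀ u v w : E, partialDeriv H.kahlerForm q u v w =
        formE H.g q (christoffelE H.g q u v) (H.JE q w) -
        formE H.g q (christoffelE H.g q u w) (H.JE q v) +
        (θ u * formE H.g q w (H.JE q v) + θ w * formE H.g q u (H.JE q v) -
          θ (H.JE q v) * formE H.g q u w) / 2 +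
        (θ u * formE H.g q (H.JE q w) v + θ (H.JE q w) * formE H.g q u v -
          θ v * formE H.g q u (H.JE q w)) / 2 := by
      intro u v w
      rw [H.partialDeriv_kahlerForm q hG, hK.fderiv_coordJ hq, hg.fderiv_coord_eq hG, hsub]
      have h1 := hT u w (H.JE q v)
      have h2 := hT u (H.JE q w) v
      rw [hg.formE_symm q v (H.JE q _), H.formE_JE_left, hg.formE_symm q v,
        hg.formE_symm q v]
      linarith
    have h3 : extDeriv₂ H.kahlerForm q u v w = partialDeriv H.kahlerForm q u v w +
      partialDeriv H.kahlerForm q v w u + partialDeriv H.kahlerForm q w u v := rfl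
    rw [h3, hP, hP, hP, hg.christoffelE_symm q v u, hg.christoffelE_symm q w u,
      hg.christoffelE_symm q w v, H.formE_JE_left, H.formE_JE_left, H.formE_JE_left,
      hg.formE_symm q w u, hg.formE_symm q w v, hg.formE_symm q v u]
    have e1 := H.formE_JE_left q u v
    have e2 := H.formE_JE_left q u w
    have e3 := H.formE_JE_left q v w
    rw [hg.formE_symm] at e1 e2 e3
    rw [e1, e2, e3]
    ring
  · unfold nablaJ
    rw [hK.fderiv_coordJ hq, hg.sub_left, hg.add_left, hg.sub_left, H.formE_JE_left,
      H.formE_JE_left, hT, hT, H.formE_JE_left]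
    ring

end AlmostHermitian

end ConformallyKahler

/-! ### Pointwise algebra of CR-submanifolds -/

section CRPointwise

open Filter Module

theorem isCompl_orthogonal_of_pos {V : Type*} [AddCommGroup V] [Module ℝ V] [FiniteDimensional ℝ V]
    (B : LinearMap.BilinForm ℝ V) (hs : ∀ v w, B v w = B w v) (hpos : ∀ v, v ≠ 0 → 0 < B v v)
    (W : Submodule ℝ V) : IsCompl W (B.orthogonal W) ∧ B.orthogonal (B.orthogonal W) = W := by
  have hrefl : B.IsRefl := fun x y h => (hs y x).trans h
  have hnd : B.Nondegenerate := by
    refine (LinearMap.IsRefl.nondegenerate_iff_separatingLeft hrefl).2 fun v hv => ?_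
    by_contra h
    exact (hpos v h).ne' (hv v)
  refine ⟨(LinearMap.BilinForm.isCompl_orthogonal_iff_disjoint hrefl).2 ?_,
    LinearMap.BilinForm.orthogonal_orthogonal hnd hrefl W⟩
  refine Submodule.disjoint_def.2 fun v hv hv' => ?_
  by_contra h
  exact (hpos v h).ne' (hv' v hv)

variable {E : Type*} [NormedAddCommGroup E] [NormedSpace ℝ E] [FiniteDimensional ℝ E]
  {Mb : Type*} [TopologicalSpace Mb] [ChartedSpace E Mb] [IsManifold 𝓘(ℝ, E) ∞ Mb]
  {F : Type*} [NormedAddCommGroup F] [NormedSpace ℝ F] [FiniteDimensional ℝ F]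
  {M : Type*} [TopologicalSpace M] [ChartedSpace F M] [IsManifold 𝓘(ℝ, F) ∞ M]
  {H : AlmostHermitian E Mb} {i : M → Mb}
  {D : ∀ p : M, Submodule ℝ (TangentSpace 𝓘(ℝ, F) p)}

/-- The fibre at `p` of a distribution, as a subspace of the model space. -/
def fibre (D : ∀ p : M, Submodule ℝ (TangentSpace 𝓘(ℝ, F) p)) (p : M) : Submodule ℝ F := D p

theorem mem_fibre_orthDist {p : M} {y : F} :
    y ∈ fibre (orthDist H i D) p ↔
      ∀ x ∈ fibre D p, formE H.g (i p) (diffE i p x) (diffE i p y) = 0 := Iff.rfl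

namespace IsCRSubmanifold

theorem isCompl_and_orthDist_orthDist (hM : IsCRSubmanifold H i D) (p : M) :
    IsCompl (fibre D p) (fibre (orthDist H i D) p) ∧
      fibre (orthDist H i (orthDist H i D)) p = fibre D p := by
  have hg := H.isSmoothMetric_g
  have hgM := hg.inducedMetric hM.immersion
  obtain ⟨G, hG⟩ := hgM.exists_isCoordForm p
  let B : LinearMap.BilinForm ℝ F := LinearMap.mk₂ ℝ
    (fun v w => G (extChartAt 𝓘(ℝ, F) p p) v w) (by simp) (by simp) (by simp) (by simp)
  have hB : ∀ v w, B v w = formE (inducedMetric (F := F) H.g i) p v w :=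
    fun v w => (hG.formE_eq v w).symm
  have h := isCompl_orthogonal_of_pos B (fun v w => by rw [hB, hB, hgM.formE_symm])
    (fun v hv => by rw [hB]; exact hgM.pos p v hv) (fibre D p)
  have hD : ∀ D' : ∀ p : M, Submodule ℝ (TangentSpace 𝓘(ℝ, F) p),
      B.orthogonal (fibre D' p) = fibre (orthDist H i D') p := by
    intro D'
    ext y
    refine Iff.trans ?_ mem_fibre_orthDist.symm
    refine forall₂_congr fun x _ => ?_
    change B x y = 0 ↔ _
    rw [hB]
    rfl
  rw [hD, hD] at h
  exact h

theorem isCompl (hM : IsCRSubmanifold H i D) (p : M) :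
    IsCompl (fibre D p) (fibre (orthDist H i D) p) := (hM.isCompl_and_orthDist_orthDist p).1

theorem mem_of_forall_orthogonal (hM : IsCRSubmanifold H i D) {p : M} {x : F}
    (hx : ∀ y ∈ fibre (orthDist H i D) p,
      formE H.g (i p) (diffE i p x) (diffE i p y) = 0) : x ∈ fibre D p := by
  rw [← (hM.isCompl_and_orthDist_orthDist p).2]
  exact mem_fibre_orthDist.2 fun y hy => by
    rw [H.isSmoothMetric_g.formE_symm]; exact hx y hy

theorem exists_diffE_eq_JE (hM : IsCRSubmanifold H i D) {p : M} {z : F} (hz : z ∈ fibre D p) :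
    ∃ z' ∈ fibre D p, diffE (E := E) i p z = H.JE (i p) (diffE i p z') := by
  have h : diff (E := E) i p z ∈ (D p).map (diff (E := E) (F := F) i p).toLinearMap :=
    Submodule.mem_map_of_mem hz
  rw [← hM.holomorphic p] at h
  obtain ⟨z', hz', h'⟩ := h
  exact ⟨z', hz', h'.symm⟩

theorem exists_JE_diffE_eq (hM : IsCRSubmanifold H i D) {p : M} {z : F} (hz : z ∈ fibre D p) :
    ∃ z' ∈ fibre D p, H.JE (i p) (diffE i p z) = diffE (E := E) i p z' := by
  obtain ⟨z', hz', h'⟩ := hM.exists_diffE_eq_JE hz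
  refine ⟨-z', Submodule.neg_mem _ hz', ?_⟩
  rw [h', H.JE_sq, map_neg]

/-- `J D^⊥` is normal. -/
theorem formE_JE_orthDist (hM : IsCRSubmanifold H i D) {p : M} {y : F}
    (hy : y ∈ fibre (orthDist H i D) p) (w : F) :
    formE H.g (i p) (H.JE (i p) (diffE i p y)) (diffE i p w) = 0 :=
  hM.totallyReal p ⟨y, hy, rfl⟩ w

/-- `D^⊥` is the kernel of the pullback of the Kähler form to the submanifold. -/
theorem mem_orthDist_iff (hM : IsCRSubmanifold H i D) {p : M} {y : F} :
    y ∈ fibre (orthDist H i D) p ↔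
      ∀ w : F, formE H.g (i p) (diffE i p y) (H.JE (i p) (diffE i p w)) = 0 := by
  refine ⟨fun hy w => ?_, fun h => mem_fibre_orthDist.2 fun x hx => ?_⟩
  · have h := hM.formE_JE_orthDist hy w
    rwa [H.formE_JE_left, neg_eq_zero] at h
  · obtain ⟨x', -, h'⟩ := hM.exists_diffE_eq_JE hx
    rw [h', H.isSmoothMetric_g.formE_symm]
    exact h x'

/-- If the Lee vector field is normal, then `J` is parallel on `D^⊥` up to a component orthogonal
to `D`: the differential of the conformal factor agrees with the Lee form on `D` as soon as
`D^⊥ ≠ 0`, and the Lee form vanishes on `D`. -/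
theorem formE_nablaJ_eq_zero (hM : IsCRSubmanifold H i D) (hH : H.IsLCK)
    {lee : ∀ x : Mb, TangentSpace 𝓘(ℝ, E) x →L[ℝ] ℝ} (hlee : H.IsLeeForm lee) {p : M}
    (hB : H.leeField lee (i p) ∈ normalSpace F H i p) {x y z : F}
    (hx : x ∈ fibre (orthDist H i D) p) (hy : y ∈ fibre (orthDist H i D) p) (hz : z ∈ fibre D p) :
    formE H.g (i p) (H.nablaJ (i p) (diffE i p x) (diffE i p y)) (diffE i p z) = 0 := by
  have hg := H.isSmoothMetric_g
  obtain ⟨θ, hθ, hJ⟩ := hH.exists_nablaJ (i p)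
  -- if `y = 0` there is no relation between `θ` and the Lee form, but nothing to prove either
  by_cases hy0 : y = 0
  · subst hy0
    rw [hJ]
    have h0 : ∀ u : E, formE H.g (i p) u 0 = 0 := fun u => by
      obtain ⟨G, hG⟩ := hg.exists_isCoordForm (i p)
      simp [hG.formE_eq]
    have hxz := (mem_fibre_orthDist.1 hx) z hz
    rw [hg.formE_symm] at hxz
    simp [h0, hxz]
  have hdy : diffE (E := E) i p y ≠ 0 := fun h =>
    hy0 (hM.immersion.injective p (h.trans (map_zero (diff i p)).symm))
  let l : E →L[ℝ] ℝ := lee (i p)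
  have hlee0 : ∀ w : F, l (diffE (E := E) i p w) = 0 := by
    intro w
    obtain ⟨G, hG⟩ := hg.exists_isCoordForm (i p)
    have h := sharp_apply_of_pos (V := E) (G (extChartAt 𝓘(ℝ, E) (i p) (i p)))
      (fun v hv => by rw [← hG.center]; exact hg.pos _ v hv) (β := H.g (i p))
      (fun v w => hG.center v w) (lee (i p)) (a := lee (i p)) (fun _ => rfl) (diffE i p w)
    exact h.symm.trans (hB w)
  -- evaluate `(lee - θ) ∧ Ω = 0` on `(z, y, J y)`
  have hθ0 : ∀ z ∈ fibre D p, θ (diffE (E := E) i p z) = 0 := by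
    intro z hz
    have h1 := hθ (diffE i p z) (diffE i p y) (H.JE (i p) (diffE i p y))
    have h2 := hlee.d_kahlerForm (i p) (diffE (E := E) i p z) (diffE (E := E) i p y)
      (H.JE (i p) (diffE (E := E) i p y))
    have h4 : l (diffE i p z) * formE H.g (i p) (diffE i p y) (H.JE (i p) (H.JE (i p) (diffE i p
        y)))
        + l (diffE i p y) * formE H.g (i p) (H.JE (i p) (diffE i p y)) (H.JE (i p) (diffE i p z))
        + l (H.JE (i p) (diffE i p y)) * formE H.g (i p) (diffE i p z) (H.JE (i p) (diffE i p y)) =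
        _ := h2.symm.trans h1
    have h5 := hlee0 z
    have h6 : formE H.g (i p) (diffE i p z) (H.JE (i p) (diffE i p y)) = 0 := by
      rw [hg.formE_symm]; exact hM.formE_JE_orthDist hy z
    have h7 : formE H.g (i p) (H.JE (i p) (diffE i p y)) (H.JE (i p) (diffE i p z)) = 0 := by
      obtain ⟨z', -, h'⟩ := hM.exists_JE_diffE_eq hz
      rw [h']; exact hM.formE_JE_orthDist hy z'
    have h8 : formE H.g (i p) (diffE i p y) (H.JE (i p) (H.JE (i p) (diffE i p y))) ≠ 0 := by
      rw [H.JE_sq, hg.neg_right]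
      exact neg_ne_zero.2 (hg.pos _ _ hdy).ne'
    rw [h5, h6, h7, zero_mul, mul_zero, mul_zero, mul_zero, mul_zero, add_zero, add_zero,
      add_zero, add_zero] at h4
    exact (mul_eq_zero.1 h4.symm).resolve_right h8
  obtain ⟨z', hz', h'⟩ := hM.exists_JE_diffE_eq hz
  have h1 := mem_fibre_orthDist.1 hx z hz
  have h2 := mem_fibre_orthDist.1 hx z' hz'
  rw [hg.formE_symm] at h1 h2
  rw [hJ, h', hθ0 z hz, hθ0 z' hz', h1, h2]
  ring

end IsCRSubmanifold

end CRPointwise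

/-! ### Integrability of the totally real distribution -/

section Frame

open Filter Module

variable {E : Type*} [NormedAddCommGroup E] [NormedSpace ℝ E] [FiniteDimensional ℝ E]
  {Mb : Type*} [TopologicalSpace Mb] [ChartedSpace E Mb] [IsManifold 𝓘(ℝ, E) ∞ Mb]
  {F : Type*} [NormedAddCommGroup F] [NormedSpace ℝ F] [FiniteDimensional ℝ F]
  {M : Type*} [TopologicalSpace M] [ChartedSpace F M] [IsManifold 𝓘(ℝ, F) ∞ M]
  {H : AlmostHermitian E Mb} {i : M → Mb}
  {D : ∀ p : M, Submodule ℝ (TangentSpace 𝓘(ℝ, F) p)}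

/-- The differential of the inverse of the preferred chart at `p`, as a map of the model space. -/
def fromChartE (p : M) (z : F) : F →L[ℝ] F := fromChartL p z

/-- The linear equivalence given by the differential of the inverse of the preferred chart. -/
def fromChartEquiv (p : M) {z : F} (hz : z ∈ (extChartAt 𝓘(ℝ, F) p).target) : F ≃ₗ[ℝ] F where
  toFun := fromChartE p z
  map_add' := map_add _
  map_smul' := map_smul _
  invFun w := toChart p ((extChartAt 𝓘(ℝ, F) p).symm z) w
  left_inv u := toChart_fromChart hz u
  right_inv w := fromChart_toChart hz w

/-- The differential of `i`, on vectors given by their components in the preferred chart at `p`. -/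
def chartDiff (E : Type*) [NormedAddCommGroup E] [NormedSpace ℝ E]
    {Mb : Type*} [TopologicalSpace Mb] [ChartedSpace E Mb] (i : M → Mb) (p : M) (z : F) :
    F →L[ℝ] E := diffE i ((extChartAt 𝓘(ℝ, F) p).symm z) ∘L fromChartE p z

/-- The pullback of the Kähler form by `i`, in the preferred chart at `p`. -/
def coordKahler (H : AlmostHermitian E Mb) (i : M → Mb) (p : M) (z : F) : F →L[ℝ] F →L[ℝ] ℝ :=
  (show E →L[ℝ] E →L[ℝ] ℝ from
    H.metric.inner (i ((extChartAt 𝓘(ℝ, F) p).symm z))).bilinearComp (chartDiff E i p z)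
      (H.JE (i ((extChartAt 𝓘(ℝ, F) p).symm z)) ∘L chartDiff E i p z)

theorem coordKahler_apply (p : M) (z u v : F) :
    coordKahler H i p z u v = formE H.g (i ((extChartAt 𝓘(ℝ, F) p).symm z)) (chartDiff E i p z u)
      (H.JE (i ((extChartAt 𝓘(ℝ, F) p).symm z)) (chartDiff E i p z v)) := rfl

theorem coordKahler_antisymm (p : M) (z u v : F) :
    coordKahler H i p z u v = -coordKahler H i p z v u := by
  rw [coordKahler_apply, coordKahler_apply, H.isSmoothMetric_g.formE_symm, H.formE_JE_left]

theorem contDiffAt_coordKahler (hi : ContMDiff 𝓘(ℝ, F) 𝓘(ℝ, E) ∞ i) {p : M} {z : F}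
    (hz : z ∈ (extChartAt 𝓘(ℝ, F) p).target) : ContDiffAt ℝ ∞ (coordKahler H i p) z := by
  have h : ContDiffOn ℝ ∞ (coordKahler H i p) (extChartAt 𝓘(ℝ, F) p).target := by
    refine contDiffOn_clm_apply.2 fun u => contDiffOn_clm_apply.2 fun v z hz =>
      ContDiffAt.contDiffWithinAt ?_
    have hs : ∀ u : F, SmoothAlongAt F (fun y => i ((extChartAt 𝓘(ℝ, F) p).symm y))
        (fun y => diff (E := E) i _ (fromChart p y u)) z :=
      fun u => smoothAlongAt_diff hi (contMDiffAt_fromChart hz u)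
    exact contMDiffAt_iff_contDiffAt.1 (H.contMDiffAt_g (hs u) (H.contMDiffAt_J (hs v)))
  exact h.contDiffAt ((isOpen_extChartAt_target p).mem_nhds hz)

theorem fderiv_coordKahler_antisymm (hi : ContMDiff 𝓘(ℝ, F) 𝓘(ℝ, E) ∞ i) {p : M} {z : F}
    (hz : z ∈ (extChartAt 𝓘(ℝ, F) p).target) (u v w : F) :
    fderiv ℝ (coordKahler H i p) z u v w = -fderiv ℝ (coordKahler H i p) z u w v := by
  have hd := (contDiffAt_coordKahler (H := H) hi hz).differentiableAt (by simp)
  rw [← fderiv_apply₂ hd, ← fderiv_apply₂ hd]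
  have h : (fun y => coordKahler H i p y v w) = fun y => -coordKahler H i p y w v :=
    funext fun y => coordKahler_antisymm p y v w
  rw [h, fderiv_fun_neg]
  rfl

/-- The pullback of `dΩ`, in the preferred chart at `p`. -/
theorem extDeriv_coordKahler (hi : ContMDiff 𝓘(ℝ, F) 𝓘(ℝ, E) ∞ i) {p : M} {z : F}
    (hz : z ∈ (extChartAt 𝓘(ℝ, F) p).target) (u v w : F) :
    fderiv ℝ (coordKahler H i p) z u v w + fderiv ℝ (coordKahler H i p) z v w u +
      fderiv ℝ (coordKahler H i p) z w u v =
    extDeriv₂ H.kahlerForm (i ((extChartAt 𝓘(ℝ, F) p).symm z)) (chartDiff E i p z u)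
      (chartDiff E i p z v) (chartDiff E i p z w) := by
  set Φ : F → Mb := fun y => i ((extChartAt 𝓘(ℝ, F) p).symm y) with hΦ_def
  have hΦ : ContMDiffAt 𝓘(ℝ, F) 𝓘(ℝ, E) ∞ Φ z := contMDiffAt_comp_symm hi hz
  obtain ⟨G, hG⟩ := H.exists_isCoordForm_kahlerForm (Φ z)
  set ψ : F → E := fun y => extChartAt 𝓘(ℝ, E) (Φ z) (Φ y) with hψ_def
  have hψ : ContDiffAt ℝ ∞ ψ z := contDiffAt_extChartAt_comp hΦ
  have h1 : ∀ u v, (fun y => coordKahler H i p y u v) =ᶠ[𝓝 z] fun y => pullbackForm G ψ y u v := by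
    intro u v
    filter_upwards [eventually_mfderiv_eq_pullbackForm hG hΦ,
      (isOpen_extChartAt_target p).mem_nhds hz] with y hy hy'
    rw [← hy u v, hΦ_def, mfderiv_comp_symm_eq hi hy', mfderiv_comp_symm_eq hi hy']
    rfl
  have hd := (contDiffAt_coordKahler (H := H) hi hz).differentiableAt (by simp)
  have hGψ : ContDiffAt ℝ ∞ G (ψ z) := hG.contDiffAt
  have hd' := (contDiffAt_pullbackForm hGψ hψ).differentiableAt (by simp)
  have h2 : ∀ u v w, fderiv ℝ (coordKahler H i p) z u v w =
      fderiv ℝ (pullbackForm G ψ) z u v w := by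
    intro u v w
    rw [← fderiv_apply₂ hd, ← fderiv_apply₂ hd', (h1 v w).fderiv_eq]
  have h3 : ∀ u, fderiv ℝ ψ z u = chartDiff E i p z u := by
    intro u
    rw [← (toChart_mfderiv_eventually hΦ).self_of_nhds u]
    exact (toChart_self _ _).trans (mfderiv_comp_symm_eq hi hz u)
  have h4 : ∀ u v w : E, partialDeriv H.kahlerForm (Φ z) u v w = fderiv ℝ G (ψ z) u v w :=
    fun u v w => hG.partialDeriv u v w
  have h5 : ∀ u v w : E, extDeriv₂ H.kahlerForm (Φ z) u v w = partialDeriv H.kahlerForm (Φ z) u v w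
      +
      partialDeriv H.kahlerForm (Φ z) v w u + partialDeriv H.kahlerForm (Φ z) w u v :=
    fun _ _ _ => rfl
  have h6 : ∀ u v : E, G (ψ z) u v = -G (ψ z) v u := by
    intro u v
    have h7 : ∀ u v : E, G (ψ z) u v = formE H.g (Φ z) u (H.JE (Φ z) v) :=
      fun u v => (hG.center u v).symm
    rw [h7, h7, H.isSmoothMetric_g.formE_symm, H.formE_JE_left]
  refine Eq.trans ?_ (h5 _ _ _).symm
  simp only [h4, h2, fderiv_pullbackForm hGψ hψ, h3]
  rw [fderiv_fderiv_symm hψ v u, fderiv_fderiv_symm hψ w u, fderiv_fderiv_symm hψ w v,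
    h6 (chartDiff E i p z v) (fderiv ℝ (fderiv ℝ ψ) z u w),
    h6 (chartDiff E i p z w) (fderiv ℝ (fderiv ℝ ψ) z u v),
    h6 (chartDiff E i p z u) (fderiv ℝ (fderiv ℝ ψ) z v w)]
  ring

namespace IsCRSubmanifold

theorem mem_ker_coordKahler (hM : IsCRSubmanifold H i D) {p : M} {z : F}
    (hz : z ∈ (extChartAt 𝓘(ℝ, F) p).target) {u : F} :
    u ∈ LinearMap.ker (coordKahler H i p z).toLinearMap ↔
      fromChartE p z u ∈ fibre (orthDist H i D) ((extChartAt 𝓘(ℝ, F) p).symm z) := by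
  rw [hM.mem_orthDist_iff, LinearMap.mem_ker]
  refine ⟨fun h w => ?_, fun h => ContinuousLinearMap.ext fun w => h (fromChartE p z w)⟩
  obtain ⟨w, rfl⟩ := (fromChartEquiv p hz).surjective w
  exact DFunLike.congr_fun h w

theorem finrank_ker_coordKahler (hM : IsCRSubmanifold H i D) {p : M} {z : F}
    (hz : z ∈ (extChartAt 𝓘(ℝ, F) p).target) :
    finrank ℝ (LinearMap.ker (coordKahler H i p z).toLinearMap) +
      finrank ℝ (fibre D ((extChartAt 𝓘(ℝ, F) p).symm z)) = finrank ℝ F := by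
  have h1 : LinearMap.ker (coordKahler H i p z).toLinearMap =
      (fibre (orthDist H i D) ((extChartAt 𝓘(ℝ, F) p).symm z)).map
        (fromChartEquiv p hz).symm.toLinearMap := by
    ext u
    rw [hM.mem_ker_coordKahler hz, Submodule.mem_map]
    refine ⟨fun h => ⟨_, h, (fromChartEquiv p hz).symm_apply_apply u⟩, ?_⟩
    rintro ⟨v, hv, rfl⟩
    have h2 : fromChartE p z ((fromChartEquiv p hz).symm v) = v :=
      (fromChartEquiv p hz).apply_symm_apply v
    exact h2.symm ▸ hv
  rw [h1, add_comm]
  refine Eq.trans (congrArg _ (LinearEquiv.finrank_map_eq (fromChartEquiv p hz).symm _)) ?_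
  exact Submodule.finrank_add_eq_of_isCompl (hM.isCompl _)

theorem eventually_finrank_eq (hM : IsCRSubmanifold H i D) (p : M) :
    ∀ᶠ q in 𝓝 p, finrank ℝ (fibre D q) = finrank ℝ (fibre D p) := by
  obtain ⟨U, hU, hp, r, X, -, hX⟩ := hM.smooth p
  have h : ∀ q ∈ U, finrank ℝ (fibre D q) = r := by
    intro q hq
    obtain ⟨h1, h2⟩ := hX q hq
    have h3 : finrank ℝ (Submodule.span ℝ (Set.range fun a => (show F from X a q))) = r := by
      have := finrank_span_eq_card (R := ℝ) (M := F) (b := fun a => X a q) h1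
      simpa using this
    have h4 : (Submodule.span ℝ (Set.range fun a => (show F from X a q))) = fibre D q := h2
    rw [← h4, h3]
  filter_upwards [hU.mem_nhds hp] with q hq
  rw [h q hq, h p hp]

/-- Near every point, `D^⊥` has a smooth frame (in the chart) whose members commute. This is the
integrability of `D^⊥`: as `D^⊥` is the kernel of the pullback of `Ω`, and the pullback of
`dΩ = ω ∧ Ω` vanishes on two vectors of `D^⊥`, the bracket of two members of a frame is a section of
`D^⊥`; it vanishes when the frame is normalised by a fixed projection `π`. -/
theorem exists_commuting_frame (hM : IsCRSubmanifold H i D)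
    {lee : ∀ x : Mb, TangentSpace 𝓘(ℝ, E) x →L[ℝ] ℝ} (hlee : H.IsLeeForm lee) (p : M) :
    ∃ (k : ℕ) (B : F → EuclideanSpace ℝ (Fin k) →L[ℝ] F) (π : F →L[ℝ] EuclideanSpace ℝ (Fin k)),
      ∀ᶠ z in 𝓝 (extChartAt 𝓘(ℝ, F) p p), z ∈ (extChartAt 𝓘(ℝ, F) p).target ∧
        ContDiffAt ℝ ∞ B z ∧ (∀ a, π (B z a) = a) ∧
        (LinearMap.range (B z).toLinearMap).map (fromChartE p z).toLinearMap =
          fibre (orthDist H i D) ((extChartAt 𝓘(ℝ, F) p).symm z) ∧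
        ∀ a b, fderiv ℝ B z (B z a) b = fderiv ℝ B z (B z b) a := by
  have hi := hM.immersion.smooth
  have htarget := extChartAt_target_mem_nhds (I := 𝓘(ℝ, F)) p
  have hc : Tendsto (extChartAt 𝓘(ℝ, F) p).symm (𝓝 (extChartAt 𝓘(ℝ, F) p p)) (𝓝 p) := by
    have := continuousAt_extChartAt_symm (I := 𝓘(ℝ, F)) p
    rwa [ContinuousAt, extChartAt_to_inv] at this
  have hrank : ∀ᶠ z in 𝓝 (extChartAt 𝓘(ℝ, F) p p),
      finrank ℝ (LinearMap.ker (coordKahler H i p z).toLinearMap) =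
        finrank ℝ (LinearMap.ker (coordKahler H i p (extChartAt 𝓘(ℝ, F) p p)).toLinearMap) := by
    filter_upwards [htarget, hc.eventually (hM.eventually_finrank_eq p)] with z hz hz'
    have h1 := hM.finrank_ker_coordKahler hz
    have h2 := hM.finrank_ker_coordKahler (mem_extChartAt_target (I := 𝓘(ℝ, F)) p)
    rw [extChartAt_to_inv] at h2
    omega
  obtain ⟨k, B, π, hB⟩ := exists_contDiffAt_frame_ker (n := ∞) (A := coordKahler H i p)
    (x₀ := extChartAt 𝓘(ℝ, F) p p)
    (Filter.mem_of_superset htarget fun z hz => contDiffAt_coordKahler hi hz) hrank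
  refine ⟨k, B, π, ?_⟩
  have htarget' : ∀ᶠ z in 𝓝 (extChartAt 𝓘(ℝ, F) p p), z ∈ (extChartAt 𝓘(ℝ, F) p).target := htarget
  filter_upwards [(htarget'.and hB).eventually_nhds] with z hz
  obtain ⟨hzt, hBz, hπ, hr⟩ := hz.self_of_nhds
  refine ⟨hzt, hBz, hπ, ?_, fun a b => ?_⟩
  · rw [hr]
    ext w
    rw [Submodule.mem_map]
    refine ⟨?_, fun hw => ?_⟩
    · rintro ⟨u, hu, rfl⟩
      exact (hM.mem_ker_coordKahler hzt).1 hu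
    · obtain ⟨u, rfl⟩ := (fromChartEquiv p hzt).surjective w
      exact ⟨u, (hM.mem_ker_coordKahler hzt).2 hw, rfl⟩
  have hBd := hBz.differentiableAt (by simp)
  have hWd := (contDiffAt_coordKahler (H := H) hi hzt).differentiableAt (by simp)
  have hdB : ∀ a, HasFDerivAt (fun y => B y a) ((fderiv ℝ B z).flip a) z := fun a => by
    simpa using hBd.hasFDerivAt.clm_apply (hasFDerivAt_const a z)
  set W : F → F →L[ℝ] F →L[ℝ] ℝ := coordKahler H i p with hW_def
  have hker : ∀ a w, W z (B z a) w = 0 := fun a w => by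
    have h1 : B z a ∈ LinearMap.ker (W z).toLinearMap := hr ▸ ⟨a, rfl⟩
    exact DFunLike.congr_fun (LinearMap.mem_ker.1 h1) w
  have hker' : ∀ a w, W z w (B z a) = 0 := fun a w => by
    have h1 : W z w (B z a) = -W z (B z a) w := coordKahler_antisymm (H := H) (i := i) p z w (B z a)
    rw [h1, hker, neg_zero]
  -- the derivative of the identities `W (B a) w = 0`
  have h1 : ∀ u a w, fderiv ℝ W z u (B z a) w + W z (fderiv ℝ B z u a) w = 0 := by
    intro u a w
    have h2 : (fun y => W y (B y a) w) =ᶠ[𝓝 z] fun _ => 0 := by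
      filter_upwards [hz] with y hy
      have h3 : B y a ∈ LinearMap.ker (W y).toLinearMap := hy.2.2.2 ▸ ⟨a, rfl⟩
      exact DFunLike.congr_fun (LinearMap.mem_ker.1 h3) w
    have h4 := (hWd.hasFDerivAt.clm_apply (hdB a)).clm_apply (hasFDerivAt_const w z)
    have h5 := DFunLike.congr_fun (h4.fderiv.symm.trans h2.fderiv_eq) u
    rw [(hasFDerivAt_const (0 : ℝ) z).fderiv] at h5
    simp at h5
    linarith
  have hmem : ∀ a, fromChartE p z (B z a) ∈
      fibre (orthDist H i D) ((extChartAt 𝓘(ℝ, F) p).symm z) := fun a =>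
    (hM.mem_ker_coordKahler hzt).1 (hr ▸ ⟨a, rfl⟩)
  have hd : ∀ w, fderiv ℝ W z (B z a) (B z b) w + fderiv ℝ W z (B z b) w (B z a) +
      fderiv ℝ W z w (B z a) (B z b) = 0 := by
    intro w
    rw [hW_def, extDeriv_coordKahler hi hzt]
    refine (hlee.d_kahlerForm _ _ _ _).trans ?_
    have e : ∀ u v : F, H.kahlerForm (i ((extChartAt 𝓘(ℝ, F) p).symm z)) (chartDiff E i p z u)
      (chartDiff E i p z v) = W z u v := fun _ _ => rfl
    rw [e, e, e, hker, hker', hker]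
    ring
  -- the bracket of `B a` and `B b` lies in `D^⊥`
  have h6 : fderiv ℝ B z (B z a) b - fderiv ℝ B z (B z b) a ∈
      LinearMap.ker (W z).toLinearMap := by
    refine LinearMap.mem_ker.2 (ContinuousLinearMap.ext fun w => ?_)
    change W z (fderiv ℝ B z (B z a) b - fderiv ℝ B z (B z b) a) w = 0
    rw [map_sub, sub_apply]
    have e1 := h1 (B z a) b w
    have e2 := h1 (B z b) a w
    have e3 := h1 w a (B z b)
    have e4 := hd w
    rw [hker'] at e3
    have e5 := fderiv_coordKahler_antisymm (H := H) hi hzt (B z b) w (B z a)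
    rw [← hW_def] at e5
    linarith
  rw [← hr] at h6
  obtain ⟨e, he⟩ := h6
  -- and is killed by the projection `π`, which is injective on `D^⊥`
  have hπ' : ∀ u a, π (fderiv ℝ B z u a) = 0 := by
    intro u a
    have h2 : (fun y => π (B y a)) =ᶠ[𝓝 z] fun _ => a := by
      filter_upwards [hz] with y hy using hy.2.2.1 a
    have h4 := π.hasFDerivAt.comp z (hdB a)
    have h5 := DFunLike.congr_fun (h4.fderiv.symm.trans h2.fderiv_eq) u
    rw [(hasFDerivAt_const a z).fderiv] at h5
    simpa using h5
  have he0 : e = 0 := by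
    have h2 := congrArg π he
    rw [map_sub, hπ', hπ', sub_zero] at h2
    exact (hπ e).symm.trans h2
  rw [he0, map_zero] at he
  exact sub_eq_zero.1 he.symm

end IsCRSubmanifold

end Frame

/-! ### Sections of the distributions, and the shape operator -/

section Sections

open Filter Module

variable {E : Type*} [NormedAddCommGroup E] [NormedSpace ℝ E] [FiniteDimensional ℝ E]
  {Mb : Type*} [TopologicalSpace Mb] [ChartedSpace E Mb] [IsManifold 𝓘(ℝ, E) ∞ Mb]
  {F : Type*} [NormedAddCommGroup F] [NormedSpace ℝ F] [FiniteDimensional ℝ F]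
  {M : Type*} [TopologicalSpace M] [ChartedSpace F M] [IsManifold 𝓘(ℝ, F) ∞ M]
  {H : AlmostHermitian E Mb} {i : M → Mb}
  {D : ∀ p : M, Submodule ℝ (TangentSpace 𝓘(ℝ, F) p)}

/-- A local section of `D'` agrees at a given point with a global one: multiply by a bump
function. -/
theorem exists_isSection_eq [T2Space M] {D' : ∀ p : M, Submodule ℝ (TangentSpace 𝓘(ℝ, F) p)}
    {X : ∀ q : M, TangentSpace 𝓘(ℝ, F) q} {U : Set M} (hU : IsOpen U) {p : M} (hp : p ∈ U)
    (hX : SmoothFieldOn X U) (hD : ∀ q ∈ U, X q ∈ D' q) :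
    ∃ Y, IsSection D' Y ∧ fieldE Y p = fieldE X p := by
  have := isManifold_one F M
  obtain ⟨ψ, -, hψ⟩ := (SmoothBumpFunction.nhds_basis_tsupport (I := 𝓘(ℝ, F)) p).mem_iff.1
    (hU.mem_nhds hp)
  refine ⟨fun q => ψ q • X q, ⟨?_, fun q => ?_⟩, ?_⟩
  · have h := ContMDiffOn.smul_section_of_tsupport (V := fun x : M => TangentSpace 𝓘(ℝ, F) x)
      (n := ∞) ψ.contMDiff.contMDiffOn hU hψ hX
    exact h.contMDiffOn
  · by_cases hq : q ∈ U
    · exact Submodule.smul_mem _ _ (hD q hq)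
    · have h : ψ q = 0 := image_eq_zero_of_notMem_tsupport fun h => hq (hψ h)
      change ψ q • X q ∈ D' q
      rw [h, zero_smul]
      exact Submodule.zero_mem _
  · change ψ p • fieldE X p = fieldE X p
    rw [ψ.eq_one, one_smul]

theorem IsSmoothDistribution.exists_isSection_eq [T2Space M] (hD : IsSmoothDistribution D) {p : M}
    {z : F} (hz : z ∈ fibre D p) : ∃ Y, IsSection D Y ∧ fieldE Y p = z := by
  have := isManifold_one F M
  obtain ⟨U, hU, hp, r, X, hX, hX'⟩ := hD p
  have hz' : ∃ c : Fin r → ℝ, ∑ a, c a • X a p = z := by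
    have h : z ∈ D p := hz
    rw [← (hX' p hp).2] at h
    exact (Submodule.mem_span_range_iff_exists_fun (M := TangentSpace 𝓘(ℝ, F) p) ℝ).1 h
  obtain ⟨c, hc⟩ := hz'
  have h1 : SmoothFieldOn (fun q => ∑ a, c a • X a q) U :=
    ContMDiffOn.sum_section (V := fun x : M => TangentSpace 𝓘(ℝ, F) x)
      fun a _ => (contMDiffOn_const (c := c a)).smul_section (hX a)
  have h2 : ∀ q ∈ U, ∑ a, c a • X a q ∈ D q := by
    intro q hq
    refine Submodule.sum_mem _ fun a _ => Submodule.smul_mem _ _ ?_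
    rw [← (hX' q hq).2]
    exact Submodule.subset_span ⟨a, rfl⟩
  obtain ⟨Y, hY, hYp⟩ := LCK.exists_isSection_eq hU hp h1 h2
  exact ⟨Y, hY, hYp.trans hc⟩

theorem IsCRSubmanifold.exists_isSection_orthDist_eq [T2Space M] (hM : IsCRSubmanifold H i D)
    {lee : ∀ x : Mb, TangentSpace 𝓘(ℝ, E) x →L[ℝ] ℝ} (hlee : H.IsLeeForm lee) {p : M}
    {y : F} (hy : y ∈ fibre (orthDist H i D) p) :
    ∃ Y, IsSection (orthDist H i D) Y ∧ fieldE Y p = y := by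
  obtain ⟨k, B, π, hB⟩ := hM.exists_commuting_frame hlee p
  have h0 := hB.self_of_nhds
  rw [extChartAt_to_inv] at h0
  rw [← h0.2.2.2.1] at hy
  obtain ⟨-, ⟨a, rfl⟩, rfl⟩ := hy
  obtain ⟨V, hV, hVo, hV0⟩ := mem_nhds_iff.1 hB
  let X : ∀ q : M, TangentSpace 𝓘(ℝ, F) q := fun q =>
    show F from fromChartE p (extChartAt 𝓘(ℝ, F) p q) (B (extChartAt 𝓘(ℝ, F) p q) a)
  have h1 : SmoothFieldOn X ((extChartAt 𝓘(ℝ, F) p).source ∩ extChartAt 𝓘(ℝ, F) p ⁻¹' V) := by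
    intro q hq
    refine ContMDiffAt.contMDiffWithinAt ?_
    have hq1 := hq.1
    rw [extChartAt_source] at hq1
    refine (contMDiffAt_along_iff (φ := fun x => x) (c := p) hq1).2 ⟨contMDiffAt_id, ?_⟩
    have h2 : ContMDiffAt 𝓘(ℝ, F) 𝓘(ℝ, F) ∞ (fun q => B (extChartAt 𝓘(ℝ, F) p q) a) q :=
      ContMDiffAt.comp (I' := 𝓘(ℝ, F)) q
        (((hV hq.2).2.1.clm_apply contDiffAt_const).contMDiffAt) (contMDiffAt_extChartAt' hq1)
    refine h2.congr_of_eventuallyEq ?_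
    filter_upwards [(isOpen_extChartAt_source (I := 𝓘(ℝ, F)) p).mem_nhds hq.1] with x hx
    exact toChart_chartField hx _
  have h2 : ∀ q ∈ (extChartAt 𝓘(ℝ, F) p).source ∩ extChartAt 𝓘(ℝ, F) p ⁻¹' V,
      X q ∈ orthDist H i D q := by
    intro q hq
    have h2 := (hV hq.2).2.2.2.1
    rw [(extChartAt 𝓘(ℝ, F) p).left_inv hq.1] at h2
    change fieldE X q ∈ fibre (orthDist H i D) q
    rw [← h2]
    exact ⟨_, ⟨a, rfl⟩, rfl⟩
  exact LCK.exists_isSection_eq (isOpen_extChartAt_preimage' p hVo)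
    ⟨mem_extChartAt_source p, hV0⟩ h1 h2

end Sections

section Equivalences

open Filter

variable {E : Type*} [NormedAddCommGroup E] [NormedSpace ℝ E] [FiniteDimensional ℝ E]
  {Mb : Type*} [TopologicalSpace Mb] [ChartedSpace E Mb] [IsManifold 𝓘(ℝ, E) ∞ Mb]
  {F : Type*} [NormedAddCommGroup F] [NormedSpace ℝ F] [FiniteDimensional ℝ F]
  {M : Type*} [TopologicalSpace M] [ChartedSpace F M] [IsManifold 𝓘(ℝ, F) ∞ M]
  {H : AlmostHermitian E Mb} {i : M → Mb}
  {D : ∀ p : M, Submodule ℝ (TangentSpace 𝓘(ℝ, F) p)}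

theorem smoothAlongAt_comp {P K : Type*} [NormedAddCommGroup K] [NormedSpace ℝ K]
    [TopologicalSpace P] [ChartedSpace K P] {X : ∀ q : M, TangentSpace 𝓘(ℝ, F) q}
    {j : P → M} {p : P} (hX : SmoothAlongAt F (fun q => q) X (j p))
    (hj : ContMDiffAt 𝓘(ℝ, K) 𝓘(ℝ, F) ∞ j p) :
    SmoothAlongAt K j (fun q => X (j q)) p :=
  ContMDiffAt.comp (I' := 𝓘(ℝ, F)) (f := j) p hX hj

/-- Weingarten formula for a normal field along a map `j` into a submanifold. -/
theorem formE_covDerivE_of_normal {P K : Type*} [NormedAddCommGroup K] [NormedSpace ℝ K]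
    [TopologicalSpace P] [ChartedSpace K P] [IsManifold 𝓘(ℝ, K) ∞ P]
    (hi : ContMDiff 𝓘(ℝ, F) 𝓘(ℝ, E) ∞ i) {j : P → M} {p : P}
    (hj : ContMDiffAt 𝓘(ℝ, K) 𝓘(ℝ, F) ∞ j p)
    {ξ : ∀ q : P, TangentSpace 𝓘(ℝ, E) (i (j q))}
    (hξ : SmoothAlongAt K (fun q => i (j q)) ξ p) (hn : ∀ q, ξ q ∈ normalSpace F H i (j q))
    (x : K) (z : F) :
    formE H.g (i (j p)) (covDerivE H.g (fun q => i (j q)) ξ p x) (diffE i (j p) z) =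
      -formE H.g (i (j p)) (valE ξ p) (hess H.g i (j p) (diffE j p x) z) := by
  have hg := H.isSmoothMetric_g
  have hZ : SmoothAlongAt K j (fun q => chartField (j p) z (j q)) p :=
    smoothAlongAt_comp (smoothAlongAt_chartField z (mem_extChartAt_source (I := 𝓘(ℝ, F)) (j p))) hj
  have h1 := hg.formE_covDerivE_of_orthogonal hξ (smoothAlongAt_diff hi hZ)
    (Eventually.of_forall fun q => hn q _) x
  have h2 : valE (E := F) (fun q => chartField (j p) z (j q)) p = z :=
    chartField_center (E := F) (j p) z
  have h3 : valE (fun q => diff (E := E) i (j q) (chartField (j p) z (j q))) p =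
      diffE (E := E) (F := F) i (j p) z := by
    change diffE (E := E) (F := F) i (j p)
      (valE (E := F) (fun q => chartField (j p) z (j q)) p) = _
    rw [h2]
  rw [h3] at h1
  refine h1.trans ?_
  rw [covDerivE_diff (F := F) hi hZ, hg.add_right, h2]
  have h4 : ∀ w : F, formE H.g (i (j p)) (valE ξ p) (diffE i (j p) w) = 0 := fun w => hn p w
  rw [h4, add_zero]

/-- The mixed components of the second fundamental form in the directions `J D^⊥` vanish; the
second fundamental form is the normal part of the Hessian of `i`. -/
def MixedVanishing (H : AlmostHermitian E Mb) (i : M → Mb)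
    (D : ∀ p : M, Submodule ℝ (TangentSpace 𝓘(ℝ, F) p)) : Prop :=
  ∀ p, ∀ x ∈ fibre (orthDist H i D) p, ∀ y ∈ fibre (orthDist H i D) p, ∀ z ∈ fibre D p,
    formE H.g (i p) (H.JE (i p) (diffE i p y)) (hess H.g i p x z) = 0

theorem SmoothField.smoothAlongAt {X : ∀ q : M, TangentSpace 𝓘(ℝ, F) q} (hX : SmoothField X)
    (p : M) : SmoothAlongAt F (fun q => q) X p :=
  (contMDiffOn_univ.1 hX) p

namespace IsCRSubmanifold

theorem formE_secondFundamentalForm (hM : IsCRSubmanifold H i D)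
    {X Z : ∀ q : M, TangentSpace 𝓘(ℝ, F) q} (hZ : SmoothField Z) {p : M} {y : F}
    (hy : y ∈ fibre (orthDist H i D) p) :
    formE H.g (i p) (secondFundamentalFormE H.g i X Z p) (H.JE (i p) (diffE i p y)) =
      formE H.g (i p) (H.JE (i p) (diffE i p y)) (hess H.g i p (fieldE X p) (fieldE Z p)) := by
  have hg := H.isSmoothMetric_g
  have hn := hM.formE_JE_orthDist hy
  have h2 := covDerivE_diff (g := H.g) hM.immersion.smooth (hZ.smoothAlongAt p) (fieldE X p)
  rw [diffE_id] at h2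
  rw [secondFundamentalFormE_eq, hg.sub_left, hg.formE_symm _ (diffE i p _), hn, sub_zero,
    hg.formE_symm]
  refine (congrArg (formE H.g (i p) (H.JE (i p) (diffE i p y))) h2).trans ?_
  rw [hg.add_right, hn, add_zero]
  rfl

theorem secondFundamentalForm_mem_mu_iff [T2Space M] (hM : IsCRSubmanifold H i D)
    {lee : ∀ x : Mb, TangentSpace 𝓘(ℝ, E) x →L[ℝ] ℝ} (hlee : H.IsLeeForm lee) :
    (∀ X Y : ∀ p : M, TangentSpace 𝓘(ℝ, F) p,
        IsSection (orthDist H i D) X → IsSection D Y →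
          ∀ p, secondFundamentalForm H.g i X Y p ∈ muBundle H i D p) ↔ MixedVanishing H i D := by
  have hg := H.isSmoothMetric_g
  constructor
  · intro h p x hx y hy z hz
    obtain ⟨X, hX, rfl⟩ := hM.exists_isSection_orthDist_eq hlee hx
    obtain ⟨Z, hZ, rfl⟩ := hM.smooth.exists_isSection_eq hz
    rw [← hM.formE_secondFundamentalForm hZ.1 hy]
    exact (h X Z hX hZ p).2 _ ⟨y, hy, rfl⟩
  · intro h X Z hX hZ p
    refine ⟨fun w => ?_, ?_⟩
    · have h1 := hg.formE_tangentialPart hM.immersion p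
        (covDerivE H.g i (fun q => diff (E := E) i q (Z q)) p (fieldE X p)) w
      exact (hg.sub_left (i p) _ _ (diffE (E := E) (F := F) i p w)).trans (sub_eq_zero (G := ℝ).2
          h1.symm)
    · rintro - ⟨y, hy, rfl⟩
      exact (hM.formE_secondFundamentalForm hZ.1 hy).trans (h p _ (hX.2 p) y hy _ (hZ.2 p))

theorem isSectionJ (hM : IsCRSubmanifold H i D) {D' : ∀ p : M, Submodule ℝ (TangentSpace 𝓘(ℝ, F) p)}
    {Y : ∀ q : M, TangentSpace 𝓘(ℝ, F) q} (hY : IsSection D' Y) :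
    IsSectionJ H i D' fun q => H.J (i q) (diff i q (Y q)) :=
  ⟨fun q => H.smoothAlongAt_J
    (smoothAlongAt_diff hM.immersion.smooth (hY.1.smoothAlongAt q)), fun q => ⟨_, hY.2 q, rfl⟩⟩

theorem formE_shapeOperator (hM : IsCRSubmanifold H i D)
    {ξ : ∀ q : M, TangentSpace 𝓘(ℝ, E) (i q)} (hξ : IsSectionJ H i (orthDist H i D) ξ)
    (X : ∀ q : M, TangentSpace 𝓘(ℝ, F) q) (p : M) (z : F) :
    formE H.g (i p) (diffE i p (shapeOperatorE H.g i ξ X p)) (diffE i p z) =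
      formE H.g (i p) (valE ξ p) (hess H.g i p (fieldE X p) z) := by
  have hg := H.isSmoothMetric_g
  rw [shapeOperatorE_eq, map_neg, hg.neg_left, hg.formE_tangentialPart hM.immersion]
  have h2 := formE_covDerivE_of_normal (H := H) (j := fun q : M => q) (p := p) hM.immersion.smooth
    contMDiffAt_id (hξ.1 p) (fun q => hM.totallyReal q (hξ.2 q)) (fieldE X p) z
  rw [diffE_id] at h2
  have h3 : -formE H.g (i p) (covDerivE H.g i ξ p (fieldE X p)) (diffE i p z) =
      - -formE H.g (i p) (valE ξ p) (hess H.g i p (fieldE X p) z) := congrArg Neg.neg h2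
  rw [h3, neg_neg]

theorem isShapeInvariant_orthDist_iff [T2Space M] (hM : IsCRSubmanifold H i D)
    {lee : ∀ x : Mb, TangentSpace 𝓘(ℝ, E) x →L[ℝ] ℝ} (hlee : H.IsLeeForm lee) :
    (∀ ξ : ∀ p : M, TangentSpace 𝓘(ℝ, E) (i p), IsSectionJ H i (orthDist H i D) ξ →
      IsShapeInvariant H i ξ (orthDist H i D)) ↔ MixedVanishing H i D := by
  have hg := H.isSmoothMetric_g
  constructor
  · intro h p x hx y hy z hz
    obtain ⟨X, hX, rfl⟩ := hM.exists_isSection_orthDist_eq hlee hx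
    obtain ⟨Y, hY, rfl⟩ := hM.exists_isSection_orthDist_eq hlee hy
    have h1 := hM.formE_shapeOperator (hM.isSectionJ hY) X p z
    refine h1.symm.trans ?_
    rw [hg.formE_symm]
    exact h _ (hM.isSectionJ hY) X hX p z hz
  · intro h ξ hξ X hX p
    change shapeOperatorE H.g i ξ X p ∈ fibre (orthDist H i D) p
    refine mem_fibre_orthDist.2 fun z hz => ?_
    obtain ⟨y, hy, hy'⟩ : ∃ y ∈ fibre (orthDist H i D) p, H.JE (i p) (diffE i p y) = valE ξ p :=
      hξ.2 p
    rw [hg.formE_symm]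
    refine (hM.formE_shapeOperator hξ X p z).trans ?_
    rw [← hy']
    exact h p _ (hX.2 p) y hy z hz

theorem isShapeInvariant_iff [T2Space M] (hM : IsCRSubmanifold H i D)
    {lee : ∀ x : Mb, TangentSpace 𝓘(ℝ, E) x →L[ℝ] ℝ} (hlee : H.IsLeeForm lee) :
    (∀ ξ : ∀ p : M, TangentSpace 𝓘(ℝ, E) (i p), IsSectionJ H i (orthDist H i D) ξ →
      IsShapeInvariant H i ξ D) ↔ MixedVanishing H i D := by
  have hg := H.isSmoothMetric_g
  constructor
  · intro h p x hx y hy z hz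
    obtain ⟨Z, hZ, rfl⟩ := hM.smooth.exists_isSection_eq hz
    obtain ⟨Y, hY, rfl⟩ := hM.exists_isSection_orthDist_eq hlee hy
    rw [hg.hess_symm hM.immersion.smooth]
    have h1 := hM.formE_shapeOperator (hM.isSectionJ hY) Z p x
    exact h1.symm.trans (mem_fibre_orthDist.1 hx _ (h _ (hM.isSectionJ hY) Z hZ p))
  · intro h ξ hξ Z hZ p
    change shapeOperatorE H.g i ξ Z p ∈ fibre D p
    refine hM.mem_of_forall_orthogonal fun x hx => ?_
    obtain ⟨y, hy, hy'⟩ : ∃ y ∈ fibre (orthDist H i D) p, H.JE (i p) (diffE i p y) = valE ξ p :=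
      hξ.2 p
    refine (hM.formE_shapeOperator hξ Z p x).trans ?_
    rw [← hy', hg.hess_symm hM.immersion.smooth]
    exact h p x hx y hy _ (hZ.2 p)

end IsCRSubmanifold

end Equivalences

/-! ### Leaves of the totally real foliation -/

section OpenSubsets

open Filter Topology

variable {K : Type*} [NormedAddCommGroup K] [NormedSpace ℝ K] {L : Type*} [TopologicalSpace L]
  [ChartedSpace K L] [IsManifold 𝓘(ℝ, K) ∞ L] {e : L → K}

/-- If all preferred charts are the same map `e`, the differential of `e` is the identity, by the
identification of tangent spaces with the model space. -/
theorem mfderiv_of_chartAt_eq (he : ∀ q, ⇑(chartAt K q) = e) (q : L) (v : K) :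
    mfderiv 𝓘(ℝ, K) 𝓘(ℝ, K) e q v = v := by
  have h1 : ⇑(extChartAt 𝓘(ℝ, K) q) = e := by
    rw [extChartAt_coe, he]; rfl
  have h2 := toChart_self q v
  unfold toChart at h2
  rw [h1] at h2
  exact h2

theorem smoothField_const_of_chartAt_eq (he : ∀ q, ⇑(chartAt K q) = e)
    (hs : ∀ q : L, (chartAt K q).source = Set.univ) (v : K) :
    SmoothField (fun q : L => (show TangentSpace 𝓘(ℝ, K) q from v)) := by
  intro q _
  refine ContMDiffAt.contMDiffWithinAt ?_
  refine (contMDiffAt_along_iff (φ := fun x => x) (c := q) (by rw [hs]; trivial)).2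
    ⟨contMDiffAt_id, ?_⟩
  refine (contMDiffAt_const (c := v)).congr_of_eventuallyEq (Eventually.of_forall fun x => ?_)
  have h1 : ⇑(extChartAt 𝓘(ℝ, K) q) = e := by
    rw [extChartAt_coe, he]; rfl
  change mfderiv 𝓘(ℝ, K) 𝓘(ℝ, K) (extChartAt 𝓘(ℝ, K) q) x v = v
  rw [h1]
  exact mfderiv_of_chartAt_eq he x v

end OpenSubsets

section Leaves

open Filter Metric

universe u

variable {E : Type*} [NormedAddCommGroup E] [NormedSpace ℝ E] [FiniteDimensional ℝ E]
  {Mb : Type*} [TopologicalSpace Mb] [ChartedSpace E Mb] [IsManifold 𝓘(ℝ, E) ∞ Mb]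
  {F : Type*} [NormedAddCommGroup F] [NormedSpace ℝ F] [FiniteDimensional ℝ F]
  {M : Type u} [TopologicalSpace M] [ChartedSpace F M] [IsManifold 𝓘(ℝ, F) ∞ M]
  {H : AlmostHermitian E Mb} {i : M → Mb}
  {D : ∀ p : M, Submodule ℝ (TangentSpace 𝓘(ℝ, F) p)}

namespace IsCRSubmanifold

/-- Through each point there passes a connected integral manifold of `D^⊥`. -/
theorem exists_isIntegralManifold (hM : IsCRSubmanifold H i D)
    {lee : ∀ x : Mb, TangentSpace 𝓘(ℝ, E) x →L[ℝ] ℝ} (hlee : H.IsLeeForm lee) (p : M) :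
    ∃ (k : ℕ) (L : Type u) (_ : TopologicalSpace L)
      (_ : ChartedSpace (EuclideanSpace ℝ (Fin k)) L)
      (_ : IsManifold 𝓘(ℝ, EuclideanSpace ℝ (Fin k)) ∞ L) (j : L → M) (q : L),
      IsIntegralManifold (k := k) (orthDist H i D) j ∧ j q = p ∧
        ∀ v : EuclideanSpace ℝ (Fin k), ∃ X : ∀ q : L, TangentSpace 𝓘(ℝ, EuclideanSpace ℝ (Fin k))
            q,
          SmoothField X ∧ fieldE X q = v := by
  obtain ⟨k, B, π, hB⟩ := hM.exists_commuting_frame hlee p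
  have : CompleteSpace F := FiniteDimensional.complete ℝ F
  let K := EuclideanSpace ℝ (Fin k)
  obtain ⟨r, hr, f, hf0, hf⟩ := exists_hasFDerivAt_of_commuting
    (hB.self_of_nhds.2.1.of_le (by simpa using WithTop.coe_le_coe.2 (le_top : (2 : ℕ∞) ≤ ⊤)))
        (hB.mono fun z hz => hz.2.2.2.2) hB
  -- the leaf is a ball of parameters, with the inclusion as its only chart
  let L : Type u := ULift.{u} (ball (0 : K) r)
  let e : L → K := fun q => q.down
  have he : Topology.IsOpenEmbedding e :=
    isOpen_ball.isOpenEmbedding_subtypeVal.comp Homeomorph.ulift.isOpenEmbedding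
  have hne : Nonempty L := ⟨⟨⟨0, mem_ball_self hr⟩⟩⟩
  let : ChartedSpace K L := he.singletonChartedSpace
  have hmf : IsManifold 𝓘(ℝ, K) ∞ L := he.isManifold_singleton
  have hchart : ∀ q : L, ⇑(chartAt K q) = e := fun q => rfl
  have hsource : ∀ q : L, (chartAt K q).source = Set.univ := fun q =>
    OpenPartialHomeomorph.singletonChartedSpace_chartAt_source _ _
  have hesm : ContMDiff 𝓘(ℝ, K) 𝓘(ℝ, K) ∞ e := contMDiff_isOpenEmbedding he
  have hball : ∀ q : L, e q ∈ ball (0 : K) r := fun q => q.down.2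
  have hfsm : ContDiffOn ℝ ∞ f (ball (0 : K) r) :=
    contDiffOn_of_hasFDerivAt_comp (n := ⊤) isOpen_ball (fun a ha => (hf a ha).1.2.1)
      fun a ha => (hf a ha).2
  let j : L → M := fun q => (extChartAt 𝓘(ℝ, F) p).symm (f (e q))
  have hfe : ∀ q : L, ContMDiffAt 𝓘(ℝ, K) 𝓘(ℝ, F) ∞ (fun q => f (e q)) q := fun q =>
    ContMDiffAt.comp (I' := 𝓘(ℝ, K)) (f := e) q
      ((hfsm.contDiffAt (isOpen_ball.mem_nhds (hball q))).contMDiffAt) (hesm q)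
  have hjsm : ContMDiff 𝓘(ℝ, K) 𝓘(ℝ, F) ∞ j := fun q =>
    ContMDiffAt.comp (I' := 𝓘(ℝ, F)) (f := fun q => f (e q)) q
      (contMDiffAt_extChartAt_symm_center (hf _ (hball q)).1.1) (hfe q)
  have hdj : ∀ (q : L) (v : K), diffE (E := F) (F := K) j q v =
      fromChartE p (f (e q)) (B (f (e q)) v) := by
    intro q v
    have h1 : HasMFDerivAt 𝓘(ℝ, K) 𝓘(ℝ, K) e q (mfderiv 𝓘(ℝ, K) 𝓘(ℝ, K) e q) :=
      ((hesm q).mdifferentiableAt (by simp)).hasMFDerivAt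
    have h2 : HasMFDerivAt 𝓘(ℝ, K) 𝓘(ℝ, F) f (e q) (B (f (e q))) :=
      (hf _ (hball q)).2.hasMFDerivAt
    have h3 := ((contMDiffAt_extChartAt_symm_center (hf _ (hball q)).1.1).mdifferentiableAt
      (by simp)).hasMFDerivAt
    have h4 := DFunLike.congr_fun (HasMFDerivAt.comp q h3 (HasMFDerivAt.comp q h2 h1)).mfderiv v
    refine Eq.trans h4 ?_
    have h5 := mfderiv_of_chartAt_eq hchart q v
    exact congrArg (fun w : K => fromChartE p (f (e q)) (B (f (e q)) w)) h5
  -- the projection `π` recovers the parameter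
  have hπf : ∀ s ∈ ball (0 : K) r, π (f s) = π (f 0) + s := by
    intro s hs
    have h1 : ∀ s ∈ ball (0 : K) r, HasFDerivAt (fun s => π (f s) - s) (0 : K →L[ℝ] K) s := by
      intro s hs
      have h2 := (π.hasFDerivAt.comp s (hf s hs).2).sub (hasFDerivAt_id s)
      have h3 : π ∘L B (f s) - ContinuousLinearMap.id ℝ K = 0 := by
        ext1 a
        exact sub_eq_zero.2 ((hf s hs).1.2.2.1 a)
      rw [h3] at h2
      exact h2
    have h4 := (convex_ball (0 : K) r).is_const_of_fderivWithin_eq_zero (𝕜 := ℝ)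
      (fun s hs => (h1 s hs).differentiableAt.differentiableWithinAt)
      (fun s hs => (h1 s hs).hasFDerivWithinAt.fderivWithin
        (isOpen_ball.uniqueDiffWithinAt hs)) hs (mem_ball_self hr)
    simp only [sub_zero] at h4
    rw [← h4]
    abel
  have hinj : Function.Injective j := by
    intro q q' h
    have h1 := (extChartAt 𝓘(ℝ, F) p).symm.injOn (hf _ (hball q)).1.1 (hf _ (hball q')).1.1 h
    have h2 := hπf _ (hball q)
    rw [h1, hπf _ (hball q')] at h2
    exact he.injective (add_left_cancel h2).symm
  have hconn : ConnectedSpace L := by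
    have : ConnectedSpace (ball (0 : K) r) :=
      isConnected_iff_connectedSpace.1 ⟨⟨0, mem_ball_self hr⟩, (convex_ball _ _).isPreconnected⟩
    exact Homeomorph.ulift.symm.surjective.connectedSpace Homeomorph.ulift.symm.continuous
  refine ⟨k, L, inferInstance, inferInstance, hmf, j, ⟨⟨0, mem_ball_self hr⟩⟩,
    ⟨hconn, hinj, ⟨hjsm, fun q v w h => ?_⟩, fun q => ?_⟩, ?_, fun v => ?_⟩
  · have h1 : fromChartE p (f (e q)) (B (f (e q)) v) = fromChartE p (f (e q)) (B (f (e q)) w) :=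
      ((hdj q v).symm.trans h).trans (hdj q w)
    have h2 := congrArg π ((fromChartEquiv p (hf _ (hball q)).1.1).injective h1)
    exact (((hf _ (hball q)).1.2.2.1 v).symm.trans h2).trans ((hf _ (hball q)).1.2.2.1 w)
  · have h1 := (hf _ (hball q)).1.2.2.2.1
    have h2 : LinearMap.range (diffE (E := F) (F := K) j q).toLinearMap =
        fibre (orthDist H i D) (j q) := by
      rw [← h1]
      ext w
      constructor
      · rintro ⟨v, rfl⟩
        exact ⟨_, ⟨v, rfl⟩, (hdj q v).symm⟩
      · rintro ⟨-, ⟨v, rfl⟩, rfl⟩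
        exact ⟨v, hdj q v⟩
    exact h2
  · change (extChartAt 𝓘(ℝ, F) p).symm (f 0) = p
    rw [hf0, extChartAt_to_inv]
  · exact ⟨_, smoothField_const_of_chartAt_eq hchart hsource v, rfl⟩

/-- The component in `D` of the covariant derivative, on the submanifold, of a field tangent to an
integral manifold `j` of `D^⊥`; the direction in `D` is written as `J` of a vector. As `J` is
parallel up to a term which does not contribute, `J` can be moved to the tangent field, which
becomes normal to the submanifold. -/
theorem formE_covDerivE_integralManifold (hM : IsCRSubmanifold H i D) (hH : H.IsLCK)
    {lee : ∀ x : Mb, TangentSpace 𝓘(ℝ, E) x →L[ℝ] ℝ} (hlee : H.IsLeeForm lee)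
    (hB : ∀ p : M, H.leeField lee (i p) ∈ normalSpace F H i p) {k : ℕ}
    {L : Type*} [TopologicalSpace L] [ChartedSpace (EuclideanSpace ℝ (Fin k)) L]
    [IsManifold 𝓘(ℝ, EuclideanSpace ℝ (Fin k)) ∞ L] {j : L → M}
    (hj : IsIntegralManifold (k := k) (orthDist H i D) j)
    {Y : ∀ q : L, TangentSpace 𝓘(ℝ, EuclideanSpace ℝ (Fin k)) q} (hY : SmoothField Y) (q : L)
    (x : EuclideanSpace ℝ (Fin k)) {z z' : F} (hz' : z' ∈ fibre D (j q))
    (hzz' : diffE (E := E) i (j q) z = H.JE (i (j q)) (diffE i (j q) z')) :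
    formE (inducedMetric (F := F) H.g i) (j q)
        (covDerivE (inducedMetric (F := F) H.g i) j (fun q => diff (E := F) j q (Y q)) q x) z =
      formE H.g (i (j q)) (H.JE (i (j q)) (diffE i (j q) (diffE (E := F) (F := EuclideanSpace ℝ
          (Fin k)) j q (fieldE Y q))))
        (hess H.g i (j q) (diffE (E := F) (F := EuclideanSpace ℝ (Fin k)) j q x) z') := by
  have hg := H.isSmoothMetric_g
  have hmem : ∀ (q : L) v, diffE (E := F) (F := EuclideanSpace ℝ (Fin k)) j q v ∈ fibre (orthDist H
      i D) (j q) := fun q v => by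
    have h : LinearMap.range (diffE (E := F) (F := EuclideanSpace ℝ (Fin k)) j q).toLinearMap =
        fibre (orthDist H i D) (j q) :=
      hj.tangent q
    rw [← h]
    exact ⟨v, rfl⟩
  have hV : SmoothAlongAt (EuclideanSpace ℝ (Fin k)) j (fun q => diff (E := F) j q (Y q)) q :=
    smoothAlongAt_diff (j := fun q : L => q) hj.immersion.smooth (hY.smoothAlongAt q)
  have hV' := smoothAlongAt_diff hM.immersion.smooth hV
  refine (hg.formE_covDerivE_inducedMetric hM.immersion hV x z).trans ?_
  rw [hzz', hg.formE_symm, H.formE_JE_left, hg.formE_symm]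
  have h1 := H.covDerivE_J hV' x
  have h2 := hM.formE_nablaJ_eq_zero hH hlee (hB (j q)) (hmem q x) (hmem q (fieldE (F :=
      EuclideanSpace ℝ (Fin k)) Y q)) hz'
  have h3 : diffE (E := E) (F := EuclideanSpace ℝ (Fin k)) (fun q => i (j q)) q x =
      diffE (E := E) (F := F) i (j q) (diffE (E := F) (F := EuclideanSpace ℝ (Fin k)) j q x) :=
    DFunLike.congr_fun (mfderiv_comp q ((hM.immersion.smooth (j q)).mdifferentiableAt (by simp))
      ((hj.immersion.smooth q).mdifferentiableAt (by simp))) x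
  have h4 := formE_covDerivE_of_normal (H := H) hM.immersion.smooth (hj.immersion.smooth q)
    (H.smoothAlongAt_J hV') (fun q => hM.totallyReal (j q) ⟨_, hmem q (fieldE (F := EuclideanSpace
        ℝ (Fin k)) Y q), rfl⟩) x z'
  rw [h1, h3, hg.add_left] at h4
  have h5 : formE H.g (i (j q)) (H.nablaJ (i (j q)) (diffE i (j q) (diffE (E := F) (F :=
      EuclideanSpace ℝ (Fin k)) j q x))
    (valE (fun q => diff (E := E) i (j q) (diff (E := F) j q (Y q))) q)) (diffE i (j q) z') = 0 :=
        h2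
  rw [h5, add_zero] at h4
  rw [h4, neg_neg]
  rfl

/-- The second fundamental form of a leaf in `M` takes values in `D`, so it is determined by
`formE_covDerivE_integralManifold`. -/
theorem isTotallyGeodesicFoliation_iff (hM : IsCRSubmanifold H i D) (hH : H.IsLCK)
    {lee : ∀ x : Mb, TangentSpace 𝓘(ℝ, E) x →L[ℝ] ℝ} (hlee : H.IsLeeForm lee)
    (hB : ∀ p : M, H.leeField lee (i p) ∈ normalSpace F H i p) :
    IsTotallyGeodesicFoliation (inducedMetric (F := F) H.g i) (orthDist H i D) ↔
      MixedVanishing H i D := by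
  have hg := H.isSmoothMetric_g
  have hgM := hg.inducedMetric hM.immersion
  constructor
  · intro h p x hx y hy z hz
    obtain ⟨k, L, _, _, _, j, q, hj, rfl, hX⟩ := hM.exists_isIntegralManifold hlee p
    have hrange : LinearMap.range (diffE (E := F) (F := EuclideanSpace ℝ (Fin k)) j q).toLinearMap =
      fibre (orthDist H i D) (j q) := hj.tangent q
    rw [← hrange] at hx hy
    obtain ⟨x, rfl⟩ := hx
    obtain ⟨y, rfl⟩ := hy
    obtain ⟨X, hXs, rfl⟩ := hX x
    obtain ⟨Y, hYs, rfl⟩ := hX y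
    obtain ⟨a, ha, haz⟩ := hM.exists_JE_diffE_eq hz
    refine (hM.formE_covDerivE_integralManifold hH hlee hB hj hYs q (fieldE X q) hz
      haz.symm).symm.trans ?_
    have h1 : secondFundamentalFormE (inducedMetric (F := F) H.g i) j X Y q = 0 :=
      h k L j hj X Y hXs hYs q
    rw [secondFundamentalFormE_eq, sub_eq_zero] at h1
    rw [h1, hgM.formE_symm]
    have h2 : diffE (E := F) (F := EuclideanSpace ℝ (Fin k)) j q
        (tangentialPartE (inducedMetric (F := F) H.g i) j q
          (covDerivE (inducedMetric (F := F) H.g i) j (fun q => diff (E := F) j q (Y q)) q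
            (fieldE X q))) ∈ fibre (orthDist H i D) (j q) := hrange ▸ ⟨_, rfl⟩
    exact mem_fibre_orthDist.1 h2 a ha
  · intro h k L _ _ _ j hj X Y hX hY q
    have hrange : LinearMap.range (diffE (E := F) (F := EuclideanSpace ℝ (Fin k)) j q).toLinearMap =
      fibre (orthDist H i D) (j q) := hj.tangent q
    have hmem : ∀ v, diffE (E := F) (F := EuclideanSpace ℝ (Fin k)) j q v ∈
      fibre (orthDist H i D) (j q) := fun v => hrange ▸ ⟨v, rfl⟩
    change secondFundamentalFormE (inducedMetric (F := F) H.g i) j X Y q = 0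
    refine hgM.eq_zero_of_forall (q := j q) fun u => ?_
    obtain ⟨a, ha, b, hb, rfl⟩ := Submodule.mem_sup.1
      ((hM.isCompl (j q)).sup_eq_top ▸ Submodule.mem_top : u ∈ _)
    rw [secondFundamentalFormE_eq, hgM.add_right, hgM.sub_left, hgM.sub_left]
    obtain ⟨a', ha', haa'⟩ := hM.exists_diffE_eq_JE ha
    rw [hM.formE_covDerivE_integralManifold hH hlee hB hj hY q (fieldE X q) ha' haa',
      h (j q) _ (hmem _) _ (hmem _) a' ha']
    have h1 : ∀ v, formE (inducedMetric (F := F) H.g i) (j q) (diffE j q v) a = 0 := fun v => by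
      rw [hgM.formE_symm]
      exact mem_fibre_orthDist.1 (hmem v) a ha
    rw [h1]
    rw [← hrange] at hb
    obtain ⟨b, rfl⟩ := hb
    have h2 := hgM.formE_tangentialPart hj.immersion q
      (covDerivE (inducedMetric (F := F) H.g i) j (fun q => diff (E := F) j q (Y q)) q
        (fieldE X q)) b
    rw [sub_self, zero_add, sub_eq_zero]
    exact h2.symm

end IsCRSubmanifold

end Leaves

end LCK

end

theorem mainTheorem4
    {E : Type*} [NormedAddCommGroup E] [NormedSpace ℝ E] [FiniteDimensional ℝ E]
    {Mb : Type*} [TopologicalSpace Mb] [ChartedSpace E Mb] [IsManifold 𝓘(ℝ, E) ∞ Mb] [T2Space Mb]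
    {F : Type*} [NormedAddCommGroup F] [NormedSpace ℝ F] [FiniteDimensional ℝ F]
    {M : Type*} [TopologicalSpace M] [ChartedSpace F M] [IsManifold 𝓘(ℝ, F) ∞ M] [T2Space M]
    (H : LCK.AlmostHermitian E Mb) (hH : H.IsLCK)
    (lee : ∀ x : Mb, TangentSpace 𝓘(ℝ, E) x →L[ℝ] ℝ) (hlee : H.IsLeeForm lee)
    (i : M → Mb) (D : ∀ p : M, Submodule ℝ (TangentSpace 𝓘(ℝ, F) p))
    (hM : LCK.IsCRSubmanifold H i D)
    (hB : ∀ p : M, H.leeField lee (i p) ∈ LCK.normalSpace F H i p) :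
    List.TFAE [
      LCK.IsTotallyGeodesicFoliation (LCK.inducedMetric (F := F) H.g i) (LCK.orthDist H i D),
      ∀ X Y : ∀ p : M, TangentSpace 𝓘(ℝ, F) p,
        LCK.IsSection (LCK.orthDist H i D) X → LCK.IsSection D Y →
          ∀ p, LCK.secondFundamentalForm H.g i X Y p ∈ LCK.muBundle H i D p,
      ∀ ξ : ∀ p : M, TangentSpace 𝓘(ℝ, E) (i p),
        LCK.IsSectionJ H i (LCK.orthDist H i D) ξ →
          LCK.IsShapeInvariant H i ξ (LCK.orthDist H i D),
      ∀ ξ : ∀ p : M, TangentSpace 𝓘(ℝ, E) (i p),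
        LCK.IsSectionJ H i (LCK.orthDist H i D) ξ → LCK.IsShapeInvariant H i ξ D] := by
  have h1 := hM.isTotallyGeodesicFoliation_iff hH hlee hB
  have h2 := hM.secondFundamentalForm_mem_mu_iff hlee
  have h3 := hM.isShapeInvariant_orthDist_iff hlee
  have h4 := hM.isShapeInvariant_iff hlee
  tfae_have 1 ↔ 2 := h1.trans h2.symm
  tfae_have 2 ↔ 3 := h2.trans h3.symm
  tfae_have 3 ↔ 4 := h3.trans h4.symm
  tfae_finish
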